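/- **Setting.** Let $M$ be an $n$-dimensional connected paracompact (Hausdorff) smooth manifold, $\pi:T^*M\to M$ its cotangent bundle, with canonical symplectic form $\sigma=\sum_i dp_i\wedge dq_i$. If $h:T^*M\to\mathbb R$ is differentiable at $\ell$, its Hamiltonian vector $\vec h(\ell)$ is defined by $\langle dh(\ell),\cdot\rangle=\sigma_\ell(\cdot,\vec h(\ell))$. "Locally Lipschitz" for maps between manifolds means continuous and Lipschitz in local charts near each point. A *solution* of $\dot\lambda=\vec H_t(\lambda)$ on an interval $K$ is a locally Lipschitz curve on $K$ such that for a.e. $t\in K$ the function $H_t$ is differentiable at $\lambda(t)$ and $\dot\lambda(t)=\vec H_t(\lambda(t))$. Consider the Bolza problem of minimising $c_0(\xi(0))+c_f(\xi(T))+\int_0^Tf^0(\xi,\upsilon)\,dt$ subject to $\dot\xi=f(\xi,\upsilon)$, $\xi(0)\in N_0$, $\xi(T)\in N_f$, $\upsilon\in L^\infty([0,T],U)$, $U\subseteq\mathbb R^m$, with $f,f^0$ being $C^\infty$ on an open set containing $D\times U$ ($D\subseteq M$ open), and $c_0,c_f$ being $C^\infty$ near the constraint sets $N_0,N_f\subseteq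 M$; the final time is fixed or variable. For $p_0\in\{0,1\}$ let $$F(\ell,u)=\langle \ell,f(\pi\ell,u)\rangle-p_0f^0(\pi\ell,u),\qquad F_{\max}(\ell)=\sup_{u\in U}F(\ell,u)\in[-\infty,+\infty].$$ Let $0<\widehat T<T$, let $J$ be an open interval containing $I:=[0,T]$, and let $S$ be an interval with $[0,\widehat T]\subseteq S\subseteq J$ ($S=[0,\widehat T]$ and $S=J$ are allowed). **Reference extremal (PMP on $S$).** Let $\widehat\upsilon\in L^\infty(S,U)$ and $\widehat F_t:=F(\cdot,\widehat\upsilon(t))$; let $\widehat\lambda:S\to\pi^{-1}(D)$ be a solution of $\dot\lambda=\vec{\widehat F}_t(\lambda)$ with $\widehat\xi:=\pi\circ\widehat\lambda$, $\widehat\xi(0)\in N_0$, $\widehat x_f:=\widehat\xi(\widehat T)\in N_f$, $(p_0,\widehat\lambda|_{[0,\widehat T]})$ non-trivial, and $\widehat F_t(\widehat\lambda(t))=F_{\max}(\widehat\lambda(t))$ for a.e. $t\in S$; moreover $\widehat F_t(\widehat\lambda(t))$ is a.e. equal on $S$ to a constant, which is $0$ if the final time is variable. Put $\widehat\ell_0=\widehat\lambda(0)$,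 $\widehat\ell_f=\widehat\lambda(\widehat T)$. Let $\alpha$ be $C^\infty$ on an open set $W\ni\widehat\xi(0)$ with $\alpha=p_0c_0$ on $N_0\cap W$ and $d\alpha(\widehat\xi(0))=\widehat\ell_0$, and let $\beta$ be $C^\infty$ on an open set $V\ni\widehat x_f$ with $\beta=p_0c_f$ on $N_f\cap V$ and $-d\beta(\widehat x_f)=\widehat\ell_f$. Let $\Lambda=\{d\alpha(x):x\in W\}$. **Assumption 1 (regularity of $H$).** $\mathcal O\supseteq\Lambda$ is open in $T^*M$, $H:J\times\mathcal O\to\mathbb R$, and: (a) the Hamiltonian flow $\mathcal H:J\times\Lambda\to T^*M$ of $\vec H_t$ is well defined (for each $\ell\in\Lambda$, $t\mapsto\mathcal H_t(\ell)$ is a solution in $\mathcal O$ on $J$ with value $\ell$ at $t=0$, and each solution in $\mathcal O$ on a subinterval of $J$ containing $0$ with value $\ell$ at $0$ agrees with it) and locally Lipschitz in $(t,\ell)$; (b) the function $L(t,\ell)=\langle\mathcal H_t(\ell),\pi_*\vec H_t(\mathcal H_t(\ell))\rangle-H_t(\mathcal H_t(\ell))$ is Lipschitz–Carathéodory on $J\times\Lambda$: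 it coincides, for each $\ell$ and a.e. $t$, with a function that is bounded and measurable in $t$ for each $\ell$, and that near each point of $\Lambda$ is Lipschitz in $\ell$ with one constant for a.e. $t\in J$; (c) for a.e. $t\in J$, at each point $z_0\in\mathcal H_t(\Lambda)$ one has $H_t(z)-H_t(z_0)=O(|z-z_0|)$ as $z\to z_0$ (e.g. $H_t$ is differentiable at $z_0$, or Lipschitz near $z_0$). **Assumption 2 (super-Hamiltonian).** For a.e. $t\in S$: $H_t(\mathcal H_t(\ell))\ge F_{\max}(\mathcal H_t(\ell))$ for all $\ell\in\Lambda$ with $\pi\mathcal H_t(\ell)\in D$; $H_t(\widehat\lambda(t))=\widehat F_t(\widehat\lambda(t))=F_{\max}(\widehat\lambda(t))$; $\vec H_t(\widehat\lambda(t))=\vec{\widehat F}_t(\widehat\lambda(t))$. Here $\widehat\lambda(S)\subseteq\mathcal O$. **Assumption 3.** The map $(t,\ell)\mapsto(t,\pi\mathcal H_t(\ell))$ is injective on $I\times\Lambda$, locally Lipschitz with locally Lipschitz inverse, and its image $\mathcal U$ is open in $I\times M$ and contains the graph of $\widehat\xi|_{[0,\widehat T]}$. Let $\theta(t,\ell)=\alpha(\pi\ell)+\int_0^tL(s,\ell)\,ds$,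 $\alpha_t=\theta_t\circ(\pi\mathcal H_t)^{-1}$ and $\Phi(t,x)=\beta(x)+\theta(t,(\pi\mathcal H_t)^{-1}(x))=(\beta+\alpha_t)(x)$ for $(t,x)\in\mathcal U$. **Lemma.** Under these assumptions: (i) for all $(t,x)\in\mathcal U$ with $x\in V$, $\alpha_t$ and $\Phi(t,\cdot)$ are differentiable at $x$, $d\alpha_t(x)=\mathcal H_t\circ(\pi\mathcal H_t)^{-1}(x)$, and $$\partial_x\Phi(t,x)=d\beta(x)+\mathcal H_t\circ(\pi\mathcal H_t)^{-1}(x)=d(\beta+\alpha_t)(x);$$ (ii) for every $x\in M$ and a.e. $t\in I$ with $(t,x)\in\mathcal U$, $\Phi(\cdot,x)$ is differentiable at $t$ and $$\partial_t\Phi(t,x)=-H_t\circ\mathcal H_t\circ(\pi\mathcal H_t)^{-1}(x)=-H_t(d\alpha_t(x));$$ (iii) $\partial_x\Phi(\widehat T,\widehat x_f)=0$; and if the final time is variable, then $d\Phi(\widehat T,\widehat x_f)=0$, in the sense that $\Phi$, restricted to times $t\in S$, is (Fréchet) differentiable at $(\widehat T,\widehat x_f)$ with differential $0$. In particular this is the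 full differential of $\Phi$ when $S=J$. -/

import Mathlib

open Set Filter MeasureTheory
open scoped Manifold ContDiff Topology

/-! ### Lipschitz maps between manifolds -/

/-- `f` is locally Lipschitz on `s`: near each point of `s` it is continuous and Lipschitz in
charts. This is local Lipschitz continuity for the distances of any Riemannian metrics on the two
manifolds, since on compact sets all of these are equivalent to the chart distance. -/
def LocLipschitzOn
    {E₁ H₁ M₁ E₂ H₂ M₂ : Type*}
    [NormedAddCommGroup E₁] [NormedSpace ℝ E₁] [TopologicalSpace H₁]
    (I₁ : ModelWithCorners ℝ E₁ H₁) [TopologicalSpace M₁] [ChartedSpace H₁ M₁]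
    [NormedAddCommGroup E₂] [NormedSpace ℝ E₂] [TopologicalSpace H₂]
    (I₂ : ModelWithCorners ℝ E₂ H₂) [TopologicalSpace M₂] [ChartedSpace H₂ M₂]
    (f : M₁ → M₂) (s : Set M₁) : Prop :=
  ∀ x ∈ s, ContinuousWithinAt f s x ∧
    ∃ C : ℝ, ∃ u ∈ 𝓝[s] x, ∀ y ∈ u, ∀ z ∈ u,
      dist (extChartAt I₂ (f x) (f y)) (extChartAt I₂ (f x) (f z)) ≤
        C * dist (extChartAt I₁ x y) (extChartAt I₁ x z)

/-- `f` is injective on `s`, locally Lipschitz, and its inverse `f '' s → s` is locally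
Lipschitz. -/
def LocBiLipschitzOn
    {E₁ H₁ M₁ E₂ H₂ M₂ : Type*}
    [NormedAddCommGroup E₁] [NormedSpace ℝ E₁] [TopologicalSpace H₁]
    (I₁ : ModelWithCorners ℝ E₁ H₁) [TopologicalSpace M₁] [ChartedSpace H₁ M₁]
    [NormedAddCommGroup E₂] [NormedSpace ℝ E₂] [TopologicalSpace H₂]
    (I₂ : ModelWithCorners ℝ E₂ H₂) [TopologicalSpace M₂] [ChartedSpace H₂ M₂]
    (f : M₁ → M₂) (s : Set M₁) : Prop :=
  LocLipschitzOn I₁ I₂ f s ∧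
    ∃ g : M₂ → M₁, LeftInvOn g f s ∧ LocLipschitzOn I₂ I₁ g (f '' s)

/-! ### The cotangent bundle and its symplectic structure -/

/-- The cotangent bundle `T*M` of an `n`-dimensional manifold, as the smooth vector bundle of
continuous linear functionals on the tangent spaces. An element `z` consists of `z.proj = π z` and
of the covector `z.2` at `z.proj`. -/
abbrev Ctg (n : ℕ) (M : Type*) [TopologicalSpace M]
    [ChartedSpace (EuclideanSpace ℝ (Fin n)) M] [IsManifold (𝓡 n) ∞ M] : Type _ :=
  Bundle.TotalSpace (EuclideanSpace ℝ (Fin n) →L[ℝ] ℝ)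
    (fun x : M => TangentSpace (𝓡 n) x →L[ℝ] Bundle.Trivial M ℝ x)

/-- The model with corners of `T*M`; its preferred charts are the canonical coordinates `(q, p)`
induced by the charts of `M`. -/
noncomputable abbrev ctgModel (n : ℕ) :=
  (𝓡 n).prod 𝓘(ℝ, EuclideanSpace ℝ (Fin n) →L[ℝ] ℝ)

section Symplectic

variable {n : ℕ} {M : Type*} [TopologicalSpace M]
  [ChartedSpace (EuclideanSpace ℝ (Fin n)) M] [IsManifold (𝓡 n) ∞ M]

/-- The differential of `g : M → ℝ` at `x`, as a covector at `x`. -/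
noncomputable def covec (g : M → ℝ) (x : M) : TangentSpace (𝓡 n) x →L[ℝ] ℝ :=
  mfderiv (𝓡 n) 𝓘(ℝ, ℝ) g x

/-- The differential of `g : M → ℝ` at `x`, as a point of `T*M`. -/
noncomputable def dAt (g : M → ℝ) (x : M) : Ctg n M :=
  ⟨x, covec g x⟩

/-- The canonical symplectic form `∑ dpᵢ ∧ dqᵢ` at `z`. The tangent space of `T*M` at `z` is
the space of pairs `(δq, δp)` of components in the canonical coordinates of the preferred chart
at `z`. -/
noncomputable def symplecticForm (z : Ctg n M) (v w : TangentSpace (ctgModel n) z) : ℝ :=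
  let v' : EuclideanSpace ℝ (Fin n) × (EuclideanSpace ℝ (Fin n) →L[ℝ] ℝ) := v
  let w' : EuclideanSpace ℝ (Fin n) × (EuclideanSpace ℝ (Fin n) →L[ℝ] ℝ) := w
  v'.2 w'.1 - w'.2 v'.1

/-- `h` is differentiable at `z`, and `X` is the value at `z` of its Hamiltonian vector field:
`⟨dh(z), w⟩ = σ_z(w, X)` for all `w`. -/
def IsHamVec (h : Ctg n M → ℝ) (z : Ctg n M) (X : TangentSpace (ctgModel n) z) : Prop :=
  MDifferentiableAt (ctgModel n) 𝓘(ℝ, ℝ) h z ∧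
    ∀ w : TangentSpace (ctgModel n) z,
      mfderiv (ctgModel n) 𝓘(ℝ, ℝ) h z w = symplecticForm z w X

open Classical in
/-- The Hamiltonian vector field of `h` (zero at points where `h` is not differentiable). -/
noncomputable def hamVec (h : Ctg n M → ℝ) (z : Ctg n M) : TangentSpace (ctgModel n) z :=
  if hX : ∃ X, IsHamVec h z X then hX.choose else 0

/-- `c` is a (locally Lipschitz) solution in `O`, on the time set `K`, of the Hamiltonian system
`c'(t) = →H_t(c(t))` for a.e. `t`. -/
def IsHamSolution (H : ℝ → Ctg n M → ℝ) (O : Set (Ctg n M)) (K : Set ℝ) (c : ℝ → Ctg n M) :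
    Prop :=
  LocLipschitzOn 𝓘(ℝ, ℝ) (ctgModel n) c K ∧ MapsTo c K O ∧
    ∀ᵐ t ∂volume.restrict K, ∃ X : TangentSpace (ctgModel n) (c t),
      IsHamVec (H t) (c t) X ∧
      HasMFDerivAt 𝓘(ℝ, ℝ) (ctgModel n) c t ((1 : ℝ →L[ℝ] ℝ).smulRight X)

/-- The flow of `→H_t` on `J × Λ` is well defined and given by `Hc`: for every `ℓ ∈ Λ` the curve
`t ↦ Hc t ℓ` solves the Hamiltonian system on `J` with value `ℓ` at time `0`, and every solution
on a subinterval of `J` containing `0` with this initial value agrees with it. -/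
def IsHamFlow (H : ℝ → Ctg n M → ℝ) (O : Set (Ctg n M)) (J : Set ℝ) (Λ : Set (Ctg n M))
    (Hc : ℝ → Ctg n M → Ctg n M) : Prop :=
  ∀ ℓ ∈ Λ, Hc 0 ℓ = ℓ ∧ IsHamSolution H O J (fun t => Hc t ℓ) ∧
    ∀ K : Set ℝ, K.OrdConnected → 0 ∈ K → K ⊆ J →
      ∀ c : ℝ → Ctg n M, c 0 = ℓ → IsHamSolution H O K c → EqOn c (fun t => Hc t ℓ) K

/-- Lipschitz-Caratheodory real functions on `J × Λ`: bounded and measurable in `t` for each `ℓ`,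
and, locally uniformly in `ℓ`, Lipschitz in `ℓ` with an essentially bounded constant. -/
def IsLipCaratheodory (G : ℝ → Ctg n M → ℝ) (J : Set ℝ) (Λ : Set (Ctg n M)) : Prop :=
  (∀ ℓ ∈ Λ, AEMeasurable (fun t => G t ℓ) (volume.restrict J) ∧ ∃ C : ℝ, ∀ t ∈ J, |G t ℓ| ≤ C) ∧
  ∀ ℓ ∈ Λ, ∃ C : ℝ, ∃ u ∈ 𝓝[Λ] ℓ, ∀ᵐ t ∂volume.restrict J, ∀ y ∈ u, ∀ z ∈ u,
    |G t y - G t z| ≤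
      C * dist (extChartAt (ctgModel n) ℓ y) (extChartAt (ctgModel n) ℓ z)

/-- The graph `{dα(x) : x ∈ W}`. -/
def graphOfD (α : M → ℝ) (W : Set M) : Set (Ctg n M) := dAt α '' W

/-- The function `⟨Hc_t(ℓ), π_* →H_t(Hc_t(ℓ))⟩ - H_t(Hc_t(ℓ))`. -/
noncomputable def cartanIntegrand (H : ℝ → Ctg n M → ℝ) (Hc : ℝ → Ctg n M → Ctg n M)
    (t : ℝ) (ℓ : Ctg n M) : ℝ :=
  (Hc t ℓ).2 (mfderiv (ctgModel n) (𝓡 n)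
    (Bundle.TotalSpace.proj : Ctg n M → M) (Hc t ℓ) (hamVec (H t) (Hc t ℓ))) - H t (Hc t ℓ)

/-- `θ(t, ℓ) = α(π ℓ) + ∫₀ᵗ (⟨Hc_s(ℓ), π_* →H_s(Hc_s(ℓ))⟩ - H_s(Hc_s(ℓ))) ds`. -/
noncomputable def theta (α : M → ℝ) (H : ℝ → Ctg n M → ℝ) (Hc : ℝ → Ctg n M → Ctg n M)
    (t : ℝ) (ℓ : Ctg n M) : ℝ :=
  α ℓ.proj + ∫ s in (0 : ℝ)..t, cartanIntegrand H Hc s ℓ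

/-- `(π Hc_t)⁻¹(x)`, the inverse of `π ∘ Hc_t` on `Λ`. -/
noncomputable def projFlowInv (Λ : Set (Ctg n M)) (Hc : ℝ → Ctg n M → Ctg n M)
    (t : ℝ) (x : M) : Ctg n M :=
  haveI : Nonempty (Ctg n M) := ⟨⟨x, 0⟩⟩
  Function.invFunOn (fun ℓ => (Hc t ℓ).proj) Λ x

/-- `α_t = θ_t ∘ (π Hc_t)⁻¹`, where `Λ = {dα(x) : x ∈ W}`. -/
noncomputable def alphaT (α : M → ℝ) (W : Set M) (H : ℝ → Ctg n M → ℝ)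
    (Hc : ℝ → Ctg n M → Ctg n M) (t : ℝ) (x : M) : ℝ :=
  theta α H Hc t (projFlowInv (graphOfD α W) Hc t x)

/-- `Φ(t, x) = β(x) + θ(t, (π Hc_t)⁻¹(x)) = (β + α_t)(x)`. -/
noncomputable def Phi (α β : M → ℝ) (W : Set M) (H : ℝ → Ctg n M → ℝ)
    (Hc : ℝ → Ctg n M → Ctg n M) (t : ℝ) (x : M) : ℝ :=
  β x + alphaT α W H Hc t x

/-- The regularity assumption on the Hamiltonian `H : J × O → ℝ`, where `Λ = {dα(x) : x ∈ W}`. -/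
structure HamiltonianAssumption (α : M → ℝ) (W : Set M) (H : ℝ → Ctg n M → ℝ)
    (J : Set ℝ) (O : Set (Ctg n M)) (Hc : ℝ → Ctg n M → Ctg n M) : Prop where
  isOpen_O : IsOpen O
  subset_O : graphOfD α W ⊆ O
  flow : IsHamFlow H O J (graphOfD α W) Hc
  flow_lipschitz : LocLipschitzOn (𝓘(ℝ, ℝ).prod (ctgModel n)) (ctgModel n)
    (fun q : ℝ × Ctg n M => Hc q.1 q.2) (J ×ˢ graphOfD α W)
  /-- The integrand is Lipschitz-Caratheodory, up to a null set of times for each `ℓ`. -/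
  integrand : ∃ G : ℝ → Ctg n M → ℝ, IsLipCaratheodory G J (graphOfD α W) ∧
    ∀ ℓ ∈ graphOfD α W, ∀ᵐ t ∂volume.restrict J, G t ℓ = cartanIntegrand H Hc t ℓ
  /-- For a.e. `t`, at each point `z₀` of `Hc_t(Λ)`, `H_t(z) - H_t(z₀) = O(|z - z₀|)`. This holds
  if `H_t` is differentiable at `z₀` or Lipschitz near `z₀`. -/
  calm : ∀ᵐ t ∂volume.restrict J, ∀ ℓ ∈ graphOfD α W,
    (fun z => H t z - H t (Hc t ℓ)) =O[𝓝 (Hc t ℓ)]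
      (fun z => extChartAt (ctgModel n) (Hc t ℓ) z - extChartAt (ctgModel n) (Hc t ℓ) (Hc t ℓ))

end Symplectic

/-! ### The optimal control problem and its Pontryagin extremals -/

/-- The data of the Bolza problem: minimise `c₀(ξ(0)) + c_f(ξ(T)) + ∫₀ᵀ f⁰(ξ, υ) dt` subject to
`ξ' = f(ξ, υ)`, `ξ(0) ∈ N₀`, `ξ(T) ∈ N_f`, `υ ∈ L^∞([0, T], U)`. The dynamics and the running cost
are smooth on an open set containing `D × U`. -/
structure ControlProblem (n m : ℕ) (M : Type*) [TopologicalSpace M]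
    [ChartedSpace (EuclideanSpace ℝ (Fin n)) M] [IsManifold (𝓡 n) ∞ M] where
  U : Set (EuclideanSpace ℝ (Fin m))
  D : Set M
  isOpen_D : IsOpen D
  dom : Set (M × EuclideanSpace ℝ (Fin m))
  isOpen_dom : IsOpen dom
  subset_dom : D ×ˢ U ⊆ dom
  f : (x : M) → EuclideanSpace ℝ (Fin m) → TangentSpace (𝓡 n) x
  f0 : M → EuclideanSpace ℝ (Fin m) → ℝ
  smooth_f : ContMDiffOn ((𝓡 n).prod 𝓘(ℝ, EuclideanSpace ℝ (Fin m))) (𝓡 n).tangent ∞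
    (fun q : M × EuclideanSpace ℝ (Fin m) => (⟨q.1, f q.1 q.2⟩ : TangentBundle (𝓡 n) M)) dom
  smooth_f0 : ContMDiffOn ((𝓡 n).prod 𝓘(ℝ, EuclideanSpace ℝ (Fin m))) 𝓘(ℝ, ℝ) ∞
    (fun q : M × EuclideanSpace ℝ (Fin m) => f0 q.1 q.2) dom
  N₀ : Set M
  Nf : Set M
  c₀ : M → ℝ
  cf : M → ℝ
  smooth_c₀ : ∃ V, IsOpen V ∧ N₀ ⊆ V ∧ ContMDiffOn (𝓡 n) 𝓘(ℝ, ℝ) ∞ c₀ V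
  smooth_cf : ∃ V, IsOpen V ∧ Nf ⊆ V ∧ ContMDiffOn (𝓡 n) 𝓘(ℝ, ℝ) ∞ cf V

namespace ControlProblem

variable {n m : ℕ} {M : Type*} [TopologicalSpace M]
  [ChartedSpace (EuclideanSpace ℝ (Fin n)) M] [IsManifold (𝓡 n) ∞ M]

/-- The pre-Hamiltonian `F(ℓ, u) = ⟨ℓ, f(π ℓ, u)⟩ - p₀ f⁰(π ℓ, u)`. -/
noncomputable def preHam (P : ControlProblem n m M) (p₀ : ℝ) (z : Ctg n M) (u : EuclideanSpace ℝ (Fin m)) : ℝ :=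
  z.2 (P.f z.proj u) - p₀ * P.f0 z.proj u

/-- The maximised Hamiltonian `F_max(ℓ) = sup_{u ∈ U} F(ℓ, u)`, with values in `[-∞, +∞]`. -/
noncomputable def maxHam (P : ControlProblem n m M) (p₀ : ℝ) (z : Ctg n M) : EReal :=
  ⨆ u ∈ P.U, ((P.preHam p₀ z u : ℝ) : EReal)

/-- The Pontryagin maximum principle for the reference control `u` and the extremal `lam`, whose
projection `π ∘ lam` is the reference trajectory, with reference final time `Tf`, on the time
interval `S ⊇ [0, Tf]`. `freeTime` says that the final time is variable. -/
structure PMP (P : ControlProblem n m M) (freeTime : Prop) (p₀ Tf : ℝ) (S : Set ℝ)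
    (u : ℝ → EuclideanSpace ℝ (Fin m)) (lam : ℝ → Ctg n M) : Prop where
  multiplier : p₀ = 0 ∨ p₀ = 1
  nontrivial : p₀ ≠ 0 ∨ ∃ t ∈ Icc 0 Tf, (lam t).2 ≠ 0
  control_memLp : MemLp u ⊤ (volume.restrict S)
  control_mem : ∀ᵐ t ∂volume.restrict S, u t ∈ P.U
  initial_mem : (lam 0).proj ∈ P.N₀
  final_mem : (lam Tf).proj ∈ P.Nf
  /-- `lam` stays in `π⁻¹(D)` and solves the Hamiltonian system of `F̂_t(ℓ) = F(ℓ, u(t))`. -/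
  solution : IsHamSolution (fun t z => P.preHam p₀ z (u t))
    (Bundle.TotalSpace.proj ⁻¹' P.D) S lam
  maximality : ∀ᵐ t ∂volume.restrict S,
    ((P.preHam p₀ (lam t) (u t) : ℝ) : EReal) = P.maxHam p₀ (lam t)
  constant : ∃ c : ℝ, (freeTime → c = 0) ∧
    ∀ᵐ t ∂volume.restrict S, P.preHam p₀ (lam t) (u t) = c

/-- The super-Hamiltonian assumption, with the equalities along `lam` on the time interval `S`. -/
structure SuperHamiltonian (P : ControlProblem n m M) (p₀ : ℝ) (S : Set ℝ)
    (u : ℝ → EuclideanSpace ℝ (Fin m)) (lam : ℝ → Ctg n M)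
    (H : ℝ → Ctg n M → ℝ) (O : Set (Ctg n M)) (Λ : Set (Ctg n M))
    (Hc : ℝ → Ctg n M → Ctg n M) : Prop where
  ge_maxHam : ∀ᵐ t ∂volume.restrict S, ∀ ℓ ∈ Λ, (Hc t ℓ).proj ∈ P.D →
    P.maxHam p₀ (Hc t ℓ) ≤ ((H t (Hc t ℓ) : ℝ) : EReal)
  mem_O : MapsTo lam S O
  eq_along : ∀ᵐ t ∂volume.restrict S,
    H t (lam t) = P.preHam p₀ (lam t) (u t) ∧
      ((H t (lam t) : ℝ) : EReal) = P.maxHam p₀ (lam t)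
  /-- `H_t` is differentiable at `lam t`, and `→H_t = →F̂_t` there. -/
  hamVec_along : ∀ᵐ t ∂volume.restrict S, ∃ X : TangentSpace (ctgModel n) (lam t),
    IsHamVec (H t) (lam t) X ∧ IsHamVec (fun z => P.preHam p₀ z (u t)) (lam t) X

end ControlProblem

/-- The map `(t, ℓ) ↦ (t, π Hc_t(ℓ))` is bi-Lipschitz between `[0, T] × Λ` and a relatively open
set `𝒰` of `[0, T] × M`, which contains the graph of the trajectory `π ∘ lam` on `[0, Tf]`. -/
structure ProjFlowInvertible {n : ℕ} {M : Type*} [TopologicalSpace M]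
    [ChartedSpace (EuclideanSpace ℝ (Fin n)) M] [IsManifold (𝓡 n) ∞ M]
    (Tf T : ℝ) (lam : ℝ → Ctg n M) (Λ : Set (Ctg n M)) (Hc : ℝ → Ctg n M → Ctg n M)
    (𝒰 : Set (ℝ × M)) : Prop where
  image_eq : (fun q : ℝ × Ctg n M => (q.1, (Hc q.1 q.2).proj)) '' (Icc 0 T ×ˢ Λ) = 𝒰
  rel_open : ∃ V : Set (ℝ × M), IsOpen V ∧ 𝒰 = V ∩ (Icc 0 T ×ˢ univ)
  biLipschitz : LocBiLipschitzOn (𝓘(ℝ, ℝ).prod (ctgModel n)) (𝓘(ℝ, ℝ).prod (𝓡 n))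
    (fun q : ℝ × Ctg n M => (q.1, (Hc q.1 q.2).proj)) (Icc 0 T ×ˢ Λ)
  graph_mem : ∀ t ∈ Icc 0 Tf, (t, (lam t).proj) ∈ 𝒰

/-! This is the method of characteristics. `Λ` is the graph of `dα`, so `p dq` restricted to it has
the primitive `α ∘ π`. By Cartan's formula the pull-back of `p dq` by the flow changes in time by
the differential of the integrand of `theta`. Hence `dθ_t` is the pull-back of `p dq` by `Hc t`.
Since the projected flow is invertible, `α_t` has differential `Hc_t ∘ (π Hc_t)⁻¹` and solves the
Hamilton-Jacobi equation. At the end of the extremal, `dβ` cancels the momentum; when the final time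
is free, the energy along the extremal vanishes as well.

The flow is only Lipschitz, and `H_t` is known to be differentiable at `Hc t ℓ` only for a.e. `t`,
with a null set depending on `ℓ`. Cartan's formula is therefore proved along Lipschitz curves in
`Λ`, at a.e. parameter (`ae_hasDerivAt_action`). The difference quotient of the action, minus its
boundary terms, is a Taylor remainder of `H_t` plus the integral of `(Δp / Δs) · (Δq)'`. The
remainder tends to zero by dominated convergence, because for a.e. `t` the energy is Lipschitz
across the family with one constant (`intervalIntegrable_and_ae_lipschitzWith_energy`). This is
where calmness is needed: a derivative bound almost everywhere gives a Lipschitz bound only if null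
sets have null images. The other term is handled by weak convergence
(`tendsto_integral_pairing_deriv_zero`).

The formula passes from time `0` to all of `J` through windows covered by one canonical chart
(`HamiltonianAssumption.thetaVariation`). Integrated along coordinate segments, it makes `α_t`
differentiable, with a quadratic remainder because the momentum is Lipschitz in the base point
(`hasMFDerivAt_alphaT`).

For the time derivative at a fixed `x`, one follows the trajectory that passes through `x` at time
`s`. Comparing the action with the expansion of `α_t` in space gives `α_t(x) - α_s(x) = -∫ H + O((t
- s)²)`, the integral being taken along that trajectory (`exists_alphaT_time_estimate`). Lebesgue
differentiation on the diagonal yields the derivative almost everywhere. The same estimate along the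
extremal, where the integral vanishes, gives Fréchet differentiability in `(t, x)`
(`hasMFDerivWithinAt_Phi`). -/

open scoped NNReal

/-! ### Canonical charts of the cotangent bundle and their transition maps. -/

section
variable {n : ℕ} {M : Type*} [TopologicalSpace M]
  [ChartedSpace (EuclideanSpace ℝ (Fin n)) M] [IsManifold (𝓡 n) ∞ M]

theorem ctg_extChartAt_fst (z₀ z : Ctg n M) :
    (extChartAt (ctgModel n) z₀ z).1 = extChartAt (𝓡 n) z₀.proj z.proj := by
  rw [FiberBundle.extChartAt]
  rfl

theorem mem_ctg_source {z₀ z : Ctg n M} :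
    z ∈ (extChartAt (ctgModel n) z₀).source ↔ z.proj ∈ (extChartAt (𝓡 n) z₀.proj).source := by
  rw [FiberBundle.extChartAt]
  simp only [mfld_simps]
  simp
  intro h
  rw [hom_trivializationAt_apply]
  exact h

/-- The trivialisation of the Hom bundle conjugates by that of the tangent bundle, which is the
derivative of the base chart, so the duality pairing is unchanged. -/
theorem ctg_extChartAt_snd {z₀ z : Ctg n M} (h : z.proj ∈ (extChartAt (𝓡 n) z₀.proj).source)
    (v : EuclideanSpace ℝ (Fin n)) :
    (extChartAt (ctgModel n) z₀ z).2
      (mfderiv (𝓡 n) 𝓘(ℝ, EuclideanSpace ℝ (Fin n)) (extChartAt (𝓡 n) z₀.proj) z.proj v) =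
      z.2 v := by
  rw [extChartAt_source] at h
  rw [← TangentBundle.continuousLinearMapAt_trivializationAt h]
  rw [FiberBundle.extChartAt]
  have := (trivializationAt (EuclideanSpace ℝ (Fin n)) (TangentSpace (𝓡 n)) z₀.proj).symmL_continuousLinearMapAt (R := ℝ) (b := z.proj) (by simpa using h) v
  have e : (trivializationAt (EuclideanSpace ℝ (Fin n) →L[ℝ] ℝ)
      (fun x : M => TangentSpace (𝓡 n) x →L[ℝ] Bundle.Trivial M ℝ x) z₀.proj z).2 =
      ContinuousLinearMap.inCoordinates (EuclideanSpace ℝ (Fin n)) (TangentSpace (𝓡 n)) ℝ (Bundle.Trivial M ℝ) z₀.proj z.proj z₀.proj z.proj z.2 := by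
    rw [hom_trivializationAt_apply]
  simp only [PartialEquiv.coe_trans, Function.comp, PartialEquiv.prod_coe, PartialEquiv.refl_coe, id]
  refine (DFunLike.congr_fun e _).trans ?_
  refine Eq.trans ?_ (congrArg z.2 this)
  have key : ∀ w : ℝ, Bundle.Trivialization.continuousLinearMapAt ℝ
      (trivializationAt ℝ (Bundle.Trivial M ℝ) z₀.proj) z.proj w = w := fun w =>
    DFunLike.congr_fun (Bundle.Trivial.continuousLinearMapAt_trivialization ℝ M ℝ z.proj) w
  exact key _

/-- The cotangent lift of a change of coordinates preserves the canonical symplectic form. -/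
theorem symplectic_transition {E : Type*} [NormedAddCommGroup E] [NormedSpace ℝ E]
    {κ : E → E} {K : E × (E →L[ℝ] ℝ) → E × (E →L[ℝ] ℝ)} {c : E × (E →L[ℝ] ℝ)}
    {K' : E × (E →L[ℝ] ℝ) →L[ℝ] E × (E →L[ℝ] ℝ)}
    (hκ : ContDiffAt ℝ 2 κ c.1) (hK : HasFDerivAt K K' c)
    (h1 : ∀ᶠ w in 𝓝 c, (K w).1 = κ w.1)
    (h2 : ∀ᶠ w in 𝓝 c, ((K w).2).comp (fderiv ℝ κ w.1) = w.2) (v w : E × (E →L[ℝ] ℝ)) :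
    (K' v).2 (K' w).1 - (K' w).2 (K' v).1 = v.2 w.1 - w.2 v.1 := by
  -- Differentiating the lift produces second derivatives of `κ`. They enter the form
  -- antisymmetrised, so their symmetry removes them.
  have hs : ∀ a b, fderiv ℝ (fderiv ℝ κ) c.1 a b = fderiv ℝ (fderiv ℝ κ) c.1 b a := by
    have := hκ.isSymmSndFDerivAt (by simp)
    exact fun a b => this a b
  have hd : HasFDerivAt (fun w : E × (E →L[ℝ] ℝ) => fderiv ℝ κ w.1)
      ((fderiv ℝ (fderiv ℝ κ) c.1).comp (ContinuousLinearMap.fst ℝ E (E →L[ℝ] ℝ))) c :=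
    ((hκ.fderiv_right (m := 1) (by norm_num)).differentiableAt (by norm_num)).hasFDerivAt.comp c
      hasFDerivAt_fst
  have e1 : ∀ v, (K' v).1 = fderiv ℝ κ c.1 v.1 := by
    have a1 := hK.fst
    have a2 : HasFDerivAt (fun w : E × (E →L[ℝ] ℝ) => κ w.1)
        ((fderiv ℝ κ c.1).comp (ContinuousLinearMap.fst ℝ E (E →L[ℝ] ℝ))) c :=
      ((hκ.differentiableAt (by norm_num)).hasFDerivAt).comp c
        (hasFDerivAt_fst (E := E) (F := E →L[ℝ] ℝ))
    have := a1.unique (a2.congr_of_eventuallyEq h1)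
    exact fun v => DFunLike.congr_fun this v
  -- The product rule is applied to `p̃ ∘ Dκ = p`, which avoids inverting `Dκ`.
  have e2 : ∀ v b, (K' v).2 (fderiv ℝ κ c.1 b) + (K c).2 (fderiv ℝ (fderiv ℝ κ) c.1 v.1 b)
      = v.2 b := by
    have a1 := hK.snd.clm_comp hd
    have a2 : HasFDerivAt (fun w : E × (E →L[ℝ] ℝ) => w.2)
        (ContinuousLinearMap.snd ℝ E (E →L[ℝ] ℝ)) c := hasFDerivAt_snd
    have := a1.unique (a2.congr_of_eventuallyEq h2)
    intro v b
    have := DFunLike.congr_fun (DFunLike.congr_fun this v) b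
    simp at this
    rw [← this]; ring
  rw [← e2 v w.1, ← e2 w v.1, e1, e1, hs w.1 v.1]
  ring
end

/-! ### Derivatives of extended charts and of functions read in them. -/

section
variable {E H N F : Type*} [NormedAddCommGroup E] [NormedSpace ℝ E]
    [TopologicalSpace H] {I : ModelWithCorners ℝ E H} [TopologicalSpace N]
    [ChartedSpace H N] [NormedAddCommGroup F] [NormedSpace ℝ F]

/-- The derivative at `y` of the extended chart at `x`, as an endomorphism of the model space. -/
noncomputable def chartDeriv (I : ModelWithCorners ℝ E H) (x y : N) : E →L[ℝ] E :=
  mfderiv I 𝓘(ℝ, E) (extChartAt I x) y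

/-- The derivative at the image of `y` of the inverse of the extended chart at `x`, as an
endomorphism of the model space. -/
noncomputable def chartSymmDeriv (I : ModelWithCorners ℝ E H) (x y : N) : E →L[ℝ] E :=
  mfderiv 𝓘(ℝ, E) I (extChartAt I x).symm (extChartAt I x y)

theorem contDiffAt_extChartAt_transition [I.Boundaryless] {k : ℕ∞ω} [IsManifold I k N] {x₀ x y : N}
    (h₀ : y ∈ (extChartAt I x₀).source) (h : y ∈ (extChartAt I x).source) :
    ContDiffAt ℝ k (extChartAt I x₀ ∘ (extChartAt I x).symm) (extChartAt I x y) := by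
  have := contDiffWithinAt_ext_coord_change (I := I) (n := k) x₀ x (y := extChartAt I x y)
    ⟨(extChartAt I x).map_source h, by
      change (extChartAt I x).symm (extChartAt I x y) ∈ (extChartAt I x₀).source
      rwa [(extChartAt I x).left_inv h]⟩
  rwa [I.range_eq_univ, contDiffWithinAt_univ] at this

variable [IsManifold I 1 N]

theorem hasMFDerivAt_extChartAt_of_mem {x y : N} (h : y ∈ (extChartAt I x).source) :
    HasMFDerivAt I 𝓘(ℝ, E) (extChartAt I x) y (chartDeriv I x y : E →L[ℝ] E) :=
  (mdifferentiableAt_extChartAt (by rwa [extChartAt_source] at h)).hasMFDerivAt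

theorem chartDeriv_self (x : N) : chartDeriv I x x = ContinuousLinearMap.id ℝ E :=
  mfderiv_extChartAt_self

theorem HasMFDerivAt.hasDerivAt_extChartAt {x : N} {c : ℝ → N} {t : ℝ} {X : E}
    (hc : HasMFDerivAt 𝓘(ℝ, ℝ) I c t ((1 : ℝ →L[ℝ] ℝ).smulRight X : ℝ →L[ℝ] E))
    (h : c t ∈ (extChartAt I x).source) :
    HasDerivAt (fun s => extChartAt I x (c s)) (chartDeriv I x (c t) X) t := by
  have : HasFDerivAt (fun s => extChartAt I x (c s))
      ((chartDeriv I x (c t)).comp ((1 : ℝ →L[ℝ] ℝ).smulRight X)) t :=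
    hasMFDerivAt_iff_hasFDerivAt.1
      (HasMFDerivAt.comp (I' := I) t (hasMFDerivAt_extChartAt_of_mem h) hc)
  simpa using this.hasDerivAt

variable [I.Boundaryless]

theorem chartSymmDeriv_chartDeriv {x y : N} (h : y ∈ (extChartAt I x).source) (v : E) :
    chartSymmDeriv I x y (chartDeriv I x y v) = v := by
  have := mfderivWithin_extChartAt_symm_comp_mfderiv_extChartAt' (I := I) h
  rw [I.range_eq_univ, mfderivWithin_univ] at this
  exact DFunLike.congr_fun this v

theorem chartDeriv_chartSymmDeriv {x y : N} (h : y ∈ (extChartAt I x).source) (v : E) :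
    chartDeriv I x y (chartSymmDeriv I x y v) = v := by
  have := mfderiv_extChartAt_comp_mfderivWithin_extChartAt_symm' (I := I) h
  rw [I.range_eq_univ, mfderivWithin_univ] at this
  exact DFunLike.congr_fun this v

theorem hasMFDerivAt_extChartAt_symm_of_mem {x y : N} (h : y ∈ (extChartAt I x).source) :
    HasMFDerivAt 𝓘(ℝ, E) I (extChartAt I x).symm (extChartAt I x y)
      (chartSymmDeriv I x y : E →L[ℝ] E) := by
  have := mdifferentiableWithinAt_extChartAt_symm (I := I) ((extChartAt I x).map_source h)
  rw [I.range_eq_univ, mdifferentiableWithinAt_univ] at this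
  exact this.hasMFDerivAt

/-- The derivative of a function on a manifold, read in the chart at `x`. -/
theorem hasMFDerivAt_comp_chartDeriv_iff {x y : N} (h : y ∈ (extChartAt I x).source) {f : N → F}
    {G : E →L[ℝ] F} :
    HasMFDerivAt I 𝓘(ℝ, F) f y (G.comp (chartDeriv I x y) : E →L[ℝ] F) ↔
      HasFDerivAt (f ∘ (extChartAt I x).symm) G (extChartAt I x y) := by
  constructor
  · intro hf
    have hl := (extChartAt I x).left_inv h
    have := HasMFDerivAt.comp (I' := I) (extChartAt I x y) (g := f) (f := (extChartAt I x).symm)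
      (g' := (G.comp (chartDeriv I x y) : E →L[ℝ] F))
      (by rw [hl]; exact hf) (hasMFDerivAt_extChartAt_symm_of_mem h)
    have h2 : HasFDerivAt (f ∘ (extChartAt I x).symm)
      ((G.comp (chartDeriv I x y)).comp (chartSymmDeriv I x y)) (extChartAt I x y) :=
      hasMFDerivAt_iff_hasFDerivAt.1 this
    have h3 : (G.comp (chartDeriv I x y)).comp (chartSymmDeriv I x y) = G := by
      ext v
      simp [chartDeriv_chartSymmDeriv h]
    rwa [h3] at h2
  · intro hf
    have := HasMFDerivAt.comp (I' := 𝓘(ℝ, E)) y (g := f ∘ (extChartAt I x).symm) (f := extChartAt I x)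
      hf.hasMFDerivAt (hasMFDerivAt_extChartAt_of_mem h)
    refine this.congr_of_eventuallyEq ?_
    filter_upwards [(isOpen_extChartAt_source (I := I) x).mem_nhds h] with w hw
    simp only [Function.comp, (extChartAt I x).left_inv hw]

theorem hasMFDerivAt_iff_comp_symm {x y : N} (h : y ∈ (extChartAt I x).source) {f : N → F}
    {f' : E →L[ℝ] F} :
    HasMFDerivAt I 𝓘(ℝ, F) f y f' ↔
      HasFDerivAt (f ∘ (extChartAt I x).symm) (f'.comp (chartSymmDeriv I x y))
        (extChartAt I x y) := by
  rw [← hasMFDerivAt_comp_chartDeriv_iff h]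
  have : (f'.comp (chartSymmDeriv I x y)).comp (chartDeriv I x y) = f' := by
    ext v
    simp [chartSymmDeriv_chartDeriv h]
  rw [this]

theorem fderiv_transition {x₀ x y : N} (h₀ : y ∈ (extChartAt I x₀).source)
    (h : y ∈ (extChartAt I x).source) (v : E) :
    fderiv ℝ (extChartAt I x₀ ∘ (extChartAt I x).symm) (extChartAt I x y)
      (chartDeriv I x y v) = chartDeriv I x₀ y v := by
  rw [((hasMFDerivAt_iff_comp_symm h).1 (hasMFDerivAt_extChartAt_of_mem h₀)).fderiv]
  simp [chartSymmDeriv_chartDeriv h]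

end

/-! ### Hamilton's equations and the Lagrangian in canonical coordinates. -/

section
variable {n : ℕ} {M : Type*} [TopologicalSpace M]
  [ChartedSpace (EuclideanSpace ℝ (Fin n)) M] [IsManifold (𝓡 n) ∞ M]

theorem ctg_extChartAt_snd_apply {z₀ z : Ctg n M} (h : z.proj ∈ (extChartAt (𝓡 n) z₀.proj).source)
    (v : EuclideanSpace ℝ (Fin n)) :
    (extChartAt (ctgModel n) z₀ z).2 (chartDeriv (𝓡 n) z₀.proj z.proj v) = z.2 v :=
  ctg_extChartAt_snd h v

/-- The canonical symplectic form has constant coefficients in every canonical chart. -/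
theorem symplecticForm_eq {z₀ z : Ctg n M} (h : z ∈ (extChartAt (ctgModel n) z₀).source)
    (v w : EuclideanSpace ℝ (Fin n) × (EuclideanSpace ℝ (Fin n) →L[ℝ] ℝ)) :
    symplecticForm z v w = (chartDeriv (ctgModel n) z₀ z v).2 (chartDeriv (ctgModel n) z₀ z w).1 -
      (chartDeriv (ctgModel n) z₀ z w).2 (chartDeriv (ctgModel n) z₀ z v).1 := by
  have hz := mem_extChartAt_source (I := ctgModel n) z
  have hp := mem_ctg_source.1 h
  have hpz := mem_extChartAt_source (I := 𝓡 n) z.proj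
  have hK : HasFDerivAt (extChartAt (ctgModel n) z₀ ∘ (extChartAt (ctgModel n) z).symm)
      (chartDeriv (ctgModel n) z₀ z) (extChartAt (ctgModel n) z z) := by
    rw [← hasMFDerivAt_comp_chartDeriv_iff hz, chartDeriv_self]
    exact hasMFDerivAt_extChartAt_of_mem h
  -- Coordinates near the base value come from points of both chart domains, so the identities for
  -- the transition map can be checked on points of the cotangent bundle.
  have hev : ∀ᶠ w in 𝓝 (extChartAt (ctgModel n) z z),
      ∃ y ∈ (extChartAt (ctgModel n) z).source ∩ (extChartAt (ctgModel n) z₀).source,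
        w = extChartAt (ctgModel n) z y := by
    have ho : (extChartAt (ctgModel n) z).source ∩ (extChartAt (ctgModel n) z₀).source ∈ 𝓝 z :=
      ((isOpen_extChartAt_source z).inter (isOpen_extChartAt_source z₀)).mem_nhds ⟨hz, h⟩
    have := extChartAt_image_nhds_mem_nhds_of_boundaryless (I := ctgModel n) ho
    filter_upwards [this] with w hw
    obtain ⟨y, hy, rfl⟩ := hw
    exact ⟨y, hy, rfl⟩
  have hc : (extChartAt (ctgModel n) z z).1 = extChartAt (𝓡 n) z.proj z.proj :=
    ctg_extChartAt_fst z z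
  have := symplectic_transition
    (κ := extChartAt (𝓡 n) z₀.proj ∘ (extChartAt (𝓡 n) z.proj).symm) (by
      rw [hc]
      exact (contDiffAt_extChartAt_transition (k := ∞) hp hpz).of_le (by norm_cast)) hK
      (by
        filter_upwards [hev] with w hw
        obtain ⟨y, hy, rfl⟩ := hw
        have h1 := mem_ctg_source.1 hy.1
        simp only [Function.comp, (extChartAt (ctgModel n) z).left_inv hy.1, ctg_extChartAt_fst,
          (extChartAt (𝓡 n) z.proj).left_inv h1])
      (by
        filter_upwards [hev] with w hw
        obtain ⟨y, hy, rfl⟩ := hw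
        have h1 := mem_ctg_source.1 hy.1
        have h2 := mem_ctg_source.1 hy.2
        simp only [Function.comp_apply, (extChartAt (ctgModel n) z).left_inv hy.1,
          ctg_extChartAt_fst]
        ext a
        obtain ⟨b, rfl⟩ : ∃ b, chartDeriv (𝓡 n) z.proj y.proj b = a :=
          ⟨_, chartDeriv_chartSymmDeriv h1 a⟩
        rw [ContinuousLinearMap.comp_apply, fderiv_transition h2 h1, ctg_extChartAt_snd_apply h2,
          ctg_extChartAt_snd_apply h1])
      v w
  exact this.symm

/-- In the preferred charts at `z` and at `π z` the projection is the first coordinate, and both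
charts have identity derivative there. -/
theorem mfderiv_ctg_proj (z : Ctg n M)
    (v : EuclideanSpace ℝ (Fin n) × (EuclideanSpace ℝ (Fin n) →L[ℝ] ℝ)) :
    (mfderiv (ctgModel n) (𝓡 n) (Bundle.TotalSpace.proj : Ctg n M → M) z v :
      EuclideanSpace ℝ (Fin n)) = v.1 := by
  have h1 : MDifferentiableAt (ctgModel n) (𝓡 n) (Bundle.TotalSpace.proj : Ctg n M → M) z :=
    (Bundle.contMDiffAt_proj (n := 1) _).mdifferentiableAt (by norm_num)
  have h2 := HasMFDerivAt.comp (I' := 𝓡 n) z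
    (hasMFDerivAt_extChartAt_of_mem (mem_extChartAt_source (I := 𝓡 n) z.proj)) h1.hasMFDerivAt
  have h3 := HasMFDerivAt.comp (I' := 𝓘(ℝ, EuclideanSpace ℝ (Fin n) × (EuclideanSpace ℝ (Fin n) →L[ℝ] ℝ))) z
    (g := Prod.fst) (g' := ContinuousLinearMap.fst ℝ (EuclideanSpace ℝ (Fin n)) (EuclideanSpace ℝ (Fin n) →L[ℝ] ℝ))
    (hasFDerivAt_fst.hasMFDerivAt)
    (hasMFDerivAt_extChartAt_of_mem (mem_extChartAt_source (I := ctgModel n) z))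
  have h4 : (Prod.fst ∘ extChartAt (ctgModel n) z : Ctg n M → EuclideanSpace ℝ (Fin n)) =
    extChartAt (𝓡 n) z.proj ∘ Bundle.TotalSpace.proj := funext fun y => ctg_extChartAt_fst z y
  rw [h4] at h3
  have := DFunLike.congr_fun (hasMFDerivAt_unique h2 h3) v
  rw [chartDeriv_self, chartDeriv_self] at this
  exact this

theorem chartDeriv_ctg_fst {z₀ z : Ctg n M} (h : z ∈ (extChartAt (ctgModel n) z₀).source)
    (v : EuclideanSpace ℝ (Fin n) × (EuclideanSpace ℝ (Fin n) →L[ℝ] ℝ)) :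
    (chartDeriv (ctgModel n) z₀ z v).1 = chartDeriv (𝓡 n) z₀.proj z.proj v.1 := by
  have h1 : MDifferentiableAt (ctgModel n) (𝓡 n) (Bundle.TotalSpace.proj : Ctg n M → M) z :=
    (Bundle.contMDiffAt_proj (n := 1) _).mdifferentiableAt (by norm_num)
  have h2 := HasMFDerivAt.comp (I' := 𝓡 n) z
    (hasMFDerivAt_extChartAt_of_mem (mem_ctg_source.1 h)) h1.hasMFDerivAt
  have h3 := HasMFDerivAt.comp
    (I' := 𝓘(ℝ, EuclideanSpace ℝ (Fin n) × (EuclideanSpace ℝ (Fin n) →L[ℝ] ℝ))) z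
    (g := Prod.fst)
    (g' := ContinuousLinearMap.fst ℝ (EuclideanSpace ℝ (Fin n)) (EuclideanSpace ℝ (Fin n) →L[ℝ] ℝ))
    (hasFDerivAt_fst.hasMFDerivAt) (hasMFDerivAt_extChartAt_of_mem h)
  have h4 : (Prod.fst ∘ extChartAt (ctgModel n) z₀ : Ctg n M → EuclideanSpace ℝ (Fin n)) =
    extChartAt (𝓡 n) z₀.proj ∘ Bundle.TotalSpace.proj := funext fun y => ctg_extChartAt_fst z₀ y
  rw [h4] at h3
  have h5 := DFunLike.congr_fun (hasMFDerivAt_unique h2 h3) v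
  exact h5.symm.trans (congrArg _ (mfderiv_ctg_proj z v))

/-- Nondegeneracy of the symplectic form: vertical test vectors detect the position component, and
horizontal ones the momentum component. -/
theorem IsHamVec.unique {h : Ctg n M → ℝ} {z : Ctg n M} {X Y : TangentSpace (ctgModel n) z}
    (hX : IsHamVec h z X) (hY : IsHamVec h z Y) : X = Y := by
  have key : ∀ v w : EuclideanSpace ℝ (Fin n) × (EuclideanSpace ℝ (Fin n) →L[ℝ] ℝ),
      (∀ a : EuclideanSpace ℝ (Fin n) × (EuclideanSpace ℝ (Fin n) →L[ℝ] ℝ),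
        a.2 v.1 - v.2 a.1 = a.2 w.1 - w.2 a.1) → v = w := by
    intro v w H
    refine Prod.ext (ext_inner_left ℝ fun a => ?_) (ContinuousLinearMap.ext fun a => ?_)
    · have := H (0, innerSL ℝ a)
      simpa using this
    · have := H (a, 0)
      simpa using this
  exact key X Y fun a => (hX.2 a).symm.trans (hY.2 a)

theorem IsHamVec.hamVec_eq {h : Ctg n M → ℝ} {z : Ctg n M} {X : TangentSpace (ctgModel n) z}
    (hX : IsHamVec h z X) : hamVec h z = X := by
  have h0 : ∃ X, IsHamVec h z X := ⟨X, hX⟩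
  rw [hamVec, dif_pos h0]
  exact h0.choose_spec.unique hX

/-- The covector `w ↦ σ(w, v)` for the flat symplectic form. -/
noncomputable def flatHamCovec {E : Type*} [NormedAddCommGroup E] [NormedSpace ℝ E]
    (v : E × (E →L[ℝ] ℝ)) : E × (E →L[ℝ] ℝ) →L[ℝ] ℝ :=
  (ContinuousLinearMap.apply ℝ ℝ v.1).comp (ContinuousLinearMap.snd ℝ E (E →L[ℝ] ℝ)) -
    v.2.comp (ContinuousLinearMap.fst ℝ E (E →L[ℝ] ℝ))

theorem flatHamCovec_apply {E : Type*} [NormedAddCommGroup E] [NormedSpace ℝ E]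
    (v w : E × (E →L[ℝ] ℝ)) : flatHamCovec v w = w.2 v.1 - v.2 w.1 := by
  simp [flatHamCovec]

/-- Hamilton's equations in canonical coordinates. -/
theorem IsHamVec.hasFDerivAt_chart {h : Ctg n M → ℝ} {z₀ z : Ctg n M}
    {X : EuclideanSpace ℝ (Fin n) × (EuclideanSpace ℝ (Fin n) →L[ℝ] ℝ)}
    (hX : IsHamVec h z X) (hz : z ∈ (extChartAt (ctgModel n) z₀).source) :
    HasFDerivAt (h ∘ (extChartAt (ctgModel n) z₀).symm)
      (flatHamCovec (chartDeriv (ctgModel n) z₀ z X)) (extChartAt (ctgModel n) z₀ z) := by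
  rw [← hasMFDerivAt_comp_chartDeriv_iff hz]
  have h1 := hX.1.hasMFDerivAt
  have h2 : mfderiv (ctgModel n) 𝓘(ℝ, ℝ) h z =
      (flatHamCovec (chartDeriv (ctgModel n) z₀ z X)).comp (chartDeriv (ctgModel n) z₀ z) := by
    refine ContinuousLinearMap.ext fun w => ?_
    rw [hX.2 w]
    refine (symplecticForm_eq hz w X).trans ?_
    exact (flatHamCovec_apply _ _).symm
  rw [h2] at h1
  exact h1

/-- The Liouville form is `p dq` in every canonical chart, not only in the preferred one at the
point, so the integrand takes the Legendre form `p · q' - h` in a chart that can be kept fixed along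
the trajectory. -/
theorem cartanIntegrand_eq {H : ℝ → Ctg n M → ℝ} {Hc : ℝ → Ctg n M → Ctg n M} {t : ℝ}
    {ℓ z₀ : Ctg n M} {X : EuclideanSpace ℝ (Fin n) × (EuclideanSpace ℝ (Fin n) →L[ℝ] ℝ)}
    (hX : IsHamVec (H t) (Hc t ℓ) X) (hz : Hc t ℓ ∈ (extChartAt (ctgModel n) z₀).source) :
    cartanIntegrand H Hc t ℓ = (extChartAt (ctgModel n) z₀ (Hc t ℓ)).2
      (chartDeriv (ctgModel n) z₀ (Hc t ℓ) X).1 - H t (Hc t ℓ) := by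
  rw [cartanIntegrand, hX.hamVec_eq, chartDeriv_ctg_fst hz,
    ctg_extChartAt_snd_apply (mem_ctg_source.1 hz)]
  exact congrArg (fun v => (Hc t ℓ).2 v - H t (Hc t ℓ)) (mfderiv_ctg_proj _ _)

end

/-! ### Integration along Lipschitz curves and a weak convergence lemma. -/

section
variable {E : Type*} [NormedAddCommGroup E] [NormedSpace ℝ E]

theorem LipschitzOnWith.integral_deriv_eq_sub {f : ℝ → ℝ} {K : ℝ≥0} {a b : ℝ}
    (hf : LipschitzOnWith K f (uIcc a b)) :
    IntervalIntegrable (deriv f) volume a b ∧ ∫ t in a..b, deriv f t = f b - f a :=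
  ⟨hf.absolutelyContinuousOnInterval.intervalIntegrable_deriv,
    hf.absolutelyContinuousOnInterval.integral_deriv_eq_sub⟩

theorem lipschitzOnWith_pairing {X : Type*} [PseudoMetricSpace X] {p : X → E →L[ℝ] ℝ} {q : X → E}
    {s : Set X} {K K' B B' : ℝ≥0} (hp : LipschitzOnWith K p s) (hq : LipschitzOnWith K' q s)
    (hB : ∀ x ∈ s, ‖p x‖ ≤ B) (hB' : ∀ x ∈ s, ‖q x‖ ≤ B') :
    LipschitzOnWith (K * B' + B * K') (fun x => p x (q x)) s := by
  refine LipschitzOnWith.of_dist_le_mul fun x hx y hy => ?_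
  have h1 : p x (q x) - p y (q y) = (p x - p y) (q x) + p y (q x - q y) := by
    simp
  have h2 := hp.dist_le_mul x hx y hy
  have h3 := hq.dist_le_mul x hx y hy
  rw [dist_eq_norm] at h2 h3
  rw [dist_eq_norm, h1]
  calc ‖(p x - p y) (q x) + p y (q x - q y)‖ ≤ ‖p x - p y‖ * ‖q x‖ + ‖p y‖ * ‖q x - q y‖ :=
        (norm_add_le _ _).trans (add_le_add ((p x - p y).le_opNorm _) ((p y).le_opNorm _))
    _ ≤ (K * dist x y) * B' + B * (K' * dist x y) := by
        gcongr
        exacts [hB' x hx, hB y hy]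
    _ = _ := by push_cast; ring

theorem aestronglyMeasurable_pairing {p : ℝ → E →L[ℝ] ℝ} {q : ℝ → E} {μ : Measure ℝ}
    (hp : AEStronglyMeasurable p μ) (hq : AEStronglyMeasurable q μ) :
    AEStronglyMeasurable (fun t => p t (q t)) μ :=
  isBoundedBilinearMap_apply.continuous.comp_aestronglyMeasurable (hp.prodMk hq)

theorem intervalIntegrable_of_ae_bound {F : Type*} [NormedAddCommGroup F] {f : ℝ → F} {a b C : ℝ}
    (hm : AEStronglyMeasurable f (volume.restrict (uIoc a b)))
    (hC : ∀ᵐ t, t ∈ uIoc a b → ‖f t‖ ≤ C) : IntervalIntegrable f volume a b :=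
  (intervalIntegrable_const (c := C)).mono_fun' hm
    ((ae_restrict_iff' measurableSet_uIoc).2 hC)

theorem LipschitzWith.norm_deriv_le {F : Type*} [NormedAddCommGroup F] [NormedSpace ℝ F]
    {f : ℝ → F} {K : ℝ≥0} (hf : LipschitzWith K f) (t : ℝ) : ‖deriv f t‖ ≤ K :=
  norm_deriv_le_of_lipschitz hf

variable [FiniteDimensional ℝ E]

/-- Integration by parts for the duality pairing of two Lipschitz curves. -/
theorem integral_deriv_pairing {p : ℝ → E →L[ℝ] ℝ} {q : ℝ → E} {K K' : ℝ≥0}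
    (hp : LipschitzWith K p) (hq : LipschitzWith K' q) (a b : ℝ) :
    IntervalIntegrable (fun t => deriv p t (q t) + p t (deriv q t)) volume a b ∧
      ∫ t in a..b, (deriv p t (q t) + p t (deriv q t)) = p b (q b) - p a (q a) := by
  obtain ⟨B, hB⟩ := isCompact_uIcc.exists_bound_of_continuousOn
    (s := uIcc a b) hp.continuous.continuousOn
  obtain ⟨B', hB'⟩ := isCompact_uIcc.exists_bound_of_continuousOn
    (s := uIcc a b) hq.continuous.continuousOn
  have hl := lipschitzOnWith_pairing (B := B.toNNReal) (B' := B'.toNNReal)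
    hp.lipschitzOnWith hq.lipschitzOnWith
    (fun x hx => (hB x hx).trans (Real.le_coe_toNNReal _))
    (fun x hx => (hB' x hx).trans (Real.le_coe_toNNReal _))
  have hd : ∀ᵐ t, deriv (fun t => p t (q t)) t = deriv p t (q t) + p t (deriv q t) := by
    filter_upwards [hp.ae_differentiableAt_real, hq.ae_differentiableAt_real] with t h1 h2
    exact (h1.hasDerivAt.clm_apply h2.hasDerivAt).deriv
  obtain ⟨h1, h2⟩ := LipschitzOnWith.integral_deriv_eq_sub hl
  exact ⟨h1.congr_ae (ae_restrict_of_ae hd),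
    (intervalIntegral.integral_congr_ae (hd.mono fun t ht _ => ht.symm)).trans h2⟩

/-- If `r k` is bounded and converges a.e. and `δ k` is uniformly Lipschitz and tends to `0`,
then `∫ r k · (δ k)'` tends to `0`. -/
theorem tendsto_integral_pairing_deriv_zero {r : ℕ → ℝ → E →L[ℝ] ℝ} {δ : ℕ → ℝ → E}
    {K : ℕ → ℝ≥0} {D : ℝ≥0} {C a b : ℝ} {ε : ℕ → ℝ} (hab : a ≤ b)
    (hr : ∀ k, LipschitzWith (K k) (r k)) (hC : ∀ k, ∀ t ∈ Icc a b, ‖r k t‖ ≤ C)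
    {ρ : ℝ → E →L[ℝ] ℝ} (hρ : ∀ᵐ t, t ∈ Icc a b → Tendsto (fun k => r k t) atTop (𝓝 (ρ t)))
    (hδ : ∀ k, LipschitzWith D (δ k)) (hε : ∀ k, ∀ t ∈ Icc a b, ‖δ k t‖ ≤ ε k)
    (hε0 : Tendsto ε atTop (𝓝 0)) :
    Tendsto (fun k => ∫ t in a..b, r k t (deriv (δ k) t)) atTop (𝓝 0) := by
  have hsub : uIoc a b ⊆ Icc a b := by rw [uIoc_of_le hab]; exact Ioc_subset_Icc_self
  have hmr : ∀ k, AEStronglyMeasurable (r k) (volume.restrict (uIoc a b)) := fun k =>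
    (hr k).continuous.aestronglyMeasurable
  have hmd : ∀ k, AEStronglyMeasurable (deriv (δ k)) (volume.restrict (uIoc a b)) := fun k =>
    aestronglyMeasurable_deriv _ _
  have hρ' : ∀ᵐ t ∂volume.restrict (uIoc a b), Tendsto (fun k => r k t) atTop (𝓝 (ρ t)) := by
    rw [ae_restrict_iff' measurableSet_uIoc]
    exact hρ.mono fun t ht h => ht (hsub h)
  have hmρ : AEStronglyMeasurable ρ (volume.restrict (uIoc a b)) :=
    aestronglyMeasurable_of_tendsto_ae atTop hmr hρ'
  have hρC : ∀ᵐ t, t ∈ uIoc a b → ‖ρ t‖ ≤ C := by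
    filter_upwards [hρ] with t ht h
    exact le_of_tendsto (ht (hsub h)).norm (Eventually.of_forall fun k => hC k t (hsub h))
  have hint : ∀ k, IntervalIntegrable (fun t => ‖r k t - ρ t‖) volume a b := fun k => by
    refine intervalIntegrable_of_ae_bound (C := C + C) ((hmr k).sub hmρ).norm ?_
    filter_upwards [hρC] with t ht h
    rw [norm_norm]
    exact (norm_sub_le _ _).trans (add_le_add (hC k t (hsub h)) (ht h))
  -- Dominated convergence: `r k` tends to `ρ` in `L¹`.
  have hL1 : Tendsto (fun k => ∫ t in a..b, ‖r k t - ρ t‖) atTop (𝓝 0) := by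
    have := intervalIntegral.tendsto_integral_filter_of_dominated_convergence
      (μ := volume) (a := a) (b := b) (F := fun k t => ‖r k t - ρ t‖) (f := fun _ => (0 : ℝ))
      (l := atTop) (fun _ => C + C)
      (Eventually.of_forall fun k => ((hmr k).sub hmρ).norm)
      (Eventually.of_forall fun k => by
        filter_upwards [hρC] with t ht h
        rw [norm_norm]
        exact (norm_sub_le _ _).trans (add_le_add (hC k t (hsub h)) (ht h)))
      intervalIntegrable_const
      (by
        filter_upwards [hρ] with t ht h
        simpa using ((ht (hsub h)).sub_const (ρ t)).norm)
    simpa using this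
  have hpair : ∀ k l, IntervalIntegrable (fun t => r l t (deriv (δ k) t)) volume a b := fun k l => by
    refine intervalIntegrable_of_ae_bound (C := C * D)
      (aestronglyMeasurable_pairing (hmr l) (hmd k)) ?_
    refine Eventually.of_forall fun t h => ?_
    exact ((r l t).le_opNorm _).trans (mul_le_mul (hC l t (hsub h)) ((hδ k).norm_deriv_le t)
      (norm_nonneg _) ((norm_nonneg _).trans (hC l t (hsub h))))
  -- For a frozen `r m`, integration by parts moves the derivative off `δ k`, which is uniformly
  -- small. The constant `K m` may grow with `m`, but `m` is fixed here.
  have hfix : ∀ m, Tendsto (fun k => ∫ t in a..b, r m t (deriv (δ k) t)) atTop (𝓝 0) := by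
    intro m
    rw [tendsto_zero_iff_norm_tendsto_zero]
    refine squeeze_zero (fun _ => norm_nonneg _) (g := fun k => (2 * C + K m * (b - a)) * ε k)
      (fun k => ?_) (by simpa using hε0.const_mul (2 * C + K m * (b - a)))
    obtain ⟨i1, i2⟩ := integral_deriv_pairing (hr m) (hδ k) a b
    have i3 : IntervalIntegrable (fun t => deriv (r m) t (δ k t)) volume a b := by
      simpa using i1.sub (hpair k m)
    rw [intervalIntegral.integral_add i3 (hpair k m)] at i2
    have e1 : ∫ t in a..b, r m t (deriv (δ k) t) =
        r m b (δ k b) - r m a (δ k a) - ∫ t in a..b, deriv (r m) t (δ k t) := by linarith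
    have b1 : ∀ t ∈ Icc a b, ‖r m t (δ k t)‖ ≤ C * ε k := fun t ht =>
      ((r m t).le_opNorm _).trans (mul_le_mul (hC m t ht) (hε k t ht)
      (norm_nonneg _) ((norm_nonneg _).trans (hC m t ht)))
    have b2 : ‖∫ t in a..b, deriv (r m) t (δ k t)‖ ≤ (K m * ε k) * |b - a| := by
      refine intervalIntegral.norm_integral_le_of_norm_le_const fun t ht => ?_
      exact ((deriv (r m) t).le_opNorm _).trans (mul_le_mul ((hr m).norm_deriv_le t)
        (hε k t (hsub ht)) (norm_nonneg _) (NNReal.coe_nonneg _))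
    rw [abs_of_nonneg (sub_nonneg.2 hab)] at b2
    rw [e1]
    have b3 := b1 b (right_mem_Icc.2 hab)
    have b4 := b1 a (left_mem_Icc.2 hab)
    have := norm_sub_le (r m b (δ k b) - r m a (δ k a)) (∫ t in a..b, deriv (r m) t (δ k t))
    have := norm_sub_le (r m b (δ k b)) (r m a (δ k a))
    nlinarith
  rw [Metric.tendsto_atTop]
  intro η hη
  -- Replacing `r k` by `r m` costs `D` times two `L¹` errors, each contributing at most `η / 3`;
  -- the last third is the integral with `r m`. The `+ 1` covers `D = 0`.
  have hη' : 0 < η / (3 * (D + 1)) := by positivity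
  have hDη : D * (η / (3 * (D + 1))) ≤ η / 3 := by
    rw [mul_div_assoc', div_le_div_iff₀ (by positivity) (by positivity)]
    nlinarith [D.coe_nonneg]
  obtain ⟨m, hm⟩ := (Metric.tendsto_atTop.1 hL1) _ hη'
  obtain ⟨m', hm'⟩ := (Metric.tendsto_atTop.1 (hfix m)) (η / 3) (by positivity)
  refine ⟨max m m', fun k hk => ?_⟩
  have h1 := hm m le_rfl
  have h2 := hm k ((le_max_left _ _).trans hk)
  have h3 := hm' k ((le_max_right _ _).trans hk)
  rw [Real.dist_eq, sub_zero] at h1 h2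
  rw [dist_zero_right] at h3 ⊢
  have e : ∫ t in a..b, r k t (deriv (δ k) t) =
      (∫ t in a..b, (r k t - r m t) (deriv (δ k) t)) + ∫ t in a..b, r m t (deriv (δ k) t) := by
    rw [← intervalIntegral.integral_add _ (hpair k m)]
    · simp
    · simpa using (hpair k k).sub (hpair k m)
  have e2 : ‖∫ t in a..b, (r k t - r m t) (deriv (δ k) t)‖ ≤
      ∫ t in a..b, D * (‖r k t - ρ t‖ + ‖r m t - ρ t‖) := by
    refine intervalIntegral.norm_integral_le_of_norm_le hab (Eventually.of_forall fun t _ => ?_)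
      (((hint k).add (hint m)).const_mul _)
    refine ((r k t - r m t).le_opNorm _).trans ?_
    rw [mul_comm]
    refine mul_le_mul ((hδ k).norm_deriv_le t) ?_ (norm_nonneg _) D.coe_nonneg
    rw [show r k t - r m t = (r k t - ρ t) - (r m t - ρ t) by abel]
    exact norm_sub_le _ _
  rw [intervalIntegral.integral_const_mul, intervalIntegral.integral_add (hint k) (hint m)] at e2
  rw [e]
  have h4 := (le_abs_self _).trans h1.le
  have h5 := (le_abs_self _).trans_lt h2
  have h6 := (le_abs_self _).trans_lt h1
  refine (norm_add_le _ _).trans_lt ?_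
  have : (D : ℝ) * ((∫ t in a..b, ‖r k t - ρ t‖) + ∫ t in a..b, ‖r m t - ρ t‖) ≤
      η / 3 + η / 3 := by
    rw [mul_add]
    exact add_le_add ((mul_le_mul_of_nonneg_left h5.le D.coe_nonneg).trans hDη)
      ((mul_le_mul_of_nonneg_left h6.le D.coe_nonneg).trans hDη)
  linarith
end

/-! ### From pointwise Lipschitz bounds to Lipschitz functions, with and without a parameter. -/

section

/-- On each piece of `S` cut out by a half-open interval of length `r`, `f` is `K`-Lipschitz, and
one-dimensional Hausdorff measure on the line is Lebesgue measure. Only the intervals need to be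
measurable, not `S`. -/
theorem volume_image_le_of_forall_near {f : ℝ → ℝ} {K : ℝ≥0} {r : ℝ} (hr : 0 < r) {S : Set ℝ}
    (hS : ∀ x ∈ S, ∀ y, |y - x| < r → |f y - f x| ≤ K * |y - x|) :
    volume (f '' S) ≤ K * volume S := by
  let I : ℤ → Set ℝ := fun i => {x | ⌊x / r⌋ = i}
  have hI : ∀ i, MeasurableSet (I i) := fun i =>
    (Int.measurable_floor.comp (measurable_id.div_const r)) (measurableSet_singleton i)
  have hU : ⋃ i, I i = univ := iUnion_eq_univ_iff.2 fun x => ⟨⌊x / r⌋, rfl⟩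
  have hdis : Pairwise (Function.onFun Disjoint I) := fun i j hij =>
    Set.disjoint_left.2 fun x hx hx' => hij (hx.symm.trans hx')
  have hlip : ∀ i, LipschitzOnWith K f (S ∩ I i) := fun i => by
    refine LipschitzOnWith.of_dist_le_mul fun x hx y hy => ?_
    rw [Real.dist_eq, Real.dist_eq]
    refine hS y hy.1 x ?_
    have := Int.abs_sub_lt_one_of_floor_eq_floor (hx.2.trans hy.2.symm)
    rw [← sub_div, abs_div, abs_of_pos hr, div_lt_one hr] at this
    exact this
  have hle : ∀ i, volume (f '' (S ∩ I i)) ≤ K * volume.restrict S (I i) := fun i => by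
    have := (hlip i).hausdorffMeasure_image_le (d := 1) zero_le_one
    rw [Measure.restrict_apply (hI i), inter_comm (I i)]
    simpa [hausdorffMeasure_real] using this
  calc volume (f '' S) = volume (⋃ i, f '' (S ∩ I i)) := by
        rw [← image_iUnion, ← inter_iUnion, hU, inter_univ]
    _ ≤ ∑' i, volume (f '' (S ∩ I i)) := measure_iUnion_le _
    _ ≤ ∑' i, K * volume.restrict S (I i) := ENNReal.tsum_le_tsum hle
    _ = K * volume S := by
        rw [ENNReal.tsum_mul_left, ← measure_iUnion hdis hI, hU, Measure.restrict_apply_univ]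

/-- A function which is pointwise Lipschitz at every point, with constant at most `K` almost
everywhere, is `K`-Lipschitz. -/
theorem lipschitzWith_of_forall_isBigO {f : ℝ → ℝ} {K : ℝ≥0}
    (hc : ∀ x, (fun y => f y - f x) =O[𝓝 x] fun y => y - x)
    (hK : ∀ᵐ x, ∀ᶠ y in 𝓝 x, |f y - f x| ≤ K * |y - x|) : LipschitzWith K f := by
  -- The points where the bound `L` holds at scale `1 / (j + 1)`.
  let A : ℝ≥0 → ℕ → Set ℝ := fun L j => {x | ∀ y, |y - x| < 1 / (j + 1 : ℝ) → |f y - f x| ≤ L * |y - x|}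
  have hA : ∀ L j (S : Set ℝ), S ⊆ A L j → volume (f '' S) ≤ L * volume S := fun L j S hS =>
    volume_image_le_of_forall_near (r := 1 / (j + 1 : ℝ)) (by positivity) hS
  have hmono : ∀ L, Monotone (A L) := fun L i j hij x hx y hy => by
    refine hx y (hy.trans_le ?_)
    gcongr
  have hmem : ∀ (L : ℝ≥0) x, (∀ᶠ y in 𝓝 x, |f y - f x| ≤ L * |y - x|) → ∃ j, x ∈ A L j := by
    intro L x hx
    obtain ⟨ε, hε, h⟩ := Metric.eventually_nhds_iff.1 hx
    obtain ⟨j, hj⟩ := exists_nat_one_div_lt hε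
    exact ⟨j, fun y hy => h (by rw [Real.dist_eq]; exact hy.trans hj)⟩
  have hcont : Continuous f := continuous_iff_continuousAt.2 fun x => by
    have h1 : Tendsto (fun y => y - x) (𝓝 x) (𝓝 0) := by
      simpa using (continuous_sub_right x).tendsto x
    have := (hc x).trans_tendsto h1
    simpa [ContinuousAt] using this.add_const (f x)
  have hnull : volume {x | ¬ ∀ᶠ y in 𝓝 x, |f y - f x| ≤ K * |y - x|} = 0 := hK
  set Z := {x | ¬ ∀ᶠ y in 𝓝 x, |f y - f x| ≤ K * |y - x|} with hZ
  -- The exceptional set is a countable union of null pieces with some integer constant each.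
  -- Finiteness of the pointwise constant everywhere is essential here; it excludes Cantor-type
  -- functions.
  have hZ0 : volume (f '' Z) = 0 := by
    have : f '' Z ⊆ ⋃ m : ℕ, ⋃ j, f '' (Z ∩ A m j) := by
      rintro _ ⟨x, hx, rfl⟩
      obtain ⟨c, hcx⟩ := (hc x).bound
      obtain ⟨m, hm⟩ := exists_nat_ge c
      obtain ⟨j, hj⟩ := hmem m x (hcx.mono fun y hy => by
        simp only [Real.norm_eq_abs] at hy
        exact hy.trans (mul_le_mul_of_nonneg_right (by simpa using hm) (abs_nonneg _)))
      exact mem_iUnion₂.2 ⟨m, j, mem_image_of_mem _ ⟨hx, hj⟩⟩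
    refine measure_mono_null this (measure_iUnion_null fun m => measure_iUnion_null fun j => ?_)
    refine le_antisymm ((hA m j _ inter_subset_right).trans ?_) zero_le
    rw [measure_mono_null inter_subset_left hnull, mul_zero]
  have key : ∀ a b, a ≤ b → |f b - f a| ≤ K * (b - a) := by
    intro a b hab
    have h1 : volume (f '' Icc a b) ≤ K * ENNReal.ofReal (b - a) := by
      have : f '' Icc a b ⊆ (⋃ j, f '' (Icc a b ∩ A K j)) ∪ f '' Z := by
        rintro _ ⟨x, hx, rfl⟩
        by_cases hxZ : x ∈ Z
        · exact Or.inr (mem_image_of_mem _ hxZ)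
        · obtain ⟨j, hj⟩ := hmem K x (not_not.1 hxZ)
          exact Or.inl (mem_iUnion.2 ⟨j, mem_image_of_mem _ ⟨hx, hj⟩⟩)
      refine (measure_mono this).trans ((measure_union_le _ _).trans ?_)
      -- The union increases with `j`, so its measure is a supremum and the constant `K` is not lost
      -- in a sum.
      rw [hZ0, add_zero, Monotone.measure_iUnion]
      · refine iSup_le fun j => (hA K j _ inter_subset_right).trans ?_
        gcongr
        exact (measure_mono inter_subset_left).trans (by simp)
      · exact fun i j hij => image_mono (inter_subset_inter_right _ (hmono K hij))
    -- By the intermediate value theorem the increment of `f` is bounded by the measure of the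
    -- image.
    have h2 : uIcc (f a) (f b) ⊆ f '' Icc a b := by
      have := intermediate_value_uIcc (a := a) (b := b) hcont.continuousOn
      rwa [uIcc_of_le hab] at this
    have h3 := (measure_mono (μ := volume) h2).trans h1
    rw [Real.volume_interval, show (K : ENNReal) = ENNReal.ofReal K by simp,
      ← ENNReal.ofReal_mul K.coe_nonneg] at h3
    exact (ENNReal.ofReal_le_ofReal_iff (mul_nonneg K.coe_nonneg (sub_nonneg.2 hab))).1 h3
  refine LipschitzWith.of_dist_le_mul fun x y => ?_
  rw [Real.dist_eq, Real.dist_eq]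
  rcases le_total x y with h | h
  · rw [abs_sub_comm, abs_sub_comm x, abs_of_nonneg (sub_nonneg.2 h)]
    exact key x y h
  · rw [abs_of_nonneg (sub_nonneg.2 h)]
    exact key y x h

/-- A family of real functions which are continuous in `s` and almost everywhere measurable in `t`
agrees, up to a null set of times, with a jointly measurable one. -/
theorem exists_measurable_uncurry_of_ae_continuous {f : ℝ → ℝ → ℝ} {μ : Measure ℝ}
    (hm : ∀ s, AEMeasurable (fun t => f t s) μ) (hc : ∀ᵐ t ∂μ, Continuous (f t)) :
    ∃ g : ℝ → ℝ → ℝ, Measurable (Function.uncurry g) ∧ ∀ᵐ t ∂μ, ∀ s, g s t = f t s := by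
  -- Only rational parameters are compared with their measurable representatives, which costs one
  -- null set; off it, continuity determines the remaining values.
  have hq : ∀ᵐ t ∂μ, ∀ r : ℚ, (hm r).mk _ t = f t r :=
    ae_all_iff.2 fun r => (hm r).ae_eq_mk.symm
  obtain ⟨T, hTs, hTm, hT0⟩ := exists_measurable_superset_of_null (ae_iff.1 (hc.and hq))
  have hT : ∀ t, t ∉ T → Continuous (f t) ∧
      ∀ r : ℚ, (hm r).mk _ t = f t r := fun t ht => by
    by_contra h
    exact ht (hTs h)
  have hTae : ∀ᵐ t ∂μ, t ∉ T := measure_eq_zero_iff_ae_notMem.1 hT0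
  let g : ℝ → ℝ → ℝ := fun s t => Tᶜ.indicator (fun t => f t s) t
  have hgc : ∀ t, Continuous fun s => g s t := fun t => by
    by_cases ht : t ∈ T
    · simp only [g, indicator_of_notMem (show t ∉ Tᶜ from fun h => h ht)]
      exact continuous_const
    · simp only [g, indicator_of_mem (show t ∈ Tᶜ from ht)]
      exact (hT t ht).1
  have hgr : ∀ r : ℚ, Measurable (g r) := fun r => by
    have : g r = Tᶜ.indicator ((hm r).mk _) := by
      ext t
      by_cases ht : t ∈ T
      · simp [g, ht]
      · simp [g, ht, (hT t ht).2 r]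
    rw [this]
    exact (hm r).measurable_mk.indicator hTm.compl
  have hgm : ∀ s, Measurable (g s) := fun s => by
    have hd : DenseRange ((↑) : ℚ → ℝ) := Rat.denseRange_cast
    obtain ⟨u, hu, hus⟩ := mem_closure_iff_seq_limit.1 (hd s)
    refine measurable_of_tendsto_metrizable (f := fun k => g (u k)) (fun k => ?_)
      (tendsto_pi_nhds.2 fun t => ((hgc t).tendsto s).comp hus)
    obtain ⟨r, hr⟩ := hu k
    rw [← hr]
    exact hgr r
  refine ⟨g, measurable_uncurry_of_continuous_of_measurable hgc hgm, ?_⟩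
  filter_upwards [hTae] with t ht s
  exact indicator_of_mem (show t ∈ Tᶜ from ht) _

/-- A parametrised version of `lipschitzWith_of_forall_isBigO`. -/
theorem ae_lipschitzWith_of_forall_isBigO {f : ℝ → ℝ → ℝ} {K : ℝ≥0} {μ : Measure ℝ} [SFinite μ]
    (hm : ∀ s, AEMeasurable (fun t => f t s) μ)
    (hc : ∀ᵐ t ∂μ, ∀ s, (fun s' => f t s' - f t s) =O[𝓝 s] fun s' => s' - s)
    (hK : ∀ s, ∀ᵐ t ∂μ, ∀ᶠ s' in 𝓝 s, |f t s' - f t s| ≤ K * |s' - s|) :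
    ∀ᵐ t ∂μ, LipschitzWith K (f t) := by
  have hcont : ∀ t, (∀ s, (fun s' => f t s' - f t s) =O[𝓝 s] fun s' => s' - s) →
      Continuous (f t) := fun t ht => continuous_iff_continuousAt.2 fun x => by
    have h1 : Tendsto (fun y => y - x) (𝓝 x) (𝓝 0) := by
      simpa using (continuous_sub_right x).tendsto x
    have := (ht x).trans_tendsto h1
    simpa [ContinuousAt] using this.add_const (f t x)
  obtain ⟨g, hgu, hg⟩ := exists_measurable_uncurry_of_ae_continuous hm (hc.mono hcont)
  -- Testing rational increments only makes `P` measurable, so Fubini turns "for each `s`, a.e. `t`"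
  -- into "for a.e. `t`, a.e. `s`".
  let P : ℝ → ℝ → Prop := fun t s =>
    ∃ j : ℕ, ∀ r : ℚ, |(r : ℝ)| < 1 / (j + 1 : ℝ) → |g (s + r) t - g s t| ≤ K * |(r : ℝ)|
  have hP : MeasurableSet {w : ℝ × ℝ | P w.1 w.2} := by
    have : {w : ℝ × ℝ | P w.1 w.2} = ⋃ j : ℕ, ⋂ r : ℚ, {w : ℝ × ℝ | |(r : ℝ)| < 1 / (j + 1 : ℝ) →
        |g (w.2 + r) w.1 - g w.2 w.1| ≤ K * |(r : ℝ)|} := by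
      ext w; simp [P]
    rw [this]
    refine MeasurableSet.iUnion fun j => MeasurableSet.iInter fun r => ?_
    by_cases hr : |(r : ℝ)| < 1 / (j + 1 : ℝ)
    · simp only [hr, true_imp_iff]
      refine measurableSet_le (Measurable.abs (Measurable.sub ?_ ?_)) measurable_const
      · exact hgu.comp ((measurable_snd.add_const _).prodMk measurable_fst)
      · exact hgu.comp (measurable_snd.prodMk measurable_fst)
    · simp only [hr, false_imp_iff, ofPred_true]
      exact MeasurableSet.univ
  have h1 : ∀ᵐ t ∂μ, ∀ᵐ s, P t s := by
    rw [Measure.ae_ae_comm hP]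
    refine Eventually.of_forall fun s => ?_
    filter_upwards [hK s, hg] with t ht htT
    obtain ⟨ε, hε, h⟩ := Metric.eventually_nhds_iff.1 ht
    obtain ⟨j, hj⟩ := exists_nat_one_div_lt hε
    refine ⟨j, fun r hr => ?_⟩
    have := h (y := s + r) (by rw [Real.dist_eq, add_sub_cancel_left]; exact hr.trans hj)
    rw [htT, htT]
    simpa using this
  filter_upwards [h1, hg, hc] with t ht htT htc
  refine lipschitzWith_of_forall_isBigO htc ?_
  filter_upwards [ht] with s hs
  obtain ⟨j, hj⟩ := hs
  have hfc := hcont t htc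
  rw [Metric.eventually_nhds_iff]
  refine ⟨1 / (j + 1 : ℝ), by positivity, fun y hy => ?_⟩
  -- Continuity of `f t` carries the bound from rational increments to real ones.
  have hd : y - s ∈ closure (((↑) : ℚ → ℝ) '' {r : ℚ | |(r : ℝ)| < 1 / (j + 1 : ℝ)}) := by
    have ho : IsOpen {r : ℝ | |r| < 1 / (j + 1 : ℝ)} := isOpen_lt continuous_abs continuous_const
    have := (Rat.denseRange_cast (𝕜 := ℝ)).open_subset_closure_inter ho (show y - s ∈ _ by simpa [Real.dist_eq] using hy)
    refine closure_mono ?_ this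
    rintro _ ⟨h, r, rfl⟩
    exact ⟨r, h, rfl⟩
  have hcl : IsClosed {r : ℝ | |f t (s + r) - f t s| ≤ K * |r|} :=
    isClosed_le ((hfc.comp (continuous_const.add continuous_id)).sub continuous_const).abs
      (continuous_const.mul continuous_abs)
  have := closure_minimal (t := {r : ℝ | |f t (s + r) - f t s| ≤ K * |r|}) (by
    rintro _ ⟨r, hr, rfl⟩
    have := hj r hr
    rwa [htT, htT] at this) hcl hd
  simpa using this

/-! ### The action along a Lipschitz family of solutions in flat phase space. -/

variable {E : Type*} [NormedAddCommGroup E] [NormedSpace ℝ E]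

theorem HasDerivAt.curve_fst {F : Type*} [NormedAddCommGroup F] [NormedSpace ℝ F] {z : ℝ → E × F}
    {v : E × F} {t : ℝ} (h : HasDerivAt z v t) : HasDerivAt (fun t => (z t).1) v.1 t :=
  (ContinuousLinearMap.fst ℝ E F).hasFDerivAt.comp_hasDerivAt t h

theorem HasDerivAt.curve_snd {F : Type*} [NormedAddCommGroup F] [NormedSpace ℝ F] {z : ℝ → E × F}
    {v : E × F} {t : ℝ} (h : HasDerivAt z v t) : HasDerivAt (fun t => (z t).2) v.2 t :=
  (ContinuousLinearMap.snd ℝ E F).hasFDerivAt.comp_hasDerivAt t h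

theorem abs_flatHamCovec_le (v w : E × (E →L[ℝ] ℝ)) :
    |flatHamCovec v w| ≤ 2 * ‖v‖ * ‖w‖ := by
  rw [flatHamCovec_apply]
  have h1 : |w.2 v.1| ≤ ‖w‖ * ‖v‖ := (w.2.le_opNorm _).trans
    (mul_le_mul (norm_snd_le w) (norm_fst_le v) (norm_nonneg _) (norm_nonneg _))
  have h2 : |v.2 w.1| ≤ ‖v‖ * ‖w‖ := (v.2.le_opNorm _).trans
    (mul_le_mul (norm_snd_le v) (norm_fst_le w) (norm_nonneg _) (norm_nonneg _))
  have := abs_sub (w.2 v.1) (v.2 w.1)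
  linarith

variable [FiniteDimensional ℝ E]

/-- The energies `h_t(z(t, s))` along a Lipschitz family of solutions `z(·, s)` of a Hamiltonian
system are integrable in `t`, and for a.e. `t` Lipschitz in `s`. -/
theorem intervalIntegrable_and_ae_lipschitzWith_energy {z : ℝ → ℝ → E × (E →L[ℝ] ℝ)}
    {L : ℝ → ℝ → ℝ} {h : ℝ → E × (E →L[ℝ] ℝ) → ℝ} {C : ℝ≥0} {a b : ℝ} (hab : a ≤ b)
    (hz : LipschitzWith C (fun w : ℝ × ℝ => z w.1 w.2))
    (hLi : ∀ s, IntervalIntegrable (fun t => L t s) volume a b)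
    (hd : ∀ s, ∀ᵐ t, t ∈ Icc a b → ∃ v : E × (E →L[ℝ] ℝ), HasDerivAt (fun t => z t s) v t ∧
      HasFDerivAt (h t) (flatHamCovec v) (z t s) ∧ L t s = (z t s).2 v.1 - h t (z t s))
    (hc : ∀ᵐ t, t ∈ Icc a b → ∀ s,
      (fun s' => h t (z t s') - h t (z t s)) =O[𝓝 s] fun s' => s' - s) :
    (∀ s, IntervalIntegrable (fun t => h t (z t s)) volume a b) ∧
      ∀ᵐ t ∂volume.restrict (Icc a b), LipschitzWith (2 * C * C + C) (fun s => h t (z t s)) := by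
  have hsub : uIoc a b ⊆ Icc a b := by rw [uIoc_of_le hab]; exact Ioc_subset_Icc_self
  have hzs : ∀ t, LipschitzWith C (z t) := fun t => LipschitzWith.of_dist_le_mul fun x y => by
    simpa using hz.dist_le_mul (t, x) (t, y)
  have hzt : ∀ s, LipschitzWith C (fun t => z t s) := fun s =>
    LipschitzWith.of_dist_le_mul fun x y => by simpa using hz.dist_le_mul (x, s) (y, s)
  have hqt : ∀ s, LipschitzWith C (fun t => (z t s).1) := fun s => by
    simpa [Function.comp_def] using LipschitzWith.prod_fst.comp (hzt s)
  have hpt : ∀ s, LipschitzWith C (fun t => (z t s).2) := fun s => by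
    simpa [Function.comp_def] using LipschitzWith.prod_snd.comp (hzt s)
  have hzn : ∀ t s s', ‖z t s' - z t s‖ ≤ C * |s' - s| := fun t s s' => by
    rw [← dist_eq_norm, ← Real.dist_eq]; exact (hzs t).dist_le_mul s' s
  have hint : ∀ s, IntervalIntegrable (fun t => h t (z t s)) volume a b := fun s => by
    obtain ⟨B, hB⟩ := isCompact_Icc.exists_bound_of_continuousOn (s := Icc a b)
      (hpt s).continuous.continuousOn
    -- Along a solution `h = p · q' - L`. Measurability of the energy in `t` is obtained from this
    -- identity, as `h` itself carries no regularity in `t`.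
    have hi : IntervalIntegrable (fun t => (z t s).2 (deriv (fun t => (z t s).1) t)) volume a b :=
      intervalIntegrable_of_ae_bound (C := B * C) (aestronglyMeasurable_pairing
        (hpt s).continuous.aestronglyMeasurable (aestronglyMeasurable_deriv _ _))
        (Eventually.of_forall fun t ht => (ContinuousLinearMap.le_opNorm _ _).trans
          (mul_le_mul (hB t (hsub ht)) ((hqt s).norm_deriv_le t) (norm_nonneg _)
            ((norm_nonneg _).trans (hB t (hsub ht)))))
    refine (hi.sub (hLi s)).congr_ae ?_
    rw [EventuallyEq, ae_restrict_iff' measurableSet_uIoc]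
    filter_upwards [hd s] with t ht hm
    obtain ⟨v, h1, h2, h3⟩ := ht (hsub hm)
    have h4 : HasDerivAt (fun t => (z t s).1) v.1 t := h1.curve_fst
    rw [h4.deriv, h3]
    ring
  refine ⟨hint, ?_⟩
  -- Where `h t` is differentiable, its gradient is given by the velocity, of norm at most `C`; this
  -- yields the slope `2 * C * C`. The extra `C` bounds the first-order remainder, taken with `ε =
  -- 1`.
  refine ae_lipschitzWith_of_forall_isBigO (fun s => ?_) ?_ (fun s => ?_)
  · have := (hint s).1.aestronglyMeasurable.aemeasurable
    rwa [← restrict_Ioc_eq_restrict_Icc]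
  · rw [ae_restrict_iff' measurableSet_Icc]
    exact hc
  · rw [ae_restrict_iff' measurableSet_Icc]
    filter_upwards [hd s] with t ht hm
    obtain ⟨v, h1, h2, h3⟩ := ht hm
    have h4 := h2.isLittleO.comp_tendsto ((hzs t).continuous.tendsto s)
    filter_upwards [h4.def one_pos] with s' hs'
    simp only [Function.comp, one_mul, Real.norm_eq_abs] at hs'
    have hv : ‖v‖ ≤ C := by rw [← h1.deriv]; exact (hzt s).norm_deriv_le t
    have h5 := abs_flatHamCovec_le v (z t s' - z t s)
    have h6 := hzn t s s'
    have h7 : 2 * ‖v‖ * ‖z t s' - z t s‖ ≤ 2 * C * (C * |s' - s|) := by gcongr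
    have h8 := abs_sub_abs_le_abs_sub (h t (z t s') - h t (z t s))
      (flatHamCovec v (z t s' - z t s))
    push_cast
    nlinarith

/-- Let `z(·, s)` be a Lipschitz family of solutions of a Hamiltonian system, with Lagrangian
`L = p q' - h(z)`. For a.e. `s₀`, the variation of `∫ L` with respect to `s` at
`s₀` is given by the boundary terms `p δq`. -/
theorem ae_hasDerivAt_action {z : ℝ → ℝ → E × (E →L[ℝ] ℝ)} {L : ℝ → ℝ → ℝ}
    {h : ℝ → E × (E →L[ℝ] ℝ) → ℝ} {C : ℝ≥0} {a b : ℝ} (hab : a ≤ b)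
    (hz : LipschitzWith C (fun w : ℝ × ℝ => z w.1 w.2))
    (hLi : ∀ s, IntervalIntegrable (fun t => L t s) volume a b)
    (hd : ∀ s, ∀ᵐ t, t ∈ Icc a b → ∃ v : E × (E →L[ℝ] ℝ), HasDerivAt (fun t => z t s) v t ∧
      HasFDerivAt (h t) (flatHamCovec v) (z t s) ∧ L t s = (z t s).2 v.1 - h t (z t s))
    (hc : ∀ᵐ t, t ∈ Icc a b → ∀ s,
      (fun s' => h t (z t s') - h t (z t s)) =O[𝓝 s] fun s' => s' - s) :
    ∀ᵐ s₀, HasDerivAt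
      (fun s => (∫ t in a..b, L t s) - (z b s₀).2 (z b s).1 + (z a s₀).2 (z a s).1) 0 s₀ := by
  have hsub : uIoc a b ⊆ Icc a b := by rw [uIoc_of_le hab]; exact Ioc_subset_Icc_self
  have hzs : ∀ t, LipschitzWith C (z t) := fun t => LipschitzWith.of_dist_le_mul fun x y => by
    simpa using hz.dist_le_mul (t, x) (t, y)
  have hzt : ∀ s, LipschitzWith C (fun t => z t s) := fun s =>
    LipschitzWith.of_dist_le_mul fun x y => by simpa using hz.dist_le_mul (x, s) (y, s)
  have hqt : ∀ s, LipschitzWith C (fun t => (z t s).1) := fun s => by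
    simpa [Function.comp_def] using LipschitzWith.prod_fst.comp (hzt s)
  have hpt : ∀ s, LipschitzWith C (fun t => (z t s).2) := fun s => by
    simpa [Function.comp_def] using LipschitzWith.prod_snd.comp (hzt s)
  have hps : ∀ t, LipschitzWith C (fun s => (z t s).2) := fun t => by
    simpa [Function.comp_def] using LipschitzWith.prod_snd.comp (hzs t)
  have hzn : ∀ t s s', ‖z t s' - z t s‖ ≤ C * |s' - s| := fun t s s' => by
    rw [← dist_eq_norm, ← Real.dist_eq]; exact (hzs t).dist_le_mul s' s
  have hLip := (intervalIntegrable_and_ae_lipschitzWith_energy hab hz hLi hd hc).2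
  -- Rademacher's theorem in `s` for each fixed `t`, then Fubini. These are the parameters for which
  -- the formula is proved.
  have hgood : ∀ᵐ s₀, ∀ᵐ t ∂volume.restrict (Icc a b),
      DifferentiableAt ℝ (fun s => (z t s).2) s₀ := by
    have hcont : Continuous (Function.uncurry fun t s => (z t s).2) :=
      continuous_snd.comp hz.continuous
    have := measurableSet_of_differentiableAt_with_param ℝ hcont
    rw [← Measure.ae_ae_comm (p := fun t s => DifferentiableAt ℝ (fun s => (z t s).2) s) this]
    exact Eventually.of_forall fun t => (hps t).ae_differentiableAt_real
  filter_upwards [hgood] with s₀ hs₀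
  rw [ae_restrict_iff' measurableSet_Icc] at hs₀ hLip
  rw [hasDerivAt_iff_tendsto_slope]
  -- Along a sequence of parameters only countably many exceptional sets of times occur.
  refine tendsto_of_seq_tendsto fun w hw => ?_
  have hw1 : Tendsto w atTop (𝓝 s₀) := hw.mono_right nhdsWithin_le_nhds
  have hne : ∀ᶠ k in atTop, w k ≠ s₀ := hw.eventually self_mem_nhdsWithin
  set q₀ := fun t => (z t s₀).1 with hq₀
  set p₀ := fun t => (z t s₀).2 with hp₀
  -- The splitting is `ΔL = (p₀ δ)' + Δp · δ' - (Δh - dh Δz)`. After division by `w k - s₀`, `r k`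
  -- is the quotient of `Δp` and `ρ k` is minus the quotient of the Taylor remainder; `(p₀ δ)'`
  -- integrates to the boundary terms.
  set δ : ℕ → ℝ → E := fun k t => (z t (w k)).1 - (z t s₀).1 with hδ
  set r : ℕ → ℝ → E →L[ℝ] ℝ := fun k t => (w k - s₀)⁻¹ • ((z t (w k)).2 - (z t s₀).2) with hr
  set ρ : ℕ → ℝ → ℝ := fun k t => (w k - s₀)⁻¹ * (L t (w k) - L t s₀ - deriv p₀ t (δ k t) -
    (z t (w k)).2 (deriv (δ k) t)) with hρ
  have hδl : ∀ k, LipschitzWith (C + C) (δ k) := fun k => (hqt (w k)).sub (hqt s₀)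
  have hδn : ∀ k t, ‖δ k t‖ ≤ C * |w k - s₀| := fun k t => (norm_fst_le _).trans (hzn t s₀ (w k))
  have hrl : ∀ k, LipschitzWith (‖(w k - s₀)⁻¹‖₊ * (C + C)) (r k) := fun k => by
    exact (lipschitzWith_smul (w k - s₀)⁻¹).comp ((hpt (w k)).sub (hpt s₀))
  -- True also if `w k = s₀`, where the inverse is `0`, so no term of the sequence is discarded.
  have hinv : ∀ k, |(w k - s₀)⁻¹| * |w k - s₀| ≤ 1 := fun k => by
    rw [← abs_mul]
    rcases eq_or_ne (w k - s₀) 0 with h0 | h0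
    · simp [h0]
    · simp [inv_mul_cancel₀ h0]
  have hrn : ∀ k, ∀ t ∈ Icc a b, ‖r k t‖ ≤ C := fun k t _ => by
    have h1 : ‖(z t (w k)).2 - (z t s₀).2‖ ≤ C * |w k - s₀| :=
      (norm_snd_le _).trans (hzn t s₀ (w k))
    simp only [hr, norm_smul, Real.norm_eq_abs]
    have := hinv k
    have h3 := mul_le_mul_of_nonneg_left h1 (abs_nonneg ((w k - s₀)⁻¹))
    nlinarith [C.coe_nonneg]
  -- The derivatives of `δ k` are only known to be bounded, so the lemma uses instead that `δ k`
  -- itself tends to `0` uniformly.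
  have hmid := tendsto_integral_pairing_deriv_zero (ε := fun k => C * |w k - s₀|)
    (ρ := fun t => deriv (fun s => (z t s).2) s₀) hab hrl hrn (by
      filter_upwards [hs₀] with t ht hm
      have := hasDerivAt_iff_tendsto_slope.1 (ht hm).hasDerivAt
      exact this.comp hw) hδl (fun k t _ => hδn k t) (by
      have : Tendsto (fun k => w k - s₀) atTop (𝓝 0) := by simpa using hw1.sub_const s₀
      simpa using this.abs.const_mul (C : ℝ))
  have hall : ∀ᵐ t, ∀ k, t ∈ Icc a b → ∃ v : E × (E →L[ℝ] ℝ), HasDerivAt (fun t => z t (w k)) v t ∧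
      HasFDerivAt (h t) (flatHamCovec v) (z t (w k)) ∧
      L t (w k) = (z t (w k)).2 v.1 - h t (z t (w k)) := ae_all_iff.2 fun k => hd (w k)
  -- the pointwise form of `ρ`
  have hform : ∀ᵐ t, t ∈ Icc a b → ∃ v : E × (E →L[ℝ] ℝ), ‖v‖ ≤ C ∧
      HasFDerivAt (h t) (flatHamCovec v) (z t s₀) ∧ ∀ k, ρ k t = -((w k - s₀)⁻¹ *
        (h t (z t (w k)) - h t (z t s₀) - flatHamCovec v (z t (w k) - z t s₀))) := by
    filter_upwards [hall, hd s₀] with t h1 h2 hm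
    obtain ⟨v, a1, a2, a3⟩ := h2 hm
    refine ⟨v, by rw [← a1.deriv]; exact (hzt s₀).norm_deriv_le t, a2, fun k => ?_⟩
    obtain ⟨v', b1, b2, b3⟩ := h1 k hm
    have e1 : deriv p₀ t = v.2 := a1.curve_snd.deriv
    have e2 : deriv (δ k) t = v'.1 - v.1 := (b1.curve_fst.sub a1.curve_fst).deriv
    simp only [hρ]
    rw [e1, e2, a3, b3]
    simp only [flatHamCovec_apply, hδ, map_sub]
    ring
  have hm1 : ∀ k, AEStronglyMeasurable (ρ k) (volume.restrict (uIoc a b)) := fun k => by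
    have hL' : ∀ s, AEStronglyMeasurable (fun t => L t s) (volume.restrict (uIoc a b)) := fun s =>
      (hLi s).aestronglyMeasurable_restrict_uIoc
    exact ((((hL' _).sub (hL' _)).sub (aestronglyMeasurable_pairing (aestronglyMeasurable_deriv _ _)
      (hδl k).continuous.aestronglyMeasurable)).sub
      (aestronglyMeasurable_pairing (hpt _).continuous.aestronglyMeasurable
      (aestronglyMeasurable_deriv _ _))).const_mul _
  -- The dominating constant: the Lipschitz constant of the energy in `s`, plus the bound of the
  -- linear term.
  have hρb : ∀ k, ∀ᵐ t, t ∈ uIoc a b → ‖ρ k t‖ ≤ 2 * C * C + C + 2 * C * C := fun k => by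
    filter_upwards [hform, hLip] with t h1 h2 hm
    obtain ⟨v, hv, a2, a3⟩ := h1 (hsub hm)
    have h3 := (h2 (hsub hm)).dist_le_mul (w k) s₀
    rw [Real.dist_eq, Real.dist_eq] at h3
    push_cast at h3
    have h4 := abs_flatHamCovec_le v (z t (w k) - z t s₀)
    have h5 := hzn t s₀ (w k)
    have h7 : 2 * ‖v‖ * ‖z t (w k) - z t s₀‖ ≤ 2 * C * (C * |w k - s₀|) := by gcongr
    rw [a3 k, norm_neg, norm_mul, Real.norm_eq_abs, Real.norm_eq_abs]
    have h8 := abs_sub (h t (z t (w k)) - h t (z t s₀)) (flatHamCovec v (z t (w k) - z t s₀))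
    have h9 : |h t (z t (w k)) - h t (z t s₀) - flatHamCovec v (z t (w k) - z t s₀)| ≤
        (2 * C * C + C + 2 * C * C) * |w k - s₀| := by nlinarith
    have := mul_le_mul_of_nonneg_left h9 (abs_nonneg ((w k - s₀)⁻¹))
    have h10 : (0 : ℝ) ≤ 2 * C * C + C + 2 * C * C := by positivity
    nlinarith [hinv k]
  have hρi : ∀ k, IntervalIntegrable (ρ k) volume a b := fun k =>
    intervalIntegrable_of_ae_bound (hm1 k) (hρb k)
  have hρ0 : Tendsto (fun k => ∫ t in a..b, ρ k t) atTop (𝓝 0) := by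
    have := intervalIntegral.tendsto_integral_filter_of_dominated_convergence
      (μ := volume) (a := a) (b := b) (F := ρ) (f := fun _ => (0 : ℝ))
      (l := atTop) (fun _ => 2 * C * C + C + 2 * C * C) (Eventually.of_forall hm1)
      (Eventually.of_forall hρb) intervalIntegrable_const (by
        filter_upwards [hform] with t h1 hm
        obtain ⟨v, hv, a2, a3⟩ := h1 (hsub hm)
        have h2 := a2.isLittleO.comp_tendsto (((hzs t).continuous.tendsto s₀).comp hw1)
        have h3 : (fun k => z t (w k) - z t s₀) =O[atTop] fun k => w k - s₀ :=
          Asymptotics.IsBigO.of_bound C (Eventually.of_forall fun k => hzn t s₀ (w k))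
        have h4 := (h2.trans_isBigO h3).tendsto_div_nhds_zero
        refine (neg_zero (G := ℝ) ▸ h4.neg).congr fun k => ?_
        rw [a3 k, div_eq_inv_mul]
        rfl)
    simpa using this
  have hsum := hρ0.add hmid
  rw [add_zero] at hsum
  refine hsum.congr fun k => ?_
  obtain ⟨i1, i2⟩ := integral_deriv_pairing (hpt s₀) (hδl k) a b
  have i3 : IntervalIntegrable (fun t => r k t (deriv (δ k) t)) volume a b :=
    intervalIntegrable_of_ae_bound (C := C * (C + C)) (aestronglyMeasurable_pairing
      (hrl k).continuous.aestronglyMeasurable (aestronglyMeasurable_deriv _ _))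
      (Eventually.of_forall fun t ht => ((r k t).le_opNorm _).trans
        (mul_le_mul (hrn k t (hsub ht)) (by simpa using (hδl k).norm_deriv_le t)
        (norm_nonneg _) C.coe_nonneg))
  rw [← intervalIntegral.integral_add (hρi k) i3]
  have e : ∀ t, ρ k t + r k t (deriv (δ k) t) = (w k - s₀)⁻¹ * (L t (w k) - L t s₀ -
      (deriv p₀ t (δ k t) + p₀ t (deriv (δ k) t))) := fun t => by
    simp only [hρ, hr, hp₀, smul_apply, sub_apply, smul_eq_mul]
    ring
  simp_rw [e]
  rw [intervalIntegral.integral_const_mul, intervalIntegral.integral_sub ((hLi _).sub (hLi _)) i1,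
    intervalIntegral.integral_sub (hLi _) (hLi _), i2, Function.comp, slope_def_field, div_eq_inv_mul]
  simp only [hδ, map_sub]
  ring
end

/-! ### Curves in a manifold read in one chart. -/

section
variable {E H N : Type*} [NormedAddCommGroup E] [NormedSpace ℝ E]
    [TopologicalSpace H] {I : ModelWithCorners ℝ E H} [TopologicalSpace N]
    [ChartedSpace H N]

theorem continuousAt_of_extChartAt {x : N} {c : ℝ → N} {s : ℝ}
    (hs : ∀ᶠ s' in 𝓝 s, c s' ∈ (extChartAt I x).source)
    (hc : ContinuousAt (fun s' => extChartAt I x (c s')) s) : ContinuousAt c s := by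
  have h1 := ContinuousAt.comp (g := (extChartAt I x).symm)
    (f := fun s' => extChartAt I x (c s')) (x := s)
    (continuousAt_extChartAt_symm' hs.self_of_nhds) hc
  refine h1.congr ?_
  filter_upwards [hs] with s' hs'
  exact (extChartAt I x).left_inv hs'

/-- Two functions with the same differential at `y s₀` have the same derivative along every curve
`y` which is Lipschitz at `s₀`. -/
theorem hasDerivAt_sub_comp_of_same_mfderiv [I.Boundaryless] [IsManifold I 1 N] {x : N}
    {y : ℝ → N} {s₀ : ℝ} {D : ℝ} (hs : ∀ᶠ s in 𝓝 s₀, y s ∈ (extChartAt I x).source)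
    (hD : ∀ᶠ s in 𝓝 s₀, ‖extChartAt I x (y s) - extChartAt I x (y s₀)‖ ≤ D * ‖s - s₀‖)
    {g₁ g₂ : N → ℝ} {p : E →L[ℝ] ℝ} (h₁ : HasMFDerivAt I 𝓘(ℝ, ℝ) g₁ (y s₀) p)
    (h₂ : HasMFDerivAt I 𝓘(ℝ, ℝ) g₂ (y s₀) p) {Θ : ℝ → ℝ}
    (hΘ : HasDerivAt (fun s => Θ s - g₁ (y s)) 0 s₀) :
    HasDerivAt (fun s => Θ s - g₂ (y s)) 0 s₀ := by
  have hy := hs.self_of_nhds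
  have h3 := ((hasMFDerivAt_iff_comp_symm hy).1 h₁).sub ((hasMFDerivAt_iff_comp_symm hy).1 h₂)
  rw [sub_self] at h3
  have hO : (fun s => extChartAt I x (y s) - extChartAt I x (y s₀)) =O[𝓝 s₀] fun s => s - s₀ :=
    Asymptotics.IsBigO.of_bound D hD
  have h0 : Tendsto (fun s => s - s₀) (𝓝 s₀) (𝓝 0) := by
    simpa using (continuous_sub_right s₀).tendsto s₀
  have hcont : Tendsto (fun s => extChartAt I x (y s)) (𝓝 s₀) (𝓝 (extChartAt I x (y s₀))) :=
    tendsto_sub_nhds_zero_iff.1 (hO.trans_tendsto h0)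
  -- `y` need not be differentiable at `s₀`: a map with zero differential turns `O(s - s₀)` into
  -- `o(s - s₀)`.
  have h4 := (h3.isLittleO.comp_tendsto hcont).trans_isBigO hO
  have h5 : HasDerivAt (fun s => g₁ (y s) - g₂ (y s)) 0 s₀ := by
    rw [hasDerivAt_iff_isLittleO]
    refine h4.congr' ?_ EventuallyEq.rfl
    filter_upwards [hs] with s hs'
    simp only [Function.comp, Pi.sub_apply, (extChartAt I x).left_inv hs',
      (extChartAt I x).left_inv hy, zero_apply, smul_zero]
  have h6 := hΘ.add h5
  rw [add_zero] at h6
  refine h6.congr_of_eventuallyEq (Eventually.of_forall fun s => ?_)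
  simp
end

/-! ### The Hamiltonian flow in windows covered by one canonical chart. -/

section
variable {n : ℕ} {M : Type*} [TopologicalSpace M]
  [ChartedSpace (EuclideanSpace ℝ (Fin n)) M] [IsManifold (𝓡 n) ∞ M]

/-- A concrete primitive of the covector `z`: it is linear in the chart, so the terms `p · q` of the
flat formula can be read as values of functions on `M`. -/
theorem hasMFDerivAt_momentum_comp_chart {z₀ z : Ctg n M}
    (h : z ∈ (extChartAt (ctgModel n) z₀).source) :
    HasMFDerivAt (𝓡 n) 𝓘(ℝ, ℝ)
      (fun x => (extChartAt (ctgModel n) z₀ z).2 (extChartAt (𝓡 n) z₀.proj x)) z.proj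
      (z.2 : EuclideanSpace ℝ (Fin n) →L[ℝ] ℝ) := by
  have hp := mem_ctg_source.1 h
  have e : (z.2 : EuclideanSpace ℝ (Fin n) →L[ℝ] ℝ) =
      (extChartAt (ctgModel n) z₀ z).2.comp (chartDeriv (𝓡 n) z₀.proj z.proj) :=
    ContinuousLinearMap.ext fun v => (ctg_extChartAt_snd_apply hp v).symm
  rw [e, hasMFDerivAt_comp_chartDeriv_iff hp]
  refine (extChartAt (ctgModel n) z₀ z).2.hasFDerivAt.congr_of_eventuallyEq ?_
  filter_upwards [extChartAt_target_mem_nhds' (I := 𝓡 n) ((extChartAt (𝓡 n) z₀.proj).map_source hp)]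
    with w hw
  simp only [Function.comp, (extChartAt (𝓡 n) z₀.proj).right_inv hw]

/-- Hamilton's equations and the Lagrangian in canonical coordinates along a solution. -/
theorem IsHamSolution.chart {H : ℝ → Ctg n M → ℝ} {O : Set (Ctg n M)} {K : Set ℝ} {c : ℝ → Ctg n M}
    (hc : IsHamSolution H O K c) (z₀ : Ctg n M) :
    ∀ᵐ t ∂volume.restrict K, c t ∈ (extChartAt (ctgModel n) z₀).source →
      ∃ v : EuclideanSpace ℝ (Fin n) × (EuclideanSpace ℝ (Fin n) →L[ℝ] ℝ),
        HasDerivAt (fun s => extChartAt (ctgModel n) z₀ (c s)) v t ∧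
        HasFDerivAt (H t ∘ (extChartAt (ctgModel n) z₀).symm) (flatHamCovec v)
          (extChartAt (ctgModel n) z₀ (c t)) ∧
        ∀ (Hc : ℝ → Ctg n M → Ctg n M) (ℓ : Ctg n M), Hc t ℓ = c t →
          cartanIntegrand H Hc t ℓ = (extChartAt (ctgModel n) z₀ (c t)).2 v.1 - H t (c t) := by
  filter_upwards [hc.2.2] with t ht hm
  obtain ⟨X, hX, hX'⟩ := ht
  refine ⟨chartDeriv (ctgModel n) z₀ (c t) X, HasMFDerivAt.hasDerivAt_extChartAt hX' hm,
    IsHamVec.hasFDerivAt_chart hX hm, fun Hc ℓ hℓ => ?_⟩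
  rw [← hℓ] at hX hm ⊢
  exact cartanIntegrand_eq hX hm

variable {α : M → ℝ} {W : Set M} {H : ℝ → Ctg n M → ℝ} {J : Set ℝ} {O : Set (Ctg n M)}
  {Hc : ℝ → Ctg n M → Ctg n M}

theorem continuous_curve_of_chart {z₀ : Ctg n M} {c : ℝ → Ctg n M} {D : ℝ≥0}
    (hs : ∀ s, c s ∈ (extChartAt (ctgModel n) z₀).source)
    (hD : LipschitzWith D fun s => extChartAt (ctgModel n) z₀ (c s)) : Continuous c :=
  continuous_iff_continuousAt.2 fun s =>
    continuousAt_of_extChartAt (Eventually.of_forall hs) (hD.continuous.continuousAt)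

/-- Calmness of `h` at `z`, read along a curve which is Lipschitz in some canonical chart. -/
theorem isBigO_comp_curve_of_calm {h : Ctg n M → ℝ} {z₀ : Ctg n M} {c : ℝ → Ctg n M} {D : ℝ≥0}
    (hs : ∀ s, c s ∈ (extChartAt (ctgModel n) z₀).source)
    (hD : LipschitzWith D fun s => extChartAt (ctgModel n) z₀ (c s)) {s : ℝ}
    (hcalm : (fun z => h z - h (c s)) =O[𝓝 (c s)]
      (fun z => extChartAt (ctgModel n) (c s) z - extChartAt (ctgModel n) (c s) (c s))) :
    (fun s' => h (c s') - h (c s)) =O[𝓝 s] fun s' => s' - s := by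
  have h1 := hcalm.comp_tendsto ((continuous_curve_of_chart hs hD).tendsto s)
  refine h1.trans ?_
  -- Calmness is expressed in the chart at `c s` and the Lipschitz bound in the chart at `z₀`;
  -- differentiability of the transition map is enough to compare them.
  have hdiff : DifferentiableAt ℝ (extChartAt (ctgModel n) (c s) ∘ (extChartAt (ctgModel n) z₀).symm)
      (extChartAt (ctgModel n) z₀ (c s)) :=
    (contDiffAt_extChartAt_transition (k := 1) (mem_extChartAt_source (c s)) (hs s)).differentiableAt
      (by norm_num)
  have h2 := hdiff.isBigO_sub.comp_tendsto (hD.continuous.tendsto s)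
  have h3 : (fun s' => extChartAt (ctgModel n) z₀ (c s') - extChartAt (ctgModel n) z₀ (c s))
      =O[𝓝 s] fun s' => s' - s := by
    refine Asymptotics.IsBigO.of_bound D (Eventually.of_forall fun s' => ?_)
    rw [← dist_eq_norm, ← dist_eq_norm]
    exact hD.dist_le_mul s' s
  refine (h2.trans h3).congr_left fun s' => ?_
  simp only [Function.comp, (extChartAt (ctgModel n) z₀).left_inv (hs _)]

theorem HamiltonianAssumption.intervalIntegrable (hH : HamiltonianAssumption α W H J O Hc)
    (hJ : J.OrdConnected) {ℓ : Ctg n M} (hℓ : ℓ ∈ graphOfD α W) {a b : ℝ} (ha : a ∈ J)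
    (hb : b ∈ J) : IntervalIntegrable (fun t => cartanIntegrand H Hc t ℓ) volume a b := by
  obtain ⟨G, ⟨hG, -⟩, hGe⟩ := hH.integrand
  obtain ⟨hm, C, hC⟩ := hG ℓ hℓ
  have hs : uIoc a b ⊆ J := uIoc_subset_uIcc.trans (hJ.uIcc_subset ha hb)
  have h1 : IntervalIntegrable (fun t => G t ℓ) volume a b :=
    intervalIntegrable_of_ae_bound (C := C) (hm.mono_measure (Measure.restrict_mono hs le_rfl)).aestronglyMeasurable
      (Eventually.of_forall fun t ht => hC t (hs ht))
  exact h1.congr_ae (ae_restrict_of_ae_restrict_of_subset hs (hGe ℓ hℓ))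

theorem HamiltonianAssumption.theta_sub (hH : HamiltonianAssumption α W H J O Hc)
    (hJ : J.OrdConnected) (h0 : (0 : ℝ) ∈ J) {ℓ : Ctg n M} (hℓ : ℓ ∈ graphOfD α W) {a b : ℝ}
    (ha : a ∈ J) (hb : b ∈ J) :
    theta α H Hc b ℓ - theta α H Hc a ℓ = ∫ t in a..b, cartanIntegrand H Hc t ℓ := by
  rw [theta, theta, add_sub_add_left_eq_sub]
  exact intervalIntegral.integral_interval_sub_left (hH.intervalIntegrable hJ hℓ h0 hb)
    (hH.intervalIntegrable hJ hℓ h0 ha)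

/-- Local Lipschitz continuity of the flow unpacked on a product neighbourhood. As `J` is open the
time window is two-sided, whereas `N` is a neighbourhood only inside `Λ`. -/
theorem HamiltonianAssumption.exists_window (hH : HamiltonianAssumption α W H J O Hc)
    (hJ : IsOpen J) {ℓ₀ : Ctg n M} (hℓ₀ : ℓ₀ ∈ graphOfD α W) {t₀ : ℝ} (ht₀ : t₀ ∈ J) :
    ∃ ε > 0, Icc (t₀ - ε) (t₀ + ε) ⊆ J ∧ ∃ N ∈ 𝓝[graphOfD α W] ℓ₀, ∃ C : ℝ≥0,
      N ⊆ graphOfD α W ∧ N ⊆ (extChartAt (ctgModel n) ℓ₀).source ∧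
      ∀ t ∈ Icc (t₀ - ε) (t₀ + ε), ∀ ℓ ∈ N,
        Hc t ℓ ∈ (extChartAt (ctgModel n) (Hc t₀ ℓ₀)).source ∧
        ∀ t' ∈ Icc (t₀ - ε) (t₀ + ε), ∀ ℓ' ∈ N,
          dist (extChartAt (ctgModel n) (Hc t₀ ℓ₀) (Hc t ℓ))
            (extChartAt (ctgModel n) (Hc t₀ ℓ₀) (Hc t' ℓ')) ≤ C * max (dist t t')
              (dist (extChartAt (ctgModel n) ℓ₀ ℓ) (extChartAt (ctgModel n) ℓ₀ ℓ')) := by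
  obtain ⟨hc, C, u, hu, hC⟩ := hH.flow_lipschitz (t₀, ℓ₀) ⟨ht₀, hℓ₀⟩
  have h1 : ∀ᶠ q : ℝ × Ctg n M in 𝓝[J ×ˢ graphOfD α W] (t₀, ℓ₀),
      Hc q.1 q.2 ∈ (extChartAt (ctgModel n) (Hc t₀ ℓ₀)).source :=
    hc.eventually_mem (extChartAt_source_mem_nhds (Hc t₀ ℓ₀))
  have h2 := h1.and hu
  rw [nhdsWithin_prod_eq, hJ.nhdsWithin_eq ht₀] at h2
  obtain ⟨A, hA, B, hB, hAB⟩ := Filter.mem_prod_iff.1 h2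
  obtain ⟨ε, hε, hεA⟩ := Metric.nhds_basis_closedBall.mem_iff.1 (inter_mem hA (hJ.mem_nhds ht₀))
  rw [Real.closedBall_eq_Icc] at hεA
  refine ⟨ε, hε, fun t ht => (hεA ht).2, B ∩ (graphOfD α W ∩ (extChartAt (ctgModel n) ℓ₀).source),
    inter_mem hB (inter_mem self_mem_nhdsWithin
      (mem_nhdsWithin_of_mem_nhds (extChartAt_source_mem_nhds ℓ₀))),
    C.toNNReal, fun ℓ h => h.2.1, fun ℓ h => h.2.2, fun t ht ℓ hℓ => ⟨?_, fun t' ht' ℓ' hℓ' => ?_⟩⟩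
  · exact (hAB (mk_mem_prod (hεA ht).1 hℓ.1)).1
  · have h3 := hC (t, ℓ) (hAB (mk_mem_prod (hεA ht).1 hℓ.1)).2 (t', ℓ')
      (hAB (mk_mem_prod (hεA ht').1 hℓ'.1)).2
    refine h3.trans ?_
    have e : dist (extChartAt (𝓘(ℝ, ℝ).prod (ctgModel n)) (t₀, ℓ₀) (t, ℓ))
        (extChartAt (𝓘(ℝ, ℝ).prod (ctgModel n)) (t₀, ℓ₀) (t', ℓ')) = max (dist t t')
              (dist (extChartAt (ctgModel n) ℓ₀ ℓ) (extChartAt (ctgModel n) ℓ₀ ℓ')) := by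
      simp only [extChartAt_prod, Prod.dist_eq]
      rfl
    rw [e]
    exact mul_le_mul_of_nonneg_right (Real.le_coe_toNNReal C) (le_max_of_le_left dist_nonneg)

/-- In a window covered by one canonical chart, a Lipschitz family of initial values gives rise to
a Lipschitz family of solutions of the Hamiltonian system in coordinates. -/
theorem HamiltonianAssumption.curve_family (hH : HamiltonianAssumption α W H J O Hc)
    (hJ : J.OrdConnected) {z₀ ℓ₀ : Ctg n M} {a b : ℝ} (hab : a ≤ b)
    (hJab : Icc a b ⊆ J) {N : Set (Ctg n M)} {C : ℝ≥0} (hN : N ⊆ graphOfD α W)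
    (hw : ∀ t ∈ Icc a b, ∀ ℓ ∈ N, Hc t ℓ ∈ (extChartAt (ctgModel n) z₀).source ∧
        ∀ t' ∈ Icc a b, ∀ ℓ' ∈ N,
          dist (extChartAt (ctgModel n) z₀ (Hc t ℓ)) (extChartAt (ctgModel n) z₀ (Hc t' ℓ')) ≤
            C * max (dist t t')
              (dist (extChartAt (ctgModel n) ℓ₀ ℓ) (extChartAt (ctgModel n) ℓ₀ ℓ')))
    {γ : ℝ → Ctg n M} (hγ : ∀ s, γ s ∈ N) {D : ℝ≥0}
    (hD : LipschitzWith D fun s => extChartAt (ctgModel n) ℓ₀ (γ s))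
    {z : ℝ → ℝ → EuclideanSpace ℝ (Fin n) × (EuclideanSpace ℝ (Fin n) →L[ℝ] ℝ)}
    (hz : z = fun t s => extChartAt (ctgModel n) z₀ (Hc (projIcc a b hab t) (γ s))) :
    LipschitzWith (C * max 1 D) (fun w : ℝ × ℝ => z w.1 w.2) ∧
    (∀ t ∈ Icc a b, ∀ s, z t s = extChartAt (ctgModel n) z₀ (Hc t (γ s))) ∧
    (∀ s, IntervalIntegrable (fun t => cartanIntegrand H Hc t (γ s)) volume a b) ∧
    (∀ s, ∀ᵐ t, t ∈ Icc a b → ∃ v : EuclideanSpace ℝ (Fin n) × (EuclideanSpace ℝ (Fin n) →L[ℝ] ℝ),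
      HasDerivAt (fun t => z t s) v t ∧
      HasFDerivAt (H t ∘ (extChartAt (ctgModel n) z₀).symm) (flatHamCovec v) (z t s) ∧
      cartanIntegrand H Hc t (γ s) =
        (z t s).2 v.1 - (H t ∘ (extChartAt (ctgModel n) z₀).symm) (z t s)) ∧
    (∀ᵐ t, t ∈ Icc a b → ∀ s,
      (fun s' => (H t ∘ (extChartAt (ctgModel n) z₀).symm) (z t s') -
        (H t ∘ (extChartAt (ctgModel n) z₀).symm) (z t s)) =O[𝓝 s] fun s' => s' - s) := by
  -- Clamping times to `[a, b]` makes the family Lipschitz on the whole plane, as the flat lemmas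
  -- require.
  let cl : ℝ → ℝ := fun t => projIcc a b hab t
  have hcl : ∀ t, cl t ∈ Icc a b := fun t => (projIcc a b hab t).2
  have hcld : ∀ t t', dist (cl t) (cl t') ≤ dist t t' := fun t t' => by
    have := (LipschitzWith.projIcc hab).dist_le_mul t t'
    rwa [NNReal.coe_one, one_mul] at this
  have haI := left_mem_Icc.2 hab
  have hbI := right_mem_Icc.2 hab
  have hzid : ∀ t ∈ Icc a b, ∀ s, z t s = extChartAt (ctgModel n) z₀ (Hc t (γ s)) :=
    fun t ht s => by simp only [hz, projIcc_of_mem hab ht]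
  have hzl : LipschitzWith (C * max 1 D) (fun w : ℝ × ℝ => z w.1 w.2) := by
    subst hz
    refine LipschitzWith.of_dist_le_mul fun x y => ?_
    refine ((hw _ (hcl x.1) _ (hγ x.2)).2 _ (hcl y.1) _ (hγ y.2)).trans ?_
    rw [NNReal.coe_mul, mul_assoc]
    refine mul_le_mul_of_nonneg_left (max_le ?_ ?_) C.coe_nonneg
    · refine ((hcld _ _).trans (le_max_left (dist x.1 y.1) (dist x.2 y.2))).trans ?_
      rw [Prod.dist_eq]
      exact le_mul_of_one_le_left (le_max_of_le_left dist_nonneg) (by exact_mod_cast le_max_left 1 D)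
    · refine (hD.dist_le_mul _ _).trans ?_
      rw [Prod.dist_eq]
      exact mul_le_mul (by exact_mod_cast le_max_right 1 D) (le_max_right _ _) dist_nonneg
        (NNReal.coe_nonneg _)
  refine ⟨hzl, hzid, fun s => hH.intervalIntegrable hJ (hN (hγ s)) (hJab haI) (hJab hbI),
    fun s => ?_, ?_⟩
  · have h1 := ae_restrict_of_ae_restrict_of_subset hJab
      ((hH.flow _ (hN (hγ s))).2.1.chart z₀)
    rw [ae_restrict_iff' measurableSet_Icc] at h1
    -- The clamped curve agrees with the solution on a neighbourhood of `t` only when `t` is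
    -- interior.
    have h2 : ∀ᵐ t : ℝ, t ≠ a ∧ t ≠ b := by
      refine (Measure.ae_ne volume a).and (Measure.ae_ne volume b)
    filter_upwards [h1, h2] with t h1 h2 ht
    obtain ⟨v, h3, h4, h5⟩ := h1 ht (hw t ht _ (hγ s)).1
    have h6 := h5 Hc (γ s) rfl
    rw [← hzid t ht] at h4 h6
    refine ⟨v, h3.congr_of_eventuallyEq ?_, h4, ?_⟩
    · have : Ioo a b ∈ 𝓝 t := Ioo_mem_nhds (lt_of_le_of_ne ht.1 h2.1.symm)
        (lt_of_le_of_ne ht.2 h2.2)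
      filter_upwards [this] with t' ht'
      exact hzid t' (Ioo_subset_Icc_self ht') s
    · rw [h6, hzid t ht, Function.comp,
        (extChartAt (ctgModel n) z₀).left_inv (hw t ht _ (hγ s)).1]
  · have h1 := ae_restrict_of_ae_restrict_of_subset hJab hH.calm
    rw [ae_restrict_iff' measurableSet_Icc] at h1
    filter_upwards [h1] with t h1 ht s
    have h2 := isBigO_comp_curve_of_calm (h := H t) (c := fun s => Hc t (γ s)) (D := C * max 1 D)
      (fun s => (hw t ht _ (hγ s)).1) (LipschitzWith.of_dist_le_mul fun x y => by
        simpa [hzid t ht] using hzl.dist_le_mul (t, x) (t, y)) (h1 ht _ (hN (hγ s)))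
    refine h2.congr_left fun s' => ?_
    simp only [Function.comp, hzid t ht, (extChartAt (ctgModel n) z₀).left_inv (hw t ht _ (hγ _)).1]

/-- The variation formula for `θ` between two times `a ≤ b` of a window covered by one chart. -/
theorem HamiltonianAssumption.ae_hasDerivAt_theta_sub (hH : HamiltonianAssumption α W H J O Hc)
    (hJ : J.OrdConnected) (h0 : (0 : ℝ) ∈ J) {z₀ ℓ₀ : Ctg n M} {a b : ℝ} (hab : a ≤ b)
    (hJab : Icc a b ⊆ J) {N : Set (Ctg n M)} {C : ℝ≥0} (hN : N ⊆ graphOfD α W)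
    (hw : ∀ t ∈ Icc a b, ∀ ℓ ∈ N, Hc t ℓ ∈ (extChartAt (ctgModel n) z₀).source ∧
        ∀ t' ∈ Icc a b, ∀ ℓ' ∈ N,
          dist (extChartAt (ctgModel n) z₀ (Hc t ℓ)) (extChartAt (ctgModel n) z₀ (Hc t' ℓ')) ≤
            C * max (dist t t')
              (dist (extChartAt (ctgModel n) ℓ₀ ℓ) (extChartAt (ctgModel n) ℓ₀ ℓ')))
    {γ : ℝ → Ctg n M} (hγ : ∀ s, γ s ∈ N) {D : ℝ≥0}
    (hD : LipschitzWith D fun s => extChartAt (ctgModel n) ℓ₀ (γ s)) :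
    ∀ᵐ s₀, HasDerivAt (fun s => (theta α H Hc b (γ s) - theta α H Hc a (γ s)) -
      (extChartAt (ctgModel n) z₀ (Hc b (γ s₀))).2 (extChartAt (ctgModel n) z₀ (Hc b (γ s))).1 +
      (extChartAt (ctgModel n) z₀ (Hc a (γ s₀))).2 (extChartAt (ctgModel n) z₀ (Hc a (γ s))).1)
      0 s₀ := by
  have haI := left_mem_Icc.2 hab
  have hbI := right_mem_Icc.2 hab
  obtain ⟨h1, h2, h3, h4, h5⟩ := hH.curve_family hJ hab hJab hN hw hγ hD rfl
  filter_upwards [ae_hasDerivAt_action hab h1 h3 h4 h5] with s₀ hs₀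
  refine hs₀.congr_of_eventuallyEq (Eventually.of_forall fun s => ?_)
  simp only [h2 a haI, h2 b hbI, hH.theta_sub hJ h0 (hN (hγ s)) (hJab haI) (hJab hbI)]
end

/-! ### The variation formula for `θ` at all times. -/

section
variable {n : ℕ} {M : Type*} [TopologicalSpace M]
  [ChartedSpace (EuclideanSpace ℝ (Fin n)) M] [IsManifold (𝓡 n) ∞ M]

/-- Along almost every point of each Lipschitz curve in `Λ` near `ℓ₀`, the differential of
`θ(t, ·)` is the pull-back by `Hc t` of the Liouville form `p dq`. -/
def ThetaVariation (α : M → ℝ) (H : ℝ → Ctg n M → ℝ) (Hc : ℝ → Ctg n M → Ctg n M)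
    (Λ : Set (Ctg n M)) (ℓ₀ : Ctg n M) (t : ℝ) : Prop :=
  ∃ N ∈ 𝓝[Λ] ℓ₀, ∀ (γ : ℝ → Ctg n M) (D : ℝ≥0), (∀ s, γ s ∈ N) →
    LipschitzWith D (fun s => extChartAt (ctgModel n) ℓ₀ (γ s)) →
    -- Allowing every primitive `g` of the momentum makes the property independent of charts, so it
    -- can be handed from one time window to the next.
    ∀ᵐ s₀, ∀ g : M → ℝ, HasMFDerivAt (𝓡 n) 𝓘(ℝ, ℝ) g (Hc t (γ s₀)).proj
        ((Hc t (γ s₀)).2 : EuclideanSpace ℝ (Fin n) →L[ℝ] ℝ) →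
      HasDerivAt (fun s => theta α H Hc t (γ s) - g (Hc t (γ s)).proj) 0 s₀

variable {α : M → ℝ} {W : Set M} {H : ℝ → Ctg n M → ℝ} {J : Set ℝ} {O : Set (Ctg n M)}
  {Hc : ℝ → Ctg n M → Ctg n M}

theorem norm_base_chart_sub_le {z₀ z z' : Ctg n M} :
    ‖extChartAt (𝓡 n) z₀.proj z.proj - extChartAt (𝓡 n) z₀.proj z'.proj‖ ≤
      dist (extChartAt (ctgModel n) z₀ z) (extChartAt (ctgModel n) z₀ z') := by
  rw [← ctg_extChartAt_fst, ← ctg_extChartAt_fst, dist_eq_norm]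
  exact norm_fst_le (extChartAt (ctgModel n) z₀ z - extChartAt (ctgModel n) z₀ z')

/-- The variation formula at a point, stated with one or with all primitives of the momentum. -/
theorem hasDerivAt_sub_momentum_iff {z₀ : Ctg n M} {c : ℝ → Ctg n M} {D : ℝ≥0}
    (hs : ∀ s, c s ∈ (extChartAt (ctgModel n) z₀).source)
    (hD : LipschitzWith D fun s => extChartAt (ctgModel n) z₀ (c s)) {Θ : ℝ → ℝ} {s₀ : ℝ} :
    (∀ g : M → ℝ, HasMFDerivAt (𝓡 n) 𝓘(ℝ, ℝ) g (c s₀).proj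
        ((c s₀).2 : EuclideanSpace ℝ (Fin n) →L[ℝ] ℝ) →
      HasDerivAt (fun s => Θ s - g (c s).proj) 0 s₀) ↔
    HasDerivAt (fun s => Θ s - (extChartAt (ctgModel n) z₀ (c s₀)).2
      (extChartAt (ctgModel n) z₀ (c s)).1) 0 s₀ := by
  simp_rw [ctg_extChartAt_fst]
  constructor
  · exact fun h => h _ (hasMFDerivAt_momentum_comp_chart (hs s₀))
  · intro h g hg
    exact hasDerivAt_sub_comp_of_same_mfderiv (I := 𝓡 n) (x := z₀.proj) (y := fun s => (c s).proj)
      (D := D) (Eventually.of_forall fun s => mem_ctg_source.1 (hs s))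
      (Eventually.of_forall fun s => norm_base_chart_sub_le.trans
        ((hD.dist_le_mul s s₀).trans_eq (by rw [dist_eq_norm])))
      (hasMFDerivAt_momentum_comp_chart (hs s₀)) hg h

theorem hasMFDerivAt_dAt (hW : IsOpen W) (hα : ContMDiffOn (𝓡 n) 𝓘(ℝ, ℝ) ∞ α W) {x : M}
    (hx : x ∈ W) : HasMFDerivAt (𝓡 n) 𝓘(ℝ, ℝ) α x (covec α x) :=
  ((hα.contMDiffAt (hW.mem_nhds hx)).mdifferentiableAt (by simp)).hasMFDerivAt

/-- At time `0` the integral is empty and `α` is itself a primitive of the momentum, because `Λ` is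
the graph of `dα`. -/
theorem HamiltonianAssumption.thetaVariation_zero (hH : HamiltonianAssumption α W H J O Hc)
    (hW : IsOpen W) (hα : ContMDiffOn (𝓡 n) 𝓘(ℝ, ℝ) ∞ α W) (ℓ₀ : Ctg n M) :
    ThetaVariation α H Hc (graphOfD α W) ℓ₀ 0 := by
  refine ⟨graphOfD α W ∩ (extChartAt (ctgModel n) ℓ₀).source, inter_mem self_mem_nhdsWithin
    (mem_nhdsWithin_of_mem_nhds (extChartAt_source_mem_nhds ℓ₀)), fun γ D hγ hD => ?_⟩
  refine Eventually.of_forall fun s₀ g hg => ?_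
  have h0 : ∀ s, Hc 0 (γ s) = γ s := fun s => (hH.flow _ (hγ s).1).1
  rw [h0] at hg
  simp only [h0]
  obtain ⟨x, hx, hxs⟩ := (hγ s₀).1
  have hα' : HasMFDerivAt (𝓡 n) 𝓘(ℝ, ℝ) α (γ s₀).proj
      ((γ s₀).2 : EuclideanSpace ℝ (Fin n) →L[ℝ] ℝ) := by
    rw [← hxs]
    exact hasMFDerivAt_dAt hW hα hx
  refine hasDerivAt_sub_comp_of_same_mfderiv (I := 𝓡 n) (x := ℓ₀.proj) (y := fun s => (γ s).proj)
      (D := D) (Eventually.of_forall fun s => mem_ctg_source.1 (hγ s).2)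
      (Eventually.of_forall fun s => norm_base_chart_sub_le.trans
        ((hD.dist_le_mul s s₀).trans_eq (by rw [dist_eq_norm])))
      hα' hg ?_
  simp only [theta, intervalIntegral.integral_same, add_zero, sub_self]
  exact hasDerivAt_const _ _

/-- Inside a window the formulas at two times differ by the flat action formula, so either of them
implies the other. -/
theorem HamiltonianAssumption.thetaVariation_window (hH : HamiltonianAssumption α W H J O Hc)
    (hJo : IsOpen J) (hJ : J.OrdConnected) (h0 : (0 : ℝ) ∈ J) {ℓ₀ : Ctg n M}
    (hℓ₀ : ℓ₀ ∈ graphOfD α W) {t₀ : ℝ} (ht₀ : t₀ ∈ J) :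
    ∀ᶠ t in 𝓝 t₀, (ThetaVariation α H Hc (graphOfD α W) ℓ₀ t₀ ↔
      ThetaVariation α H Hc (graphOfD α W) ℓ₀ t) := by
  obtain ⟨ε, hε, hεJ, N, hN, C, hNΛ, -, hw⟩ := hH.exists_window hJo hℓ₀ ht₀
  have main : ∀ a ∈ Icc (t₀ - ε) (t₀ + ε), ∀ b ∈ Icc (t₀ - ε) (t₀ + ε), a ≤ b →
      (ThetaVariation α H Hc (graphOfD α W) ℓ₀ a ↔ ThetaVariation α H Hc (graphOfD α W) ℓ₀ b) := by
    intro a ha b hb hab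
    have hs : Icc a b ⊆ Icc (t₀ - ε) (t₀ + ε) := Icc_subset_Icc ha.1 hb.2
    have hcurve : ∀ (γ : ℝ → Ctg n M) (D : ℝ≥0), (∀ s, γ s ∈ N) →
        LipschitzWith D (fun s => extChartAt (ctgModel n) ℓ₀ (γ s)) →
        ∀ᵐ s₀, ((∀ g : M → ℝ, HasMFDerivAt (𝓡 n) 𝓘(ℝ, ℝ) g (Hc a (γ s₀)).proj
          ((Hc a (γ s₀)).2 : EuclideanSpace ℝ (Fin n) →L[ℝ] ℝ) →
          HasDerivAt (fun s => theta α H Hc a (γ s) - g (Hc a (γ s)).proj) 0 s₀) ↔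
          (∀ g : M → ℝ, HasMFDerivAt (𝓡 n) 𝓘(ℝ, ℝ) g (Hc b (γ s₀)).proj
          ((Hc b (γ s₀)).2 : EuclideanSpace ℝ (Fin n) →L[ℝ] ℝ) →
          HasDerivAt (fun s => theta α H Hc b (γ s) - g (Hc b (γ s)).proj) 0 s₀)) := by
      intro γ D hγ hD
      have hlip : ∀ t ∈ Icc (t₀ - ε) (t₀ + ε), LipschitzWith (C * D)
          fun s => extChartAt (ctgModel n) (Hc t₀ ℓ₀) (Hc t (γ s)) := fun t ht =>
        LipschitzWith.of_dist_le_mul fun s s' => by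
          refine ((hw t ht _ (hγ s)).2 t ht _ (hγ s')).trans ?_
          rw [dist_self, max_eq_right dist_nonneg, NNReal.coe_mul, mul_assoc]
          exact mul_le_mul_of_nonneg_left (hD.dist_le_mul s s') C.coe_nonneg
      filter_upwards [hH.ae_hasDerivAt_theta_sub hJ h0 hab (hs.trans hεJ) hNΛ
        (fun t ht ℓ hℓ => ⟨(hw t (hs ht) ℓ hℓ).1, fun t' ht' => (hw t (hs ht) ℓ hℓ).2 t' (hs ht')⟩)
        hγ hD] with s₀ h
      rw [hasDerivAt_sub_momentum_iff (c := fun s => Hc a (γ s)) (fun s => (hw a ha _ (hγ s)).1)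
        (hlip a ha), hasDerivAt_sub_momentum_iff (c := fun s => Hc b (γ s))
        (fun s => (hw b hb _ (hγ s)).1) (hlip b hb)]
      constructor
      · intro h'
        have := h.add h'
        rw [add_zero] at this
        refine this.congr_of_eventuallyEq (Eventually.of_forall fun s => ?_)
        simp only [Pi.add_apply]
        ring
      · intro h'
        have := h'.sub h
        rw [sub_zero] at this
        refine this.congr_of_eventuallyEq (Eventually.of_forall fun s => ?_)
        simp only [Pi.sub_apply]
        ring
    constructor
    · rintro ⟨N', hN', h⟩
      refine ⟨N' ∩ N, inter_mem hN' hN, fun γ D hγ hD => ?_⟩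
      filter_upwards [hcurve γ D (fun s => (hγ s).2) hD, h γ D (fun s => (hγ s).1) hD] with s₀ h1 h2
      exact h1.1 h2
    · rintro ⟨N', hN', h⟩
      refine ⟨N' ∩ N, inter_mem hN' hN, fun γ D hγ hD => ?_⟩
      filter_upwards [hcurve γ D (fun s => (hγ s).2) hD, h γ D (fun s => (hγ s).1) hD] with s₀ h1 h2
      exact h1.2 h2
  have ht₀' : t₀ ∈ Icc (t₀ - ε) (t₀ + ε) := ⟨by linarith, by linarith⟩
  filter_upwards [Icc_mem_nhds (show t₀ - ε < t₀ by linarith) (show t₀ < t₀ + ε by linarith)]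
    with t ht
  rcases le_total t₀ t with h | h
  · exact main t₀ ht₀' t ht h
  · exact (main t ht t₀ ht₀' h).symm

/-- The variation formula for `θ(t, ·)` holds at all times. -/
theorem HamiltonianAssumption.thetaVariation (hH : HamiltonianAssumption α W H J O Hc)
    (hW : IsOpen W) (hα : ContMDiffOn (𝓡 n) 𝓘(ℝ, ℝ) ∞ α W)
    (hJo : IsOpen J) (hJ : J.OrdConnected) (h0 : (0 : ℝ) ∈ J) {ℓ₀ : Ctg n M}
    (hℓ₀ : ℓ₀ ∈ graphOfD α W) {t : ℝ} (ht : t ∈ J) :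
    ThetaVariation α H Hc (graphOfD α W) ℓ₀ t := by
  -- The validity of the formula is locally constant in time and `J` is connected.
  refine hJ.isPreconnected.induction₂ (fun a b => ThetaVariation α H Hc (graphOfD α W) ℓ₀ a ↔
    ThetaVariation α H Hc (graphOfD α W) ℓ₀ b) (fun t ht => ?_) (fun _ _ _ _ _ _ h h' => h.trans h')
    (fun _ _ _ _ h => h.symm) h0 ht |>.1 (hH.thetaVariation_zero hW hα ℓ₀)
  exact mem_nhdsWithin_of_mem_nhds (hH.thetaVariation_window hJo hJ h0 hℓ₀ ht)
end

/-! ### A mean value inequality, the inverse of the projected flow, and Lipschitz continuity of `θ`.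
-/

section
variable {E : Type*} [NormedAddCommGroup E] [NormedSpace ℝ E]

/-- A mean value inequality for a function which is Lipschitz and almost everywhere differentiable
on a segment. -/
theorem abs_sub_le_of_ae_hasDerivAt {A : ℝ → ℝ} {K : ℝ≥0} (hA : LipschitzWith K A)
    {d C : ℝ} (h : ∀ᵐ s, s ∈ Ioo (0 : ℝ) 1 → ∃ A', HasDerivAt A A' s ∧ |A' - d| ≤ C) :
    |A 1 - A 0 - d| ≤ C := by
  have h1 := (hA.lipschitzOnWith (s := uIcc 0 1)).integral_deriv_eq_sub
  have h2 : ∫ s in (0 : ℝ)..1, (deriv A s - d) = A 1 - A 0 - d := by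
    rw [intervalIntegral.integral_sub h1.1 intervalIntegrable_const, h1.2]
    simp
  rw [← h2]
  have h3 := intervalIntegral.norm_integral_le_of_norm_le_const_ae (a := 0) (b := 1) (C := C)
    (f := fun s => deriv A s - d) (by
      filter_upwards [h, Measure.ae_ne volume (1 : ℝ)] with s hs h1 hm
      rw [uIoc_of_le zero_le_one] at hm
      obtain ⟨A', h4, h5⟩ := hs ⟨hm.1, lt_of_le_of_ne hm.2 h1⟩
      rwa [h4.deriv])
  simpa using h3
end

section
variable {n : ℕ} {M : Type*} [TopologicalSpace M]
  [ChartedSpace (EuclideanSpace ℝ (Fin n)) M] [IsManifold (𝓡 n) ∞ M]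
  {Tf T : ℝ} {lam : ℝ → Ctg n M} {Λ : Set (Ctg n M)} {Hc : ℝ → Ctg n M → Ctg n M}
  {𝒰 : Set (ℝ × M)}

namespace ProjFlowInvertible

theorem mem_Icc (hI : ProjFlowInvertible Tf T lam Λ Hc 𝒰) {t : ℝ} {x : M} (h : (t, x) ∈ 𝒰) :
    t ∈ Icc 0 T := by
  obtain ⟨V, -, hV⟩ := hI.rel_open
  rw [hV] at h
  exact h.2.1

theorem projFlowInv_spec (hI : ProjFlowInvertible Tf T lam Λ Hc 𝒰) {t : ℝ} {x : M}
    (h : (t, x) ∈ 𝒰) : projFlowInv Λ Hc t x ∈ Λ ∧ (Hc t (projFlowInv Λ Hc t x)).proj = x := by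
  have h1 : ∃ ℓ ∈ Λ, (Hc t ℓ).proj = x := by
    rw [← hI.image_eq] at h
    obtain ⟨⟨t', ℓ⟩, h2, h3⟩ := h
    obtain ⟨rfl, h4⟩ := Prod.mk.inj h3
    exact ⟨ℓ, h2.2, h4⟩
  have : Nonempty (Ctg n M) := ⟨⟨x, 0⟩⟩
  exact ⟨Function.invFunOn_mem h1, Function.invFunOn_eq h1⟩

theorem mem (hI : ProjFlowInvertible Tf T lam Λ Hc 𝒰) {t : ℝ} (ht : t ∈ Icc 0 T) {ℓ : Ctg n M}
    (hℓ : ℓ ∈ Λ) : (t, (Hc t ℓ).proj) ∈ 𝒰 :=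
  hI.image_eq ▸ mem_image_of_mem (fun q : ℝ × Ctg n M => (q.1, (Hc q.1 q.2).proj))
    (mk_mem_prod ht hℓ)

theorem projFlowInv_eq (hI : ProjFlowInvertible Tf T lam Λ Hc 𝒰) {t : ℝ} (ht : t ∈ Icc 0 T)
    {ℓ : Ctg n M} (hℓ : ℓ ∈ Λ) : projFlowInv Λ Hc t (Hc t ℓ).proj = ℓ := by
  obtain ⟨-, g, hg, -⟩ := hI.biLipschitz
  have h1 := hI.projFlowInv_spec (hI.mem ht hℓ)
  exact congr_arg Prod.snd (hg.injOn (mk_mem_prod ht h1.1) (mk_mem_prod ht hℓ)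
    (Prod.ext rfl h1.2))

/-- `(t, x) ↦ (π Hc_t)⁻¹(x)` is Lipschitz in charts near each point of `𝒰`. -/
theorem exists_window (hI : ProjFlowInvertible Tf T lam Λ Hc 𝒰) {t₀ : ℝ} {x₀ : M}
    (h₀ : (t₀, x₀) ∈ 𝒰) {N : Set (Ctg n M)} (hN : N ∈ 𝓝[Λ] (projFlowInv Λ Hc t₀ x₀)) :
    ∃ ε > 0, ∃ r > 0, ∃ D : ℝ≥0,
      Metric.ball (extChartAt (𝓡 n) x₀ x₀) r ⊆ (extChartAt (𝓡 n) x₀).target ∧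
      ∀ t ∈ Icc (t₀ - ε) (t₀ + ε) ∩ Icc 0 T, ∀ y ∈ Metric.ball (extChartAt (𝓡 n) x₀ x₀) r,
        (t, (extChartAt (𝓡 n) x₀).symm y) ∈ 𝒰 ∧
        projFlowInv Λ Hc t ((extChartAt (𝓡 n) x₀).symm y) ∈ N ∧
        ∀ t' ∈ Icc (t₀ - ε) (t₀ + ε) ∩ Icc 0 T, ∀ y' ∈ Metric.ball (extChartAt (𝓡 n) x₀ x₀) r,
          dist (extChartAt (ctgModel n) (projFlowInv Λ Hc t₀ x₀)
              (projFlowInv Λ Hc t ((extChartAt (𝓡 n) x₀).symm y)))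
            (extChartAt (ctgModel n) (projFlowInv Λ Hc t₀ x₀)
              (projFlowInv Λ Hc t' ((extChartAt (𝓡 n) x₀).symm y'))) ≤
          D * max (dist t t') (dist y y') := by
  obtain ⟨-, g, hg, hgl⟩ := hI.biLipschitz
  rw [hI.image_eq] at hgl
  -- The Lipschitz inverse provided by the hypothesis agrees on `𝒰` with the chosen `projFlowInv`,
  -- which inherits its estimate.
  have hge : ∀ q ∈ 𝒰, g q = (q.1, projFlowInv Λ Hc q.1 q.2) := by
    rintro ⟨t, x⟩ hq
    have h1 := hI.projFlowInv_spec hq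
    have h2 := hg (mk_mem_prod (hI.mem_Icc hq) h1.1)
    simp only [h1.2] at h2
    exact h2
  obtain ⟨hc, C, u, hu, hC⟩ := hgl (t₀, x₀) h₀
  obtain ⟨V, hV, hUV⟩ := hI.rel_open
  have hN' : ∀ᶠ q : ℝ × M in 𝓝[𝒰] (t₀, x₀), projFlowInv Λ Hc q.1 q.2 ∈ N := by
    obtain ⟨O, hO, hON⟩ := mem_nhdsWithin_iff_exists_mem_nhds_inter.1 hN
    have h1 : Tendsto (fun q => (g q).2) (𝓝[𝒰] (t₀, x₀)) (𝓝 (projFlowInv Λ Hc t₀ x₀)) := by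
      have := (continuous_snd.tendsto (g (t₀, x₀))).comp hc
      rwa [hge _ h₀] at this
    filter_upwards [h1.eventually_mem hO, self_mem_nhdsWithin] with q hq hqU
    rw [hge q hqU] at hq
    exact hON ⟨hq, (hI.projFlowInv_spec hqU).1⟩
  have h2 := eventually_nhdsWithin_iff.1 (hN'.and hu)
  have h3 := h2.and (hV.mem_nhds (show (t₀, x₀) ∈ V from (hUV ▸ h₀ : (t₀, x₀) ∈ V ∩ _).1))
  rw [nhds_prod_eq] at h3
  obtain ⟨A, hA, B, hB, hAB⟩ := Filter.mem_prod_iff.1 h3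
  obtain ⟨ε, hε, hεA⟩ := Metric.nhds_basis_closedBall.mem_iff.1 hA
  rw [Real.closedBall_eq_Icc] at hεA
  have hB' : (extChartAt (𝓡 n) x₀).symm ⁻¹' B ∈ 𝓝 (extChartAt (𝓡 n) x₀ x₀) := by
    refine (continuousAt_extChartAt_symm x₀).preimage_mem_nhds ?_
    rwa [extChartAt_to_inv]
  obtain ⟨r, hr, hrB⟩ := Metric.mem_nhds_iff.1
    (inter_mem hB' (extChartAt_target_mem_nhds (I := 𝓡 n) x₀))
  have hmem : ∀ t ∈ Icc (t₀ - ε) (t₀ + ε) ∩ Icc 0 T,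
      ∀ y ∈ Metric.ball (extChartAt (𝓡 n) x₀ x₀) r, (t, (extChartAt (𝓡 n) x₀).symm y) ∈ 𝒰 ∧
        projFlowInv Λ Hc t ((extChartAt (𝓡 n) x₀).symm y) ∈ N ∧
        (t, (extChartAt (𝓡 n) x₀).symm y) ∈ u := by
    intro t ht y hy
    have h4 := hAB (mk_mem_prod (hεA ht.1) (hrB hy).1)
    have h5 : (t, (extChartAt (𝓡 n) x₀).symm y) ∈ 𝒰 := by
      rw [hUV]
      exact ⟨h4.2, ht.2, mem_univ _⟩
    exact ⟨h5, h4.1 h5⟩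
  refine ⟨ε, hε, r, hr, C.toNNReal, fun y hy => (hrB hy).2, fun t ht y hy =>
    ⟨(hmem t ht y hy).1, (hmem t ht y hy).2.1, fun t' ht' y' hy' => ?_⟩⟩
  have h6 := hC _ (hmem t ht y hy).2.2 _ (hmem t' ht' y' hy').2.2
  rw [hge _ h₀, hge _ (hmem t ht y hy).1, hge _ (hmem t' ht' y' hy').1] at h6
  have e : dist (extChartAt (𝓘(ℝ, ℝ).prod (𝓡 n)) (t₀, x₀) (t, (extChartAt (𝓡 n) x₀).symm y))
      (extChartAt (𝓘(ℝ, ℝ).prod (𝓡 n)) (t₀, x₀) (t', (extChartAt (𝓡 n) x₀).symm y')) =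
      max (dist t t') (dist y y') := by
    simp only [extChartAt_prod, Prod.dist_eq]
    change max (dist t t') (dist (extChartAt (𝓡 n) x₀ ((extChartAt (𝓡 n) x₀).symm y))
      (extChartAt (𝓡 n) x₀ ((extChartAt (𝓡 n) x₀).symm y'))) = _
    rw [(extChartAt (𝓡 n) x₀).right_inv (hrB hy).2, (extChartAt (𝓡 n) x₀).right_inv (hrB hy').2]
  rw [e] at h6
  refine le_trans ?_ (h6.trans (mul_le_mul_of_nonneg_right (Real.le_coe_toNNReal C)
    (le_max_of_le_left dist_nonneg)))
  simp only [extChartAt_prod, Prod.dist_eq]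
  exact le_max_right _ _

end ProjFlowInvertible

variable {α : M → ℝ} {W : Set M} {H : ℝ → Ctg n M → ℝ} {J : Set ℝ} {O : Set (Ctg n M)}

/-- `θ(t, ·)` is locally Lipschitz in charts. -/
theorem HamiltonianAssumption.exists_theta_lipschitz (hH : HamiltonianAssumption α W H J O Hc)
    (hW : IsOpen W) (hα : ContMDiffOn (𝓡 n) 𝓘(ℝ, ℝ) ∞ α W) (hJ : J.OrdConnected)
    (h0 : (0 : ℝ) ∈ J) {ℓ₀ : Ctg n M} (hℓ₀ : ℓ₀ ∈ graphOfD α W) {t : ℝ} (ht : t ∈ J) :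
    ∃ N ∈ 𝓝[graphOfD α W] ℓ₀, ∃ K : ℝ≥0, ∀ ℓ ∈ N, ∀ ℓ' ∈ N,
      dist (theta α H Hc t ℓ) (theta α H Hc t ℓ') ≤
        K * dist (extChartAt (ctgModel n) ℓ₀ ℓ) (extChartAt (ctgModel n) ℓ₀ ℓ') := by
  have hπ : ℓ₀.proj ∈ W := by
    obtain ⟨x, hx, rfl⟩ := hℓ₀
    exact hx
  have h1 : ContDiffAt ℝ 1 (α ∘ (extChartAt (𝓡 n) ℓ₀.proj).symm)
      (extChartAt (𝓡 n) ℓ₀.proj ℓ₀.proj) := by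
    have h2 := (contMDiffAt_iff_of_mem_source (I := 𝓡 n) (I' := 𝓘(ℝ, ℝ))
      (mem_chart_source _ ℓ₀.proj) (mem_chart_source ℝ (α ℓ₀.proj))).1
      (hα.contMDiffAt (hW.mem_nhds hπ))
    have h3 := h2.2
    simp only [mfld_simps, contDiffWithinAt_univ] at h3
    exact h3.of_le (by norm_cast)
  obtain ⟨K₁, B, hB, hK₁⟩ := h1.exists_lipschitzOnWith
  obtain ⟨G, ⟨-, hG⟩, hGe⟩ := hH.integrand
  obtain ⟨C, u, hu, hC⟩ := hG ℓ₀ hℓ₀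
  have hBm : {ℓ : Ctg n M | extChartAt (𝓡 n) ℓ₀.proj ℓ.proj ∈ B ∧
      ℓ.proj ∈ (extChartAt (𝓡 n) ℓ₀.proj).source} ∈ 𝓝 ℓ₀ := by
    have hp : ContinuousAt (Bundle.TotalSpace.proj : Ctg n M → M) ℓ₀ :=
      (FiberBundle.continuous_proj _ _).continuousAt
    have h4 : ContinuousAt (fun ℓ : Ctg n M => extChartAt (𝓡 n) ℓ₀.proj ℓ.proj) ℓ₀ :=
      ContinuousAt.comp (continuousAt_extChartAt ℓ₀.proj) hp
    exact inter_mem (h4.preimage_mem_nhds hB)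
      (hp.preimage_mem_nhds (extChartAt_source_mem_nhds ℓ₀.proj))
  -- The constant of `α` in the chart, plus that of the integrand multiplied by the elapsed time.
  refine ⟨_, inter_mem (mem_nhdsWithin_of_mem_nhds hBm) (inter_mem hu self_mem_nhdsWithin),
    K₁ + C.toNNReal * Real.toNNReal |t|, fun ℓ hℓ ℓ' hℓ' => ?_⟩
  rw [theta, theta, NNReal.coe_add, add_mul]
  refine (dist_add_add_le _ _ _ _).trans (add_le_add ?_ ?_)
  · have h5 := hK₁.dist_le_mul _ hℓ.1.1 _ hℓ'.1.1
    simp only [Function.comp, (extChartAt (𝓡 n) ℓ₀.proj).left_inv hℓ.1.2,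
      (extChartAt (𝓡 n) ℓ₀.proj).left_inv hℓ'.1.2] at h5
    refine h5.trans (mul_le_mul_of_nonneg_left ?_ K₁.coe_nonneg)
    rw [dist_eq_norm]
    exact norm_base_chart_sub_le
  · rw [dist_eq_norm, ← intervalIntegral.integral_sub (hH.intervalIntegrable hJ hℓ.2.2 h0 ht)
      (hH.intervalIntegrable hJ hℓ'.2.2 h0 ht)]
    have hs : uIoc 0 t ⊆ J := uIoc_subset_uIcc.trans (hJ.uIcc_subset h0 ht)
    refine (intervalIntegral.norm_integral_le_of_norm_le_const_ae (C := C.toNNReal *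
      dist (extChartAt (ctgModel n) ℓ₀ ℓ) (extChartAt (ctgModel n) ℓ₀ ℓ')) ?_).trans_eq ?_
    · have h6 := ae_restrict_of_ae_restrict_of_subset hs
        (hC.and ((hGe ℓ hℓ.2.2).and (hGe ℓ' hℓ'.2.2)))
      rw [ae_restrict_iff' measurableSet_uIoc] at h6
      filter_upwards [h6] with s h6 hs
      obtain ⟨h7, h8, h9⟩ := h6 hs
      rw [← h8, ← h9]
      exact (h7 ℓ hℓ.2.1 ℓ' hℓ'.2.1).trans
        (mul_le_mul_of_nonneg_right (Real.le_coe_toNNReal C) dist_nonneg)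
    · rw [sub_zero, NNReal.coe_mul, Real.coe_toNNReal _ (abs_nonneg t)]
      ring
end

/-! ### Differentiability of `alphaT` in space. -/

section
variable {n : ℕ} {M : Type*} [TopologicalSpace M]
  [ChartedSpace (EuclideanSpace ℝ (Fin n)) M] [IsManifold (𝓡 n) ∞ M]

/-- For times in `[t₀ - ε, t₀ + ε]`, points of the coordinate ball of radius `r` around
`π Hc_{t₀}(ℓ₀)`, and initial values in `N`, the flow and the inverse of its projection are
Lipschitz in the charts at `ℓ₀` and `Hc_{t₀}(ℓ₀)`. -/
structure FlowWindow (Λ : Set (Ctg n M)) (Hc : ℝ → Ctg n M → Ctg n M) (𝒰 : Set (ℝ × M))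
    (J : Set ℝ) (T t₀ : ℝ) (ℓ₀ : Ctg n M) (ε r : ℝ) (N : Set (Ctg n M)) (C D : ℝ≥0) : Prop where
  time_subset : Icc (t₀ - ε) (t₀ + ε) ⊆ J
  subset_graph : N ⊆ Λ
  ball_subset : Metric.ball (extChartAt (𝓡 n) (Hc t₀ ℓ₀).proj (Hc t₀ ℓ₀).proj) r ⊆
    (extChartAt (𝓡 n) (Hc t₀ ℓ₀).proj).target
  mem_source : ∀ t ∈ Icc (t₀ - ε) (t₀ + ε), ∀ ℓ ∈ N,
    Hc t ℓ ∈ (extChartAt (ctgModel n) (Hc t₀ ℓ₀)).source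
  flow_dist : ∀ t ∈ Icc (t₀ - ε) (t₀ + ε), ∀ ℓ ∈ N, ∀ t' ∈ Icc (t₀ - ε) (t₀ + ε), ∀ ℓ' ∈ N,
    dist (extChartAt (ctgModel n) (Hc t₀ ℓ₀) (Hc t ℓ))
      (extChartAt (ctgModel n) (Hc t₀ ℓ₀) (Hc t' ℓ')) ≤
    C * max (dist t t') (dist (extChartAt (ctgModel n) ℓ₀ ℓ) (extChartAt (ctgModel n) ℓ₀ ℓ'))
  mem : ∀ t ∈ Icc (t₀ - ε) (t₀ + ε) ∩ Icc 0 T,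
    ∀ y ∈ Metric.ball (extChartAt (𝓡 n) (Hc t₀ ℓ₀).proj (Hc t₀ ℓ₀).proj) r,
    (t, (extChartAt (𝓡 n) (Hc t₀ ℓ₀).proj).symm y) ∈ 𝒰 ∧
      projFlowInv Λ Hc t ((extChartAt (𝓡 n) (Hc t₀ ℓ₀).proj).symm y) ∈ N
  inv_dist : ∀ t ∈ Icc (t₀ - ε) (t₀ + ε) ∩ Icc 0 T,
    ∀ y ∈ Metric.ball (extChartAt (𝓡 n) (Hc t₀ ℓ₀).proj (Hc t₀ ℓ₀).proj) r,
    ∀ t' ∈ Icc (t₀ - ε) (t₀ + ε) ∩ Icc 0 T,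
    ∀ y' ∈ Metric.ball (extChartAt (𝓡 n) (Hc t₀ ℓ₀).proj (Hc t₀ ℓ₀).proj) r,
    dist (extChartAt (ctgModel n) ℓ₀
        (projFlowInv Λ Hc t ((extChartAt (𝓡 n) (Hc t₀ ℓ₀).proj).symm y)))
      (extChartAt (ctgModel n) ℓ₀
        (projFlowInv Λ Hc t' ((extChartAt (𝓡 n) (Hc t₀ ℓ₀).proj).symm y'))) ≤
    D * max (dist t t') (dist y y')

variable {Tf T : ℝ} {lam : ℝ → Ctg n M} {Hc : ℝ → Ctg n M → Ctg n M}
  {𝒰 : Set (ℝ × M)} {α : M → ℝ} {W : Set M} {H : ℝ → Ctg n M → ℝ} {J : Set ℝ} {O : Set (Ctg n M)}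

theorem exists_flowWindow (hI : ProjFlowInvertible Tf T lam (graphOfD α W) Hc 𝒰)
    (hH : HamiltonianAssumption α W H J O Hc) (hJ : IsOpen J) (hTJ : Icc 0 T ⊆ J)
    {t₀ : ℝ} (ht₀ : t₀ ∈ Icc 0 T) {ℓ₀ : Ctg n M} (hℓ₀ : ℓ₀ ∈ graphOfD α W)
    {N' : Set (Ctg n M)} (hN' : N' ∈ 𝓝[graphOfD α W] ℓ₀) :
    ∃ ε > 0, ∃ r > 0, ∃ N ⊆ N', ∃ C D : ℝ≥0,
      FlowWindow (graphOfD α W) Hc 𝒰 J T t₀ ℓ₀ ε r N C D := by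
  obtain ⟨ε₁, hε₁, hε₁J, N₁, hN₁, C, hN₁Λ, -, hw⟩ := hH.exists_window hJ hℓ₀ (hTJ ht₀)
  have hinv := hI.projFlowInv_eq ht₀ hℓ₀
  obtain ⟨ε₂, hε₂, r, hr, D, hball, hw'⟩ := hI.exists_window (hI.mem ht₀ hℓ₀)
    (N := N₁ ∩ N') (hinv.symm ▸ inter_mem hN₁ hN')
  rw [hinv] at hw'
  have i₁ : Icc (t₀ - min ε₁ ε₂) (t₀ + min ε₁ ε₂) ⊆ Icc (t₀ - ε₁) (t₀ + ε₁) := by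
    have := min_le_left ε₁ ε₂
    exact Icc_subset_Icc (by linarith) (by linarith)
  have i₂ : Icc (t₀ - min ε₁ ε₂) (t₀ + min ε₁ ε₂) ∩ Icc 0 T ⊆
      Icc (t₀ - ε₂) (t₀ + ε₂) ∩ Icc 0 T := by
    have := min_le_right ε₁ ε₂
    exact inter_subset_inter_left _ (Icc_subset_Icc (by linarith) (by linarith))
  exact ⟨min ε₁ ε₂, lt_min hε₁ hε₂, r, hr, N₁ ∩ N', inter_subset_right, C, D, i₁.trans hε₁J,
    fun ℓ h => hN₁Λ h.1, hball, fun t ht ℓ hℓ => (hw t (i₁ ht) ℓ hℓ.1).1,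
    fun t ht ℓ hℓ t' ht' ℓ' hℓ' => (hw t (i₁ ht) ℓ hℓ.1).2 t' (i₁ ht') ℓ' hℓ'.1,
    fun t ht y hy => ⟨(hw' t (i₂ ht) y hy).1, (hw' t (i₂ ht) y hy).2.1⟩,
    fun t ht y hy t' ht' y' hy' => (hw' t (i₂ ht) y hy).2.2 t' (i₂ ht') y' hy'⟩

namespace FlowWindow

variable {Λ N : Set (Ctg n M)} {t₀ ε r : ℝ} {ℓ₀ : Ctg n M} {C D : ℝ≥0}

/-- The momentum `Hc_t ∘ (π Hc_s)⁻¹` is jointly Lipschitz in the times and the base point; the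
second-order remainders in the expansions in space come from this. -/
theorem flow_inv_dist (hw : FlowWindow Λ Hc 𝒰 J T t₀ ℓ₀ ε r N C D) {t₁ t₂ s₁ s₂ : ℝ}
    {y₁ y₂ : EuclideanSpace ℝ (Fin n)}
    (ht₁ : t₁ ∈ Icc (t₀ - ε) (t₀ + ε)) (ht₂ : t₂ ∈ Icc (t₀ - ε) (t₀ + ε))
    (hs₁ : s₁ ∈ Icc (t₀ - ε) (t₀ + ε) ∩ Icc 0 T) (hs₂ : s₂ ∈ Icc (t₀ - ε) (t₀ + ε) ∩ Icc 0 T)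
    (hy₁ : y₁ ∈ Metric.ball (extChartAt (𝓡 n) (Hc t₀ ℓ₀).proj (Hc t₀ ℓ₀).proj) r)
    (hy₂ : y₂ ∈ Metric.ball (extChartAt (𝓡 n) (Hc t₀ ℓ₀).proj (Hc t₀ ℓ₀).proj) r) :
    dist (extChartAt (ctgModel n) (Hc t₀ ℓ₀)
        (Hc t₁ (projFlowInv Λ Hc s₁ ((extChartAt (𝓡 n) (Hc t₀ ℓ₀).proj).symm y₁))))
      (extChartAt (ctgModel n) (Hc t₀ ℓ₀)
        (Hc t₂ (projFlowInv Λ Hc s₂ ((extChartAt (𝓡 n) (Hc t₀ ℓ₀).proj).symm y₂)))) ≤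
      C * max (dist t₁ t₂) (D * max (dist s₁ s₂) (dist y₁ y₂)) :=
  (hw.flow_dist _ ht₁ _ (hw.mem _ hs₁ _ hy₁).2 _ ht₂ _ (hw.mem _ hs₂ _ hy₂).2).trans
    (mul_le_mul_of_nonneg_left (max_le_max le_rfl (hw.inv_dist _ hs₁ _ hy₁ _ hs₂ _ hy₂))
      C.coe_nonneg)

end FlowWindow

theorem ctg_snd_eq_comp_chartDeriv {z₀ z : Ctg n M}
    (h : z ∈ (extChartAt (ctgModel n) z₀).source) :
    (z.2 : EuclideanSpace ℝ (Fin n) →L[ℝ] ℝ) =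
      (extChartAt (ctgModel n) z₀ z).2.comp (chartDeriv (𝓡 n) z₀.proj z.proj) :=
  ContinuousLinearMap.ext fun v => (ctg_extChartAt_snd_apply (mem_ctg_source.1 h) v).symm

/-- `alphaT` is differentiable in `x`, and its differential at `π Hc_t(ℓ₀)` is `Hc_t(ℓ₀)`. -/
theorem hasMFDerivAt_alphaT (hI : ProjFlowInvertible Tf T lam (graphOfD α W) Hc 𝒰)
    (hH : HamiltonianAssumption α W H J O Hc) (hW : IsOpen W)
    (hα : ContMDiffOn (𝓡 n) 𝓘(ℝ, ℝ) ∞ α W) (hJo : IsOpen J) (hJ : J.OrdConnected)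
    (hTJ : Icc 0 T ⊆ J) {t : ℝ} (ht : t ∈ Icc 0 T) {ℓ₀ : Ctg n M} (hℓ₀ : ℓ₀ ∈ graphOfD α W) :
    HasMFDerivAt (𝓡 n) 𝓘(ℝ, ℝ) (alphaT α W H Hc t) (Hc t ℓ₀).proj
      ((Hc t ℓ₀).2 : EuclideanSpace ℝ (Fin n) →L[ℝ] ℝ) := by
  have h0 : (0 : ℝ) ∈ J := hTJ ⟨le_rfl, ht.1.trans ht.2⟩
  obtain ⟨N₁, hN₁, hvar⟩ := hH.thetaVariation hW hα hJo hJ h0 hℓ₀ (hTJ ht)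
  obtain ⟨N₂, hN₂, K, hK⟩ := hH.exists_theta_lipschitz hW hα hJ h0 hℓ₀ (hTJ ht)
  obtain ⟨ε, hε, r, hr, N, hN, C, D, hw⟩ :=
    exists_flowWindow hI hH hJo hTJ ht hℓ₀ (inter_mem hN₁ hN₂)
  rw [ctg_snd_eq_comp_chartDeriv (mem_extChartAt_source (Hc t ℓ₀)),
    hasMFDerivAt_comp_chartDeriv_iff (mem_extChartAt_source (Hc t ℓ₀).proj)]
  have htI : t ∈ Icc (t - ε) (t + ε) := ⟨by linarith, by linarith⟩
  have htI' : t ∈ Icc (t - ε) (t + ε) ∩ Icc 0 T := ⟨htI, ht⟩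
  set φ := extChartAt (𝓡 n) (Hc t ℓ₀).proj with hφ
  set c := φ (Hc t ℓ₀).proj with hc
  set Ψ := extChartAt (ctgModel n) (Hc t ℓ₀) with hΨ
  let q : EuclideanSpace ℝ (Fin n) → Ctg n M :=
    fun y => projFlowInv (graphOfD α W) Hc t (φ.symm y)
  have hq : ∀ y ∈ Metric.ball c r, (Hc t (q y)).proj = φ.symm y := fun y hy =>
    (hI.projFlowInv_spec (hw.mem t htI' y hy).1).2
  have hcm : c ∈ Metric.ball c r := Metric.mem_ball_self hr
  have hqc : q c = ℓ₀ := by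
    simp only [q, hc, hφ, extChartAt_to_inv, hI.projFlowInv_eq ht hℓ₀]
  -- The segment from `c` to `y` is lifted to `Λ` by the inverse projected flow. Almost everywhere
  -- the derivative of `θ_t` along the lift is the current momentum applied to `y - c`, and this
  -- momentum stays within `C * D * ‖y - c‖` of the one at `c`.
  have bound : ∀ y ∈ Metric.ball c r, |theta α H Hc t (q y) - theta α H Hc t (q c) -
      (Ψ (Hc t ℓ₀)).2 (y - c)| ≤ C * D * ‖y - c‖ ^ 2 := by
    intro y hy
    let cl : ℝ → ℝ := fun s => projIcc (0 : ℝ) 1 zero_le_one s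
    have hcl : ∀ s, cl s ∈ Icc (0 : ℝ) 1 := fun s => (projIcc (0 : ℝ) 1 zero_le_one s).2
    have hclid : ∀ s ∈ Icc (0 : ℝ) 1, cl s = s := fun s hs => by
      simp only [cl, projIcc_of_mem zero_le_one hs]
    have hcld : ∀ s s', dist (cl s) (cl s') ≤ dist s s' := fun s s' => by
      have := (LipschitzWith.projIcc (zero_le_one (α := ℝ))).dist_le_mul s s'
      rwa [NNReal.coe_one, one_mul] at this
    let w : ℝ → EuclideanSpace ℝ (Fin n) := fun s => c + cl s • (y - c)
    have hwd : ∀ s s', dist (w s) (w s') ≤ ‖y - c‖ * dist s s' := fun s s' => by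
      simp only [w, dist_add_left]
      rw [dist_eq_norm, ← sub_smul, norm_smul, mul_comm]
      exact mul_le_mul_of_nonneg_left (hcld s s') (norm_nonneg _)
    have hwc : ∀ s, dist (w s) c ≤ ‖y - c‖ := fun s => by
      rw [dist_eq_norm, add_sub_cancel_left, norm_smul, Real.norm_of_nonneg (hcl s).1]
      exact mul_le_of_le_one_left (norm_nonneg _) (hcl s).2
    have hwm : ∀ s, w s ∈ Metric.ball c r := fun s =>
      (hwc s).trans_lt (by rwa [← dist_eq_norm])
    have hγN : ∀ s, q (w s) ∈ N := fun s => (hw.mem t htI' _ (hwm s)).2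
    have hγd : LipschitzWith (D * ‖y - c‖₊) (fun s => extChartAt (ctgModel n) ℓ₀ (q (w s))) :=
      LipschitzWith.of_dist_le_mul fun s s' => by
        refine (hw.inv_dist t htI' _ (hwm s) t htI' _ (hwm s')).trans ?_
        rw [dist_self, max_eq_right dist_nonneg, NNReal.coe_mul, mul_assoc]
        exact mul_le_mul_of_nonneg_left (hwd s s') D.coe_nonneg
    have hA : LipschitzWith (K * (D * ‖y - c‖₊)) (fun s => theta α H Hc t (q (w s))) :=
      LipschitzWith.of_dist_le_mul fun s s' => by
        refine (hK _ (hN (hγN s)).2 _ (hN (hγN s')).2).trans ?_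
        rw [NNReal.coe_mul, mul_assoc]
        exact mul_le_mul_of_nonneg_left (hγd.dist_le_mul s s') K.coe_nonneg
    have key := abs_sub_le_of_ae_hasDerivAt hA (d := (Ψ (Hc t ℓ₀)).2 (y - c))
      (C := C * D * ‖y - c‖ ^ 2) ?_
    · have e0 : w 0 = c := by simp [w, hclid 0 (by simp)]
      have e1 : w 1 = y := by simp [w, hclid 1 (by simp)]
      simpa only [e0, e1] using key
    filter_upwards [hvar _ _ (fun s => (hN (hγN s)).1) hγd] with s₀ hs₀ hs
    refine ⟨(Ψ (Hc t (q (w s₀)))).2 (y - c), ?_, ?_⟩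
    -- The primitive tested is the chart-linear one at the current point, whose derivative along the
    -- segment is explicit.
    · have h1 := hs₀ _ (hasMFDerivAt_momentum_comp_chart (hw.mem_source t htI _ (hγN s₀)))
      have h2 : HasDerivAt (fun s : ℝ => (Ψ (Hc t (q (w s₀)))).2 (c + s • (y - c)))
          ((Ψ (Hc t (q (w s₀)))).2 (y - c)) s₀ := by
        have h3 : HasDerivAt (fun s : ℝ => c + s • (y - c)) (y - c) s₀ := by
          simpa using ((hasDerivAt_id s₀).smul_const (y - c)).const_add c
        exact (Ψ (Hc t (q (w s₀)))).2.hasFDerivAt.comp_hasDerivAt s₀ h3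
      have h4 := h1.add h2
      rw [zero_add] at h4
      refine h4.congr_of_eventuallyEq ?_
      filter_upwards [Ioo_mem_nhds hs.1 hs.2] with s hs'
      have h5 : c + s • (y - c) = w s := by
        simp only [w, hclid s (Ioo_subset_Icc_self hs')]
      simp only [Pi.add_apply, hq _ (hwm s), ← hφ, φ.right_inv (hw.ball_subset (hwm s)), h5, ← hΨ]
      ring
    · have h6 := hw.flow_inv_dist htI htI htI' htI' (hwm s₀) hcm
      rw [dist_self, max_eq_right dist_nonneg, max_eq_right (by positivity)] at h6
      have h6' : dist (Ψ (Hc t (q (w s₀)))) (Ψ (Hc t (q c))) ≤ C * (D * dist (w s₀) c) := h6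
      rw [hqc] at h6'
      have h7 : ‖(Ψ (Hc t (q (w s₀)))).2 - (Ψ (Hc t ℓ₀)).2‖ ≤ C * (D * ‖y - c‖) := by
        rw [← dist_eq_norm]
        refine (le_max_right _ _ |>.trans_eq (Prod.dist_eq (α := EuclideanSpace ℝ (Fin n))).symm).trans ?_
        refine h6'.trans ?_
        gcongr
        exact hwc s₀
      rw [← sub_apply, ← Real.norm_eq_abs]
      refine ((_ : EuclideanSpace ℝ (Fin n) →L[ℝ] ℝ).le_of_opNorm_le h7 _).trans_eq ?_
      ring
  have hO : (fun y => theta α H Hc t (q y) - theta α H Hc t (q c) -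
      (Ψ (Hc t ℓ₀)).2 (y - c)) =O[𝓝 c] fun y => ‖y - c‖ ^ 2 := by
    refine Asymptotics.IsBigO.of_bound (C * D) ?_
    filter_upwards [Metric.ball_mem_nhds c hr] with y hy
    simpa using bound y hy
  refine HasFDerivAt.of_isLittleO (hO.trans_isLittleO ?_)
  exact Asymptotics.isLittleO_pow_sub_sub c one_lt_two
end

/-! ### Time increments compared with the energy, in flat phase space. -/

section
variable {E : Type*} [NormedAddCommGroup E] [NormedSpace ℝ E] [FiniteDimensional ℝ E]

/-- If the increments of `f` agree to second order with those of the action along each curve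
`z(·, s)` of a Lipschitz family of solutions, up to the boundary term, then they agree to second
order with those of the integrated energy. -/
theorem exists_abs_add_integral_energy_le {z : ℝ → ℝ → E × (E →L[ℝ] ℝ)}
    {L : ℝ → ℝ → ℝ} {h : ℝ → E × (E →L[ℝ] ℝ) → ℝ} {C : ℝ≥0} {a b B : ℝ} (hab : a ≤ b)
    (hz : LipschitzWith C (fun w : ℝ × ℝ => z w.1 w.2))
    (hLi : ∀ s, IntervalIntegrable (fun t => L t s) volume a b)
    (hd : ∀ s, ∀ᵐ t, t ∈ Icc a b → ∃ v : E × (E →L[ℝ] ℝ), HasDerivAt (fun t => z t s) v t ∧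
      HasFDerivAt (h t) (flatHamCovec v) (z t s) ∧ L t s = (z t s).2 v.1 - h t (z t s))
    (hc : ∀ᵐ t, t ∈ Icc a b → ∀ s,
      (fun s' => h t (z t s') - h t (z t s)) =O[𝓝 s] fun s' => s' - s)
    {f : ℝ → ℝ} (hf : ∀ s ∈ Icc a b, ∀ t ∈ Icc a b, |f t - f s - (∫ τ in s..t, L τ s) +
      (z s s).2 ((z t s).1 - (z s s).1)| ≤ B * (t - s) ^ 2) :
    ∀ s ∈ Icc a b, ∀ t ∈ Icc a b,
      |f t - f s + ∫ τ in s..t, h τ (z τ s)| ≤ (B + C * C) * (t - s) ^ 2 := by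
  intro s hs t ht
  have hst : uIcc s t ⊆ Icc a b := ordConnected_Icc.uIcc_subset hs ht
  have hst' : uIcc s t ⊆ uIcc a b := by rwa [uIcc_of_le hab]
  have hzt : LipschitzWith C (fun t => z t s) :=
    LipschitzWith.of_dist_le_mul fun x y => by simpa using hz.dist_le_mul (x, s) (y, s)
  have hqt : LipschitzWith C (fun t => (z t s).1) := by
    simpa [Function.comp_def] using LipschitzWith.prod_fst.comp hzt
  have hL := (hLi s).mono_set hst'
  have hE := ((intervalIntegrable_and_ae_lipschitzWith_energy hab hz hLi hd hc).1 s).mono_set hst'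
  have hl : LipschitzWith (‖(z s s).2‖₊ * C) (fun t => (z s s).2 (z t s).1) :=
    (z s s).2.lipschitz.comp hqt
  obtain ⟨i1, i2⟩ := (hl.lipschitzOnWith (s := uIcc s t)).integral_deriv_eq_sub
  -- The integrand equals `(p(τ) - p(s)) · q'(τ)`, which is at most `C * C * |t - s|`.
  have h1 : |∫ τ in s..t, (L τ s + h τ (z τ s) - deriv (fun t => (z s s).2 (z t s).1) τ)| ≤
      C * C * |t - s| * |t - s| := by
    rw [← Real.norm_eq_abs]
    refine intervalIntegral.norm_integral_le_of_norm_le_const_ae ?_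
    filter_upwards [hd s] with τ hτ hm
    have hm' := uIoc_subset_uIcc hm
    obtain ⟨v, h1, h2, h3⟩ := hτ (hst hm')
    have h4 : HasDerivAt (fun t => (z s s).2 (z t s).1) ((z s s).2 v.1) τ :=
      (z s s).2.hasFDerivAt.comp_hasDerivAt τ h1.curve_fst
    have e : L τ s + h τ (z τ s) - deriv (fun t => (z s s).2 (z t s).1) τ =
        ((z τ s).2 - (z s s).2) v.1 := by
      rw [h3, h4.deriv, sub_apply]
      ring
    have hv : ‖v.1‖ ≤ C := by
      rw [← h1.curve_fst.deriv]
      exact hqt.norm_deriv_le τ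
    have h5 : ‖(z τ s).2 - (z s s).2‖ ≤ C * |t - s| := by
      refine (norm_snd_le (z τ s - z s s)).trans ?_
      rw [← dist_eq_norm]
      refine (hzt.dist_le_mul τ s).trans (mul_le_mul_of_nonneg_left ?_ C.coe_nonneg)
      rw [Real.dist_eq]
      exact abs_sub_left_of_mem_uIcc hm'
    rw [e]
    refine (ContinuousLinearMap.le_opNorm _ _).trans ?_
    calc _ ≤ C * |t - s| * C := mul_le_mul h5 hv (norm_nonneg _) (by positivity)
      _ = _ := by ring
  rw [intervalIntegral.integral_sub (hL.add hE) i1, intervalIntegral.integral_add hL hE, i2,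
    ← map_sub] at h1
  have h2 := abs_add_le _ _ |>.trans (add_le_add (hf s hs t ht) h1)
  refine le_trans (le_of_eq (congr_arg _ ?_)) (h2.trans_eq ?_)
  · ring
  · rw [mul_assoc (C * C : ℝ), abs_mul_abs_self]
    ring

/-- Such a function `f` is differentiable almost everywhere, and its derivative is given by the
energy on the diagonal. -/
theorem ae_hasDerivAt_neg_energy {z : ℝ → ℝ → E × (E →L[ℝ] ℝ)}
    {L : ℝ → ℝ → ℝ} {h : ℝ → E × (E →L[ℝ] ℝ) → ℝ} {C : ℝ≥0} {a b B : ℝ} (hab : a ≤ b)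
    (hz : LipschitzWith C (fun w : ℝ × ℝ => z w.1 w.2))
    (hLi : ∀ s, IntervalIntegrable (fun t => L t s) volume a b)
    (hd : ∀ s, ∀ᵐ t, t ∈ Icc a b → ∃ v : E × (E →L[ℝ] ℝ), HasDerivAt (fun t => z t s) v t ∧
      HasFDerivAt (h t) (flatHamCovec v) (z t s) ∧ L t s = (z t s).2 v.1 - h t (z t s))
    (hc : ∀ᵐ t, t ∈ Icc a b → ∀ s,
      (fun s' => h t (z t s') - h t (z t s)) =O[𝓝 s] fun s' => s' - s)
    {f : ℝ → ℝ} (hf : ∀ s ∈ Icc a b, ∀ t ∈ Icc a b,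
      |f t - f s + ∫ τ in s..t, h τ (z τ s)| ≤ B * (t - s) ^ 2) :
    ∀ᵐ t, t ∈ Ioo a b → HasDerivAt f (-h t (z t t)) t := by
  obtain ⟨hi, hlip⟩ := intervalIntegrable_and_ae_lipschitzWith_energy hab hz hLi hd hc
  have hsub : uIoc a b ⊆ Icc a b := by rw [uIoc_of_le hab]; exact Ioc_subset_Icc_self
  have hae : ∀ᵐ t ∂volume.restrict (uIoc a b), LipschitzWith (2 * C * C + C)
      (fun s => h t (z t s)) := ae_restrict_of_ae_restrict_of_subset hsub hlip
  -- Measurability for each `s` says nothing on the diagonal; a jointly measurable version is needed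
  -- to restrict to it.
  obtain ⟨g, hg, hge⟩ := exists_measurable_uncurry_of_ae_continuous
    (f := fun t s => h t (z t s)) (μ := volume.restrict (uIoc a b))
    (fun s => (hi s).aestronglyMeasurable_restrict_uIoc.aemeasurable)
    (hae.mono fun t ht => ht.continuous)
  have hm : AEStronglyMeasurable (fun t => h t (z t t)) (volume.restrict (uIoc a b)) := by
    have : Measurable fun t => g t t := hg.comp (measurable_id.prodMk measurable_id)
    refine this.aestronglyMeasurable.congr ?_
    filter_upwards [hge] with t ht
    exact ht t
  rw [ae_restrict_iff' measurableSet_uIoc] at hae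
  have hEi : IntervalIntegrable (fun t => h t (z t t)) volume a b := by
    have h1 : IntervalIntegrable (fun t => h t (z t t) - h t (z t a)) volume a b := by
      refine intervalIntegrable_of_ae_bound (C := (2 * C * C + C) * |b - a|)
        (hm.sub (hi a).aestronglyMeasurable_restrict_uIoc) ?_
      filter_upwards [hae] with t ht htm
      have h2 := (ht htm).dist_le_mul t a
      rw [dist_eq_norm, Real.dist_eq] at h2
      push_cast at h2
      exact h2.trans (mul_le_mul_of_nonneg_left
        (abs_sub_left_of_mem_uIcc (uIoc_subset_uIcc htm)) (by positivity))
    simpa using h1.add (hi a)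
  -- Moving from the trajectory of parameter `s` to the diagonal costs another second-order term, as
  -- the energy is Lipschitz in the parameter.
  have key : ∀ s ∈ Icc a b, ∀ t ∈ Icc a b, |f t - f s + ∫ τ in s..t, h τ (z τ τ)| ≤
      (B + (2 * C * C + C)) * (t - s) ^ 2 := by
    intro s hs t ht
    have hst : uIcc s t ⊆ uIcc a b := by
      rw [uIcc_of_le hab]; exact ordConnected_Icc.uIcc_subset hs ht
    have h1 : |∫ τ in s..t, (h τ (z τ τ) - h τ (z τ s))| ≤
        (2 * C * C + C) * |t - s| * |t - s| := by
      rw [← Real.norm_eq_abs]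
      refine intervalIntegral.norm_integral_le_of_norm_le_const_ae ?_
      filter_upwards [hae, Measure.ae_ne volume a] with τ hτ ha hm
      have hm' := uIoc_subset_uIcc hm
      have hm2 : τ ∈ Icc a b := by rw [← uIcc_of_le hab]; exact hst hm'
      have h2 := (hτ (by
        rw [uIoc_of_le hab]
        exact ⟨lt_of_le_of_ne hm2.1 ha.symm, hm2.2⟩)).dist_le_mul τ s
      rw [dist_eq_norm, Real.dist_eq] at h2
      push_cast at h2
      exact h2.trans (mul_le_mul_of_nonneg_left (abs_sub_left_of_mem_uIcc hm') (by positivity))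
    rw [intervalIntegral.integral_sub (hEi.mono_set hst) ((hi s).mono_set hst)] at h1
    have h2 := abs_add_le _ _ |>.trans (add_le_add (hf s hs t ht) h1)
    refine le_trans (le_of_eq (congr_arg _ ?_)) (h2.trans_eq ?_)
    · ring
    · rw [mul_assoc, abs_mul_abs_self]
      ring
  -- Lebesgue differentiation of the diagonal energy; the quadratic error has zero derivative.
  filter_upwards [hEi.ae_hasDerivAt_integral] with t ht htI
  have htI' := Ioo_subset_Icc_self htI
  have h1 := ht (by rwa [uIcc_of_le hab]) a (by simp)
  have h2 : HasDerivAt (fun u => f u - f t + ∫ τ in t..u, h τ (z τ τ)) 0 t := by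
    have hO : (fun u => f u - f t + ∫ τ in t..u, h τ (z τ τ)) =O[𝓝 t]
        fun u => ‖u - t‖ ^ 2 := by
      refine Asymptotics.IsBigO.of_bound (B + (2 * C * C + C)) ?_
      filter_upwards [Ioo_mem_nhds htI.1 htI.2] with u hu
      simpa using key t htI' u (Ioo_subset_Icc_self hu)
    have := hO.trans_isLittleO (Asymptotics.isLittleO_pow_sub_sub t one_lt_two)
    rw [hasDerivAt_iff_isLittleO]
    simpa using this
  have h3 := h2.sub h1
  rw [zero_sub] at h3
  refine (h3.add_const (f t + ∫ τ in a..t, h τ (z τ τ))).congr_of_eventuallyEq ?_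
  filter_upwards [Ioo_mem_nhds htI.1 htI.2] with u hu
  have hau := intervalIntegral.integral_add_adjacent_intervals
    (hEi.mono_set (show uIcc a t ⊆ uIcc a b from uIcc_subset_uIcc_left (by rwa [uIcc_of_le hab])))
    (hEi.mono_set (show uIcc t u ⊆ uIcc a b from uIcc_subset_uIcc (by rwa [uIcc_of_le hab])
      (by rw [uIcc_of_le hab]; exact Ioo_subset_Icc_self hu)))
  simp only [Pi.sub_apply, ← hau]
  ring
end

/-! ### The time derivative of `alphaT`. -/

section
variable {n : ℕ} {M : Type*} [TopologicalSpace M]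
  [ChartedSpace (EuclideanSpace ℝ (Fin n)) M] [IsManifold (𝓡 n) ∞ M]
  {Tf T : ℝ} {lam : ℝ → Ctg n M} {Hc : ℝ → Ctg n M → Ctg n M}
  {𝒰 : Set (ℝ × M)} {α : M → ℝ} {W : Set M} {H : ℝ → Ctg n M → ℝ} {J : Set ℝ} {O : Set (Ctg n M)}
  {N : Set (Ctg n M)} {t₀ ε r : ℝ} {ℓ₀ : Ctg n M} {C D : ℝ≥0}

/-- The differential of `alphaT` in a chart. -/
theorem FlowWindow.hasFDerivAt_alphaT (hw : FlowWindow (graphOfD α W) Hc 𝒰 J T t₀ ℓ₀ ε r N C D)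
    (hI : ProjFlowInvertible Tf T lam (graphOfD α W) Hc 𝒰)
    (hH : HamiltonianAssumption α W H J O Hc) (hW : IsOpen W)
    (hα : ContMDiffOn (𝓡 n) 𝓘(ℝ, ℝ) ∞ α W) (hJo : IsOpen J) (hJ : J.OrdConnected)
    (hTJ : Icc 0 T ⊆ J) {t : ℝ} (ht : t ∈ Icc (t₀ - ε) (t₀ + ε) ∩ Icc 0 T)
    {y : EuclideanSpace ℝ (Fin n)}
    (hy : y ∈ Metric.ball (extChartAt (𝓡 n) (Hc t₀ ℓ₀).proj (Hc t₀ ℓ₀).proj) r) :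
    HasFDerivAt (alphaT α W H Hc t ∘ (extChartAt (𝓡 n) (Hc t₀ ℓ₀).proj).symm)
      (extChartAt (ctgModel n) (Hc t₀ ℓ₀) (Hc t (projFlowInv (graphOfD α W) Hc t
        ((extChartAt (𝓡 n) (Hc t₀ ℓ₀).proj).symm y)))).2 y := by
  obtain ⟨h1, h2⟩ := hw.mem t ht y hy
  have h3 := hasMFDerivAt_alphaT hI hH hW hα hJo hJ hTJ ht.2 (hw.subset_graph h2)
  have h4 := hw.mem_source t ht.1 _ h2
  rw [ctg_snd_eq_comp_chartDeriv h4, hasMFDerivAt_comp_chartDeriv_iff (mem_ctg_source.1 h4)] at h3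
  rwa [(hI.projFlowInv_spec h1).2,
    (extChartAt (𝓡 n) (Hc t₀ ℓ₀).proj).right_inv (hw.ball_subset hy)] at h3

/-- First order expansion of `alphaT` in `x` in a window, with a remainder of second order. -/
theorem FlowWindow.abs_alphaT_sub_le (hw : FlowWindow (graphOfD α W) Hc 𝒰 J T t₀ ℓ₀ ε r N C D)
    (hI : ProjFlowInvertible Tf T lam (graphOfD α W) Hc 𝒰)
    (hH : HamiltonianAssumption α W H J O Hc) (hW : IsOpen W)
    (hα : ContMDiffOn (𝓡 n) 𝓘(ℝ, ℝ) ∞ α W) (hJo : IsOpen J) (hJ : J.OrdConnected)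
    (hTJ : Icc 0 T ⊆ J) {t s : ℝ} (ht : t ∈ Icc (t₀ - ε) (t₀ + ε) ∩ Icc 0 T)
    (hs : s ∈ Icc (t₀ - ε) (t₀ + ε) ∩ Icc 0 T) {y : EuclideanSpace ℝ (Fin n)}
    (hy : y ∈ Metric.ball (extChartAt (𝓡 n) (Hc t₀ ℓ₀).proj (Hc t₀ ℓ₀).proj) r) :
    |alphaT α W H Hc t ((extChartAt (𝓡 n) (Hc t₀ ℓ₀).proj).symm y) -
        alphaT α W H Hc t (Hc t₀ ℓ₀).proj -
      (extChartAt (ctgModel n) (Hc t₀ ℓ₀) (Hc s (projFlowInv (graphOfD α W) Hc s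
        (Hc t₀ ℓ₀).proj))).2 (y - extChartAt (𝓡 n) (Hc t₀ ℓ₀).proj (Hc t₀ ℓ₀).proj)| ≤
    C * max |t - s| (D * max |t - s|
        ‖y - extChartAt (𝓡 n) (Hc t₀ ℓ₀).proj (Hc t₀ ℓ₀).proj‖) *
      ‖y - extChartAt (𝓡 n) (Hc t₀ ℓ₀).proj (Hc t₀ ℓ₀).proj‖ := by
  set φ := extChartAt (𝓡 n) (Hc t₀ ℓ₀).proj with hφ
  set c := φ (Hc t₀ ℓ₀).proj with hc
  have hx : φ.symm c = (Hc t₀ ℓ₀).proj := extChartAt_to_inv _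
  have hr : 0 < r := dist_nonneg.trans_lt hy
  have hcb : c ∈ Metric.ball c r := Metric.mem_ball_self hr
  have hsub : Metric.closedBall c ‖y - c‖ ⊆ Metric.ball c r :=
    Metric.closedBall_subset_ball (by rwa [← dist_eq_norm])
  -- Mean value inequality against the constant covector at time `s` and the centre, from which the
  -- momenta at time `t` on the ball differ by a Lipschitz bound.
  have h1 := (convex_closedBall c ‖y - c‖).norm_image_sub_le_of_norm_hasFDerivWithin_le'
    (f := alphaT α W H Hc t ∘ φ.symm)
    (φ := (extChartAt (ctgModel n) (Hc t₀ ℓ₀) (Hc s (projFlowInv (graphOfD α W) Hc s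
        (Hc t₀ ℓ₀).proj))).2)
    (C := C * max |t - s| (D * max |t - s| ‖y - c‖))
    (fun w hwb => (hw.hasFDerivAt_alphaT hI hH hW hα hJo hJ hTJ ht (hsub hwb)).hasFDerivWithinAt)
    (fun w hwb => by
      rw [← dist_eq_norm]
      have h2 := hw.flow_inv_dist ht.1 hs.1 ht hs (hsub hwb) hcb
      rw [← hφ, hx] at h2
      refine (le_max_right _ _ |>.trans_eq
        (Prod.dist_eq (α := EuclideanSpace ℝ (Fin n))).symm).trans (h2.trans ?_)
      rw [Real.dist_eq]
      gcongr
      exact hwb)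
    (Metric.mem_closedBall_self (norm_nonneg _))
    (show y ∈ Metric.closedBall c ‖y - c‖ by rw [Metric.mem_closedBall, dist_eq_norm])
  simpa only [Function.comp, hx, Real.norm_eq_abs] using h1

/-- Near an interior time, the increments of `alphaT` at a fixed point are, to second order, the
integrals of `-H`, and its time derivative exists almost everywhere. -/
theorem exists_alphaT_time_estimate (hI : ProjFlowInvertible Tf T lam (graphOfD α W) Hc 𝒰)
    (hH : HamiltonianAssumption α W H J O Hc) (hW : IsOpen W)
    (hα : ContMDiffOn (𝓡 n) 𝓘(ℝ, ℝ) ∞ α W) (hJo : IsOpen J) (hJ : J.OrdConnected)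
    (hTJ : Icc 0 T ⊆ J) (ht₀ : t₀ ∈ Ioo 0 T) (hℓ₀ : ℓ₀ ∈ graphOfD α W) :
    ∃ δ > 0, ∃ B : ℝ, Icc (t₀ - δ) (t₀ + δ) ⊆ Icc 0 T ∧
      (∀ s ∈ Icc (t₀ - δ) (t₀ + δ), ∀ t ∈ Icc (t₀ - δ) (t₀ + δ),
        |alphaT α W H Hc t (Hc t₀ ℓ₀).proj - alphaT α W H Hc s (Hc t₀ ℓ₀).proj +
          ∫ τ in s..t, H τ (Hc τ (projFlowInv (graphOfD α W) Hc s (Hc t₀ ℓ₀).proj))| ≤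
          B * (t - s) ^ 2) ∧
      ∀ᵐ t, t ∈ Ioo (t₀ - δ) (t₀ + δ) →
        HasDerivAt (fun s => alphaT α W H Hc s (Hc t₀ ℓ₀).proj)
          (-H t (Hc t (projFlowInv (graphOfD α W) Hc t (Hc t₀ ℓ₀).proj))) t := by
  have h0 : (0 : ℝ) ∈ J := hTJ ⟨le_rfl, (ht₀.1.trans ht₀.2).le⟩
  obtain ⟨ε, hε, r, hr, N, -, C, D, hw⟩ :=
    exists_flowWindow hI hH hJo hTJ (Ioo_subset_Icc_self ht₀) hℓ₀ univ_mem
  -- The last condition keeps every trajectory that passes through `x₀` at a time of the window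
  -- inside the coordinate ball, since it moves by at most `C * (2 * δ)`.
  obtain ⟨δ, hδ, hδε, hδ0, hδT, hδr⟩ : ∃ δ > 0, δ ≤ ε ∧ δ ≤ t₀ ∧ δ ≤ T - t₀ ∧
      C * (2 * δ) < r := by
    refine ⟨min ε (min t₀ (min (T - t₀) (r / (4 * (C + 1))))), ?_, min_le_left _ _,
      (min_le_right _ _).trans (min_le_left _ _),
      (min_le_right _ _).trans ((min_le_right _ _).trans (min_le_left _ _)), ?_⟩
    · have := ht₀.1
      have := sub_pos.2 ht₀.2
      exact lt_min hε (lt_min ht₀.1 (lt_min this (by positivity)))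
    · have h1 : min ε (min t₀ (min (T - t₀) (r / (4 * (C + 1))))) ≤ r / (4 * (C + 1)) :=
        (min_le_right _ _).trans ((min_le_right _ _).trans (min_le_right _ _))
      have h2 : (0 : ℝ) < 4 * (C + 1) := by positivity
      rw [le_div_iff₀ h2] at h1
      have hC := C.coe_nonneg
      by_cases hm : 0 ≤ min ε (min t₀ (min (T - t₀) (r / (4 * (C + 1)))))
      · nlinarith
      · nlinarith
  have hab : t₀ - δ ≤ t₀ + δ := by linarith
  have hIJ : Icc (t₀ - δ) (t₀ + δ) ⊆ Icc (t₀ - ε) (t₀ + ε) ∩ Icc 0 T := fun t ht =>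
    ⟨⟨by linarith [ht.1], by linarith [ht.2]⟩, by linarith [ht.1], by linarith [ht.2]⟩
  set φ := extChartAt (𝓡 n) (Hc t₀ ℓ₀).proj with hφ
  set Ψ := extChartAt (ctgModel n) (Hc t₀ ℓ₀) with hΨ
  set x₀ := (Hc t₀ ℓ₀).proj with hx₀
  have hcb : φ x₀ ∈ Metric.ball (φ x₀) r := Metric.mem_ball_self hr
  have hx : φ.symm (φ x₀) = x₀ := extChartAt_to_inv _
  let cl : ℝ → ℝ := fun s => projIcc (t₀ - δ) (t₀ + δ) hab s
  have hcl : ∀ s, cl s ∈ Icc (t₀ - δ) (t₀ + δ) := fun s => (projIcc _ _ hab s).2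
  have hclid : ∀ s ∈ Icc (t₀ - δ) (t₀ + δ), cl s = s := fun s hs => by
    simp only [cl, projIcc_of_mem hab hs]
  have hcld : ∀ s s', dist (cl s) (cl s') ≤ dist s s' := fun s s' => by
    have := (LipschitzWith.projIcc hab).dist_le_mul s s'
    rwa [NNReal.coe_one, one_mul] at this
  -- The initial value of the trajectory that passes over `x₀` at time `s`; the diagonal `z s s`
  -- therefore has position `x₀`.
  let γ : ℝ → Ctg n M := fun s => projFlowInv (graphOfD α W) Hc (cl s) x₀
  have hγid : ∀ s ∈ Icc (t₀ - δ) (t₀ + δ), γ s = projFlowInv (graphOfD α W) Hc s x₀ :=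
    fun s hs => by simp only [γ, hclid s hs]
  have hγU : ∀ s, (cl s, x₀) ∈ 𝒰 ∧ γ s ∈ N := fun s => by
    have := hw.mem _ (hIJ (hcl s)) _ hcb
    rwa [← hφ, hx] at this
  have hγd : LipschitzWith D (fun s => extChartAt (ctgModel n) ℓ₀ (γ s)) :=
    LipschitzWith.of_dist_le_mul fun s s' => by
      have := hw.inv_dist _ (hIJ (hcl s)) _ hcb _ (hIJ (hcl s')) _ hcb
      rw [← hφ, hx, dist_self (φ x₀), max_eq_left dist_nonneg] at this
      exact this.trans (mul_le_mul_of_nonneg_left (hcld s s') D.coe_nonneg)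
  let z : ℝ → ℝ → EuclideanSpace ℝ (Fin n) × (EuclideanSpace ℝ (Fin n) →L[ℝ] ℝ) :=
    fun t s => Ψ (Hc (cl t) (γ s))
  obtain ⟨h1, h2, h3, h4, h5⟩ := hH.curve_family hJ hab
    (fun t ht => hw.time_subset (hIJ ht).1) hw.subset_graph
    (fun t ht ℓ hℓ => ⟨hw.mem_source t (hIJ ht).1 ℓ hℓ, fun t' ht' ℓ' hℓ' =>
      hw.flow_dist t (hIJ ht).1 ℓ hℓ t' (hIJ ht').1 ℓ' hℓ'⟩) (fun s => (hγU s).2) hγd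
    (z := z) rfl
  have hen : ∀ t ∈ Icc (t₀ - δ) (t₀ + δ), ∀ s,
      (H t ∘ Ψ.symm) (z t s) = H t (Hc t (γ s)) := fun t ht s => by
    rw [h2 t ht, Function.comp, Ψ.left_inv (hw.mem_source t (hIJ ht).1 _ (hγU s).2)]
  -- Along the trajectory of `γ s`, `alphaT` grows exactly by the action; returning to `x₀` at time
  -- `t` uses the expansion in space with the momentum frozen at time `s`.
  have hf : ∀ s ∈ Icc (t₀ - δ) (t₀ + δ), ∀ t ∈ Icc (t₀ - δ) (t₀ + δ),
      |alphaT α W H Hc t x₀ - alphaT α W H Hc s x₀ - (∫ τ in s..t, cartanIntegrand H Hc τ (γ s)) +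
        (z s s).2 ((z t s).1 - (z s s).1)| ≤ C * max (1 : ℝ) (D * max (1 : ℝ) C) * C * (t - s) ^ 2 := by
    intro s hs t ht
    have hsrc := hw.mem_source t (hIJ ht).1 _ (hγU s).2
    have hsrc' := mem_ctg_source.1 hsrc
    have e1 : (z s s).1 = φ x₀ := by
      rw [h2 s hs, ctg_extChartAt_fst, hγid s hs,
        (hI.projFlowInv_spec (hclid s hs ▸ (hγU s).1)).2]
    have e2 : (z t s).1 = φ (Hc t (γ s)).proj := by rw [h2 t ht, ctg_extChartAt_fst]
    have hd : ‖(z t s).1 - φ x₀‖ ≤ C * |t - s| := by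
      rw [← e1, h2 t ht, h2 s hs]
      refine (norm_fst_le (Ψ (Hc t (γ s)) - Ψ (Hc s (γ s)))).trans ?_
      rw [← dist_eq_norm]
      refine (hw.flow_dist t (hIJ ht).1 _ (hγU s).2 s (hIJ hs).1 _ (hγU s).2).trans_eq ?_
      rw [dist_self, max_eq_left dist_nonneg, Real.dist_eq]
    have hy : (z t s).1 ∈ Metric.ball (φ x₀) r := by
      rw [Metric.mem_ball, dist_eq_norm]
      refine (hd.trans (mul_le_mul_of_nonneg_left ?_ C.coe_nonneg)).trans_lt hδr
      rw [abs_le]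
      constructor <;> linarith [hs.1, hs.2, ht.1, ht.2]
    have h6 := hw.abs_alphaT_sub_le hI hH hW hα hJo hJ hTJ (hIJ ht) (hIJ hs) hy
    rw [← hφ, ← hx₀, ← hΨ] at h6
    have e3 : alphaT α W H Hc t (φ.symm (z t s).1) = theta α H Hc t (γ s) := by
      rw [e2, φ.left_inv hsrc', alphaT,
        hI.projFlowInv_eq (hIJ ht).2 (hw.subset_graph (hγU s).2)]
    have e4 : alphaT α W H Hc s x₀ = theta α H Hc s (γ s) := by rw [alphaT, hγid s hs]
    have e5 := hH.theta_sub hJ h0 (hw.subset_graph (hγU s).2)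
      (hw.time_subset (hIJ hs).1) (hw.time_subset (hIJ ht).1)
    have e6 : (z s s).2 = (Ψ (Hc s (projFlowInv (graphOfD α W) Hc s x₀))).2 := by
      rw [h2 s hs, hγid s hs]
    rw [e3, ← e6] at h6
    rw [e4, e1, ← e5, ← abs_neg]
    refine le_trans (le_of_eq (congr_arg _ ?_)) (h6.trans ?_)
    · ring
    calc (C : ℝ) * max |t - s| (D * max |t - s| ‖(z t s).1 - φ x₀‖) * ‖(z t s).1 - φ x₀‖
        ≤ C * max |t - s| (D * max |t - s| (C * |t - s|)) * (C * |t - s|) := by gcongr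
      _ = C * max (1 * |t - s|) (D * max (1 * |t - s|) (C * |t - s|)) * (C * |t - s|) := by
          rw [one_mul]
      _ = C * max (1 : ℝ) (D * max (1 : ℝ) C) * C * (t - s) ^ 2 := by
          rw [← max_mul_of_nonneg _ _ (abs_nonneg _), ← mul_assoc (D : ℝ),
            ← max_mul_of_nonneg _ _ (abs_nonneg _), ← sq_abs (t - s)]
          ring
  have hB := exists_abs_add_integral_energy_le hab h1 h3 h4 h5 hf
  refine ⟨δ, hδ, C * max (1 : ℝ) (D * max (1 : ℝ) C) * C + (C * max 1 D : ℝ≥0) * (C * max 1 D : ℝ≥0),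
    fun t ht => (hIJ ht).2, fun s hs t ht => ?_, ?_⟩
  · have h6 := hB s hs t ht
    rwa [intervalIntegral.integral_congr (g := fun τ => H τ (Hc τ (projFlowInv (graphOfD α W) Hc s
      x₀))) (fun τ hτ => (hen τ (ordConnected_Icc.uIcc_subset hs ht hτ) s).trans
        (by rw [hγid s hs]))] at h6
  · filter_upwards [ae_hasDerivAt_neg_energy hab h1 h3 h4 h5 hB] with t ht htI
    have h6 := ht htI
    rwa [hen t (Ioo_subset_Icc_self htI), hγid t (Ioo_subset_Icc_self htI)] at h6

/-- The time derivative of `alphaT` is minus the Hamiltonian. -/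
theorem ae_hasDerivAt_alphaT (hI : ProjFlowInvertible Tf T lam (graphOfD α W) Hc 𝒰)
    (hH : HamiltonianAssumption α W H J O Hc) (hW : IsOpen W)
    (hα : ContMDiffOn (𝓡 n) 𝓘(ℝ, ℝ) ∞ α W) (hJo : IsOpen J) (hJ : J.OrdConnected)
    (hTJ : Icc 0 T ⊆ J) (x : M) :
    ∀ᵐ t ∂volume.restrict (Icc 0 T), (t, x) ∈ 𝒰 →
      HasDerivAt (fun s => alphaT α W H Hc s x)
        (-H t (Hc t (projFlowInv (graphOfD α W) Hc t x))) t := by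
  -- The endpoints are negligible. A bad interior time lies over `𝒰`, so the local estimate applies
  -- around it, and a locally null set is null.
  rw [restrict_Ioo_eq_restrict_Icc.symm, ae_restrict_iff' measurableSet_Ioo]
  refine measure_null_of_locally_null _ fun t₀ ht₀ => ?_
  simp only [mem_compl_iff, mem_ofPred_eq, Classical.not_imp] at ht₀
  obtain ⟨h1, h2, -⟩ := ht₀
  obtain ⟨h3, h4⟩ := hI.projFlowInv_spec h2
  obtain ⟨δ, hδ, -, -, -, h5⟩ := exists_alphaT_time_estimate hI hH hW hα hJo hJ hTJ h1 h3
  rw [h4] at h5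
  refine ⟨_, inter_mem self_mem_nhdsWithin (mem_nhdsWithin_of_mem_nhds
    (Ioo_mem_nhds (show t₀ - δ < t₀ by linarith) (show t₀ < t₀ + δ by linarith))), ?_⟩
  refine measure_mono_null (fun t ht => ?_) h5
  have h6 := ht.1
  simp only [mem_compl_iff, mem_ofPred_eq, Classical.not_imp] at h6 ⊢
  exact ⟨ht.2, h6.2.2⟩
end

/-! ### The critical point of `Phi` in time and space. -/

section
variable {n : ℕ} {M : Type*} [TopologicalSpace M]
  [ChartedSpace (EuclideanSpace ℝ (Fin n)) M] [IsManifold (𝓡 n) ∞ M]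

/-- Differentiability of a function of `(t, x)` within a set `S ×ˢ univ`, in the chart at `x`. -/
theorem hasMFDerivWithinAt_prod_of_chart {f : ℝ × M → ℝ} {S : Set ℝ} {t₀ : ℝ} {x₀ : M}
    (h : HasFDerivWithinAt (fun w : ℝ × EuclideanSpace ℝ (Fin n) =>
      f (w.1, (extChartAt (𝓡 n) x₀).symm w.2)) (0 : ℝ × EuclideanSpace ℝ (Fin n) →L[ℝ] ℝ)
      (S ×ˢ univ) (t₀, extChartAt (𝓡 n) x₀ x₀)) :
    HasMFDerivWithinAt (𝓘(ℝ, ℝ).prod (𝓡 n)) 𝓘(ℝ, ℝ) f (S ×ˢ univ) (t₀, x₀) 0 := by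
  refine ⟨?_, ?_⟩
  · have h1 : ContinuousWithinAt (fun q : ℝ × M => (q.1, extChartAt (𝓡 n) x₀ q.2)) (S ×ˢ univ)
        (t₀, x₀) :=
      (continuous_fst.continuousAt.prodMk
        ((continuousAt_extChartAt x₀).comp (x := ((t₀, x₀) : ℝ × M)) continuousAt_snd)).continuousWithinAt
    have h2 := ContinuousWithinAt.comp (x := ((t₀, x₀) : ℝ × M)) h.continuousWithinAt h1
      (show MapsTo _ (S ×ˢ univ) (S ×ˢ univ) from fun q hq => mk_mem_prod hq.1 (mem_univ _))
    refine h2.congr_of_eventuallyEq ?_ ?_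
    · have h3 : ∀ᶠ q : ℝ × M in 𝓝 (t₀, x₀), q.2 ∈ (extChartAt (𝓡 n) x₀).source :=
        continuousAt_snd.eventually_mem (extChartAt_source_mem_nhds x₀)
      filter_upwards [mem_nhdsWithin_of_mem_nhds h3] with q hq
      simp only [Function.comp, (extChartAt (𝓡 n) x₀).left_inv hq]
    · simp only [Function.comp, extChartAt_to_inv]
  · have e : (extChartAt (𝓘(ℝ, ℝ).prod (𝓡 n)) (t₀, x₀)).symm ⁻¹' (S ×ˢ univ) ∩
        range (𝓘(ℝ, ℝ).prod (𝓡 n)) = S ×ˢ univ := by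
      ext w
      exact ⟨fun hw => mk_mem_prod hw.1.1 (mem_univ _),
        fun hw => ⟨mk_mem_prod hw.1 (mem_univ _), by simp⟩⟩
    rw [e]
    exact h

variable {Tf T : ℝ} {lam : ℝ → Ctg n M} {Hc : ℝ → Ctg n M → Ctg n M}
  {𝒰 : Set (ℝ × M)} {α β : M → ℝ} {W : Set M} {H : ℝ → Ctg n M → ℝ} {J : Set ℝ}
  {O : Set (Ctg n M)} {t₀ : ℝ} {ℓ₀ : Ctg n M}

/-- `Phi` is critical at a point where `dβ` is opposite to the momentum of a trajectory along which
the Hamiltonian vanishes. -/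
theorem hasMFDerivWithinAt_Phi (hI : ProjFlowInvertible Tf T lam (graphOfD α W) Hc 𝒰)
    (hH : HamiltonianAssumption α W H J O Hc) (hW : IsOpen W)
    (hα : ContMDiffOn (𝓡 n) 𝓘(ℝ, ℝ) ∞ α W) (hJo : IsOpen J) (hJ : J.OrdConnected)
    (hTJ : Icc 0 T ⊆ J) (ht₀ : t₀ ∈ Ioo 0 T) (hℓ₀ : ℓ₀ ∈ graphOfD α W)
    (hβ : HasMFDerivAt (𝓡 n) 𝓘(ℝ, ℝ) β (Hc t₀ ℓ₀).proj
      (-(Hc t₀ ℓ₀).2 : EuclideanSpace ℝ (Fin n) →L[ℝ] ℝ))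
    {S : Set ℝ} (hS : S.OrdConnected) (ht₀S : t₀ ∈ S)
    (hzero : ∀ᵐ τ ∂volume.restrict S, H τ (Hc τ ℓ₀) = 0) :
    HasMFDerivWithinAt (𝓘(ℝ, ℝ).prod (𝓡 n)) 𝓘(ℝ, ℝ)
      (fun q : ℝ × M => Phi α β W H Hc q.1 q.2) (S ×ˢ univ) (t₀, (Hc t₀ ℓ₀).proj) 0 := by
  have ht₀' := Ioo_subset_Icc_self ht₀
  obtain ⟨ε, hε, r, hr, N, -, C, D, hw⟩ := exists_flowWindow hI hH hJo hTJ ht₀' hℓ₀ univ_mem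
  obtain ⟨δ, hδ, B, hδI, hB, -⟩ := exists_alphaT_time_estimate hI hH hW hα hJo hJ hTJ ht₀ hℓ₀
  refine hasMFDerivWithinAt_prod_of_chart ?_
  have hinv := hI.projFlowInv_eq ht₀' hℓ₀
  have hβ' : HasFDerivAt (β ∘ (extChartAt (𝓡 n) (Hc t₀ ℓ₀).proj).symm)
      (-(extChartAt (ctgModel n) (Hc t₀ ℓ₀) (Hc t₀ ℓ₀)).2)
      (extChartAt (𝓡 n) (Hc t₀ ℓ₀).proj (Hc t₀ ℓ₀).proj) := by
    rw [← hasMFDerivAt_comp_chartDeriv_iff (mem_extChartAt_source (Hc t₀ ℓ₀).proj),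
      ContinuousLinearMap.neg_comp, ← ctg_snd_eq_comp_chartDeriv (mem_extChartAt_source (Hc t₀ ℓ₀))]
    exact hβ
  set φ := extChartAt (𝓡 n) (Hc t₀ ℓ₀).proj with hφ
  set p := (extChartAt (ctgModel n) (Hc t₀ ℓ₀) (Hc t₀ ℓ₀)).2 with hp
  set x₀ := (Hc t₀ ℓ₀).proj with hx₀
  have hx : φ.symm (φ x₀) = x₀ := extChartAt_to_inv _
  let w₀ : ℝ × EuclideanSpace ℝ (Fin n) := (t₀, φ x₀)
  -- Two quadratic estimates are added: the expansion of `α_t` in space with the momentum frozen at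
  -- `t₀`, and the time increment at the fixed point `x₀`.
  have hO : (fun w : ℝ × EuclideanSpace ℝ (Fin n) => alphaT α W H Hc w.1 (φ.symm w.2) -
      alphaT α W H Hc t₀ x₀ - p (w.2 - φ x₀)) =O[𝓝[S ×ˢ univ] w₀] fun w => ‖w - w₀‖ ^ 2 := by
    refine Asymptotics.IsBigO.of_bound (C * max (1 : ℝ) D + B) ?_
    have e1 : ∀ᶠ w : ℝ × EuclideanSpace ℝ (Fin n) in 𝓝 w₀, w.1 ∈ Icc (t₀ - ε) (t₀ + ε) ∩
        Icc (t₀ - δ) (t₀ + δ) :=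
      continuousAt_fst.eventually_mem (inter_mem
        (Icc_mem_nhds (by simp only [w₀]; linarith) (by simp only [w₀]; linarith))
        (Icc_mem_nhds (by simp only [w₀]; linarith) (by simp only [w₀]; linarith)))
    have e2 : ∀ᶠ w : ℝ × EuclideanSpace ℝ (Fin n) in 𝓝 w₀, w.2 ∈ Metric.ball (φ x₀) r :=
      continuousAt_snd.eventually_mem (Metric.ball_mem_nhds _ hr)
    filter_upwards [mem_nhdsWithin_of_mem_nhds e1, mem_nhdsWithin_of_mem_nhds e2,
      self_mem_nhdsWithin] with w h1 h2 h3
    have h4 := hw.abs_alphaT_sub_le hI hH hW hα hJo hJ hTJ ⟨h1.1, hδI h1.2⟩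
      ⟨⟨by linarith, by linarith⟩, ht₀'⟩ h2
    rw [← hx₀, hinv] at h4
    have h5 := hB t₀ ⟨by linarith, by linarith⟩ w.1 h1.2
    -- Order convexity of `S` keeps the whole interval of integration inside `S`, where the energy
    -- vanishes; hence the restriction to times in `S`.
    have h6 : ∫ τ in t₀..w.1, H τ (Hc τ (projFlowInv (graphOfD α W) Hc t₀ x₀)) = 0 := by
      rw [hinv]
      refine intervalIntegral.integral_zero_ae ?_
      have := ae_restrict_of_ae_restrict_of_subset
        (uIoc_subset_uIcc.trans (hS.uIcc_subset ht₀S h3.1)) hzero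
      rwa [ae_restrict_iff' measurableSet_uIoc] at this
    rw [h6, add_zero] at h5
    have h7 : |w.1 - t₀| ≤ ‖w - w₀‖ := norm_fst_le (w - w₀)
    have h8 : ‖w.2 - φ x₀‖ ≤ ‖w - w₀‖ := norm_snd_le (w - w₀)
    have h9 : 0 ≤ B := by
      have := hB t₀ ⟨by linarith, by linarith⟩ (t₀ + δ) ⟨by linarith, le_rfl⟩
      rw [add_sub_cancel_left] at this
      exact nonneg_of_mul_nonneg_left ((abs_nonneg _).trans this) (by positivity)
    rw [norm_pow, norm_norm, add_mul]
    have h10 := abs_add_le _ _ |>.trans (add_le_add h4 h5)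
    refine le_trans (le_of_eq (congr_arg _ ?_)) (h10.trans (add_le_add ?_ ?_))
    · simp only [← hφ, ← hp]
      ring
    · calc _ ≤ C * max ‖w - w₀‖ (D * max ‖w - w₀‖ ‖w - w₀‖) * ‖w - w₀‖ := by gcongr
        _ = C * max (1 * ‖w - w₀‖) (D * ‖w - w₀‖) * ‖w - w₀‖ := by rw [max_self, one_mul]
        _ = _ := by
          rw [← max_mul_of_nonneg _ _ (norm_nonneg _)]
          ring
    · rw [← sq_abs (w.1 - t₀)]
      gcongr
  refine HasFDerivWithinAt.of_isLittleO ?_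
  have ho : (fun w : ℝ × EuclideanSpace ℝ (Fin n) => (β ∘ φ.symm) w.2 - (β ∘ φ.symm) (φ x₀) -
      (-p) (w.2 - φ x₀)) =o[𝓝[S ×ˢ univ] w₀] fun w => w - w₀ := by
    have h1 := hβ'.isLittleO.comp_tendsto
      (show Tendsto (fun w : ℝ × EuclideanSpace ℝ (Fin n) => w.2) (𝓝[S ×ˢ univ] w₀) (𝓝 (φ x₀)) from
        (continuous_snd.tendsto w₀).mono_left nhdsWithin_le_nhds)
    exact h1.trans_isBigO (Asymptotics.IsBigO.of_bound 1 (Eventually.of_forall fun w => by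
      rw [one_mul]
      exact norm_snd_le (w - w₀)))
  have hs := ho.add (hO.trans_isLittleO
    ((Asymptotics.isLittleO_pow_sub_sub w₀ one_lt_two).mono nhdsWithin_le_nhds))
  refine hs.congr_left fun w => ?_
  simp only [Phi, Function.comp, hx, neg_apply, zero_apply]
  ring

/-- Hamiltonian vectors are unique, so the vector shared by the two Hamiltonians is the velocity of
the extremal. The uniqueness of the flow of `H` can then be applied to `lam`. -/
theorem ControlProblem.PMP.isHamSolution {m : ℕ} {P : ControlProblem n m M} {freeTime : Prop}
    {p₀ : ℝ} {S : Set ℝ} {u : ℝ → EuclideanSpace ℝ (Fin m)} {Λ : Set (Ctg n M)}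
    (hP : P.PMP freeTime p₀ Tf S u lam) (hs : P.SuperHamiltonian p₀ S u lam H O Λ Hc) :
    IsHamSolution H O S lam := by
  refine ⟨hP.solution.1, hs.mem_O, ?_⟩
  filter_upwards [hP.solution.2.2, hs.hamVec_along] with t h1 h2
  obtain ⟨X, hX, hX'⟩ := h1
  obtain ⟨Y, hY, hY'⟩ := h2
  exact ⟨Y, hY, hX.unique hY' ▸ hX'⟩
end

/-! ### Conclusion. -/

theorem lemma3p7
    {n m : ℕ} {M : Type*} [TopologicalSpace M] [T2Space M] [ParacompactSpace M]
    [ConnectedSpace M] [ChartedSpace (EuclideanSpace ℝ (Fin n)) M] [IsManifold (𝓡 n) ∞ M]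
    -- the problem, the reference extremal, and the time intervals `[0, Tf] ⊆ S ⊆ J`, `[0, T] ⊆ J`
    (P : ControlProblem n m M) (freeTime : Prop) (p₀ Tf T : ℝ) (J S : Set ℝ)
    (u : ℝ → EuclideanSpace ℝ (Fin m)) (lam : ℝ → Ctg n M)
    (hTf : 0 < Tf) (hT : Tf < T)
    (hJo : IsOpen J) (hJc : J.OrdConnected) (hTJ : Icc 0 T ⊆ J)
    (hSc : S.OrdConnected) (hTS : Icc 0 Tf ⊆ S) (hSJ : S ⊆ J)
    (hPMP : P.PMP freeTime p₀ Tf S u lam)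
    -- the local extensions `α` of `p₀ c₀` and `β` of `p₀ c_f`
    (α β : M → ℝ) (W V : Set M)
    (hW : IsOpen W) (hxW : (lam 0).proj ∈ W) (hαs : ContMDiffOn (𝓡 n) 𝓘(ℝ, ℝ) ∞ α W)
    (hα : ∀ x ∈ P.N₀ ∩ W, α x = p₀ * P.c₀ x)
    (hαd : (lam 0).2 = covec α (lam 0).proj)
    (hV : IsOpen V) (hxV : (lam Tf).proj ∈ V) (hβs : ContMDiffOn (𝓡 n) 𝓘(ℝ, ℝ) ∞ β V)
    (hβ : ∀ x ∈ P.Nf ∩ V, β x = p₀ * P.cf x)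
    (hβd : (lam Tf).2 = -covec β (lam Tf).proj)
    -- the three assumptions on the super-Hamiltonian, with `Λ = {dα(x) : x ∈ W}`
    (H : ℝ → Ctg n M → ℝ) (O : Set (Ctg n M)) (Hc : ℝ → Ctg n M → Ctg n M) (𝒰 : Set (ℝ × M))
    (hHam : HamiltonianAssumption α W H J O Hc)
    (hSuper : P.SuperHamiltonian p₀ S u lam H O (graphOfD α W) Hc)
    (hInv : ProjFlowInvertible Tf T lam (graphOfD α W) Hc 𝒰) :
    -- `∂ₓΦ(t, x) = dβ(x) + Hc_t((π Hc_t)⁻¹(x)) = d(β + α_t)(x)`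
    (∀ t x, (t, x) ∈ 𝒰 → x ∈ V →
      ∃ q : TangentSpace (𝓡 n) x →L[ℝ] ℝ,
        Hc t (projFlowInv (graphOfD α W) Hc t x) = (⟨x, q⟩ : Ctg n M) ∧
        HasMFDerivAt (𝓡 n) 𝓘(ℝ, ℝ) (alphaT α W H Hc t) x q ∧
        HasMFDerivAt (𝓡 n) 𝓘(ℝ, ℝ) (Phi α β W H Hc t) x (covec β x + q) ∧
        covec (fun y => β y + alphaT α W H Hc t y) x = covec β x + q) ∧
    -- `∂ₜΦ(t, x) = -H_t(Hc_t((π Hc_t)⁻¹(x))) = -H_t(dα_t(x))` for a.e. `t`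
    (∀ x, ∀ᵐ t ∂volume.restrict (Icc 0 T), (t, x) ∈ 𝒰 →
      HasDerivAt (fun s => Phi α β W H Hc s x)
        (-H t (Hc t (projFlowInv (graphOfD α W) Hc t x))) t ∧
      H t (Hc t (projFlowInv (graphOfD α W) Hc t x)) = H t (dAt (alphaT α W H Hc t) x)) ∧
    -- `(Tf, ξ̂(Tf))` is a critical point
    HasMFDerivAt (𝓡 n) 𝓘(ℝ, ℝ) (Phi α β W H Hc Tf) (lam Tf).proj 0 ∧
    (freeTime →
      HasMFDerivWithinAt (𝓘(ℝ, ℝ).prod (𝓡 n)) 𝓘(ℝ, ℝ)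
        (fun q : ℝ × M => Phi α β W H Hc q.1 q.2) (S ×ˢ univ) (Tf, (lam Tf).proj) 0) := by
  have ht0 : (0 : ℝ) ∈ S := hTS ⟨le_rfl, hTf.le⟩
  have htf : Tf ∈ S := hTS ⟨hTf.le, le_rfl⟩
  have hΛ : lam 0 ∈ graphOfD α W := by
    refine ⟨(lam 0).proj, hxW, ?_⟩
    rw [dAt, ← hαd]
  -- The reference extremal is a trajectory of the super-Hamiltonian flow starting on `Λ`.
  have hlam : EqOn lam (fun t => Hc t (lam 0)) S :=
    (hHam.flow _ hΛ).2.2 S hSc ht0 hSJ lam rfl (hPMP.isHamSolution hSuper)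
  have hone : ∀ t x, (t, x) ∈ 𝒰 → x ∈ V →
      ∃ q : TangentSpace (𝓡 n) x →L[ℝ] ℝ,
        Hc t (projFlowInv (graphOfD α W) Hc t x) = (⟨x, q⟩ : Ctg n M) ∧
        HasMFDerivAt (𝓡 n) 𝓘(ℝ, ℝ) (alphaT α W H Hc t) x q ∧
        HasMFDerivAt (𝓡 n) 𝓘(ℝ, ℝ) (Phi α β W H Hc t) x (covec β x + q) ∧
        covec (fun y => β y + alphaT α W H Hc t y) x = covec β x + q := by
    intro t x hU hx
    obtain ⟨h1, h2⟩ := hInv.projFlowInv_spec hU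
    have h3 := hasMFDerivAt_alphaT hInv hHam hW hαs hJo hJc hTJ (hInv.mem_Icc hU) h1
    -- The covector lives over the projection of this point; generalising allows `x` to be replaced
    -- by that projection.
    generalize Hc t (projFlowInv (graphOfD α W) Hc t x) = z at h2 h3
    subst h2
    have h4 := (hasMFDerivAt_dAt hV hβs hx).add h3
    exact ⟨z.2, rfl, h3, h4, h4.mfderiv⟩
  have hUf := hInv.graph_mem Tf ⟨hTf.le, le_rfl⟩
  have hlamf : lam Tf = Hc Tf (lam 0) := hlam htf
  have hproj : (lam Tf).proj = (Hc Tf (lam 0)).proj := congr_arg _ hlamf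
  have hTfI : Tf ∈ Icc 0 T := ⟨hTf.le, hT.le⟩
  have hinv : projFlowInv (graphOfD α W) Hc Tf (lam Tf).proj = lam 0 := by
    rw [hproj, hInv.projFlowInv_eq hTfI hΛ]
  refine ⟨hone, fun x => ?_, ?_, fun hfree => ?_⟩
  · filter_upwards [ae_hasDerivAt_alphaT hInv hHam hW hαs hJo hJc hTJ x] with t ht hU
    refine ⟨(ht hU).const_add (β x), ?_⟩
    obtain ⟨h1, h2⟩ := hInv.projFlowInv_spec hU
    have h3 := hasMFDerivAt_alphaT hInv hHam hW hαs hJo hJc hTJ (hInv.mem_Icc hU) h1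
    congr 1
    generalize Hc t (projFlowInv (graphOfD α W) Hc t x) = z at h2 h3
    subst h2
    rw [dAt, covec, h3.mfderiv]
  · obtain ⟨q, h1, -, h3, -⟩ := hone Tf _ hUf hxV
    rw [hinv, ← hlamf] at h1
    have hq : (lam Tf).2 = q := eq_of_heq (Bundle.TotalSpace.mk.inj h1).2
    have h4 : covec β (lam Tf).proj + q = 0 := by rw [← hq, hβd, add_neg_cancel]
    exact (congrArg (fun g : TangentSpace (𝓡 n) (lam Tf).proj →L[ℝ] ℝ =>
      HasMFDerivAt (𝓡 n) 𝓘(ℝ, ℝ) (Phi α β W H Hc Tf) (lam Tf).proj g) h4).mp h3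
  · obtain ⟨c, hc, hc'⟩ := hPMP.constant
    have hβ' : HasMFDerivAt (𝓡 n) 𝓘(ℝ, ℝ) β (Hc Tf (lam 0)).proj
        (-(Hc Tf (lam 0)).2 : EuclideanSpace ℝ (Fin n) →L[ℝ] ℝ) := by
      have h4 := hasMFDerivAt_dAt hV hβs hxV
      have h5 : covec β (lam Tf).proj = -(lam Tf).2 := by rw [hβd, neg_neg]
      rw [h5] at h4
      rw [← hlamf]
      exact h4
    rw [hproj]
    -- The energy along the extremal is the reference pre-Hamiltonian, which is constant, and the
    -- constant is zero when the final time is free.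
    refine hasMFDerivWithinAt_Phi hInv hHam hW hαs hJo hJc hTJ ⟨hTf, hT⟩ hΛ hβ' hSc htf ?_
    filter_upwards [hc', hSuper.eq_along, ae_restrict_mem hSc.measurableSet] with t h1 h2 hS
    have h3 : lam t = Hc t (lam 0) := hlam hS
    rw [← h3, h2.1, h1, hc hfree]
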